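/- Let $p$ be a prime, $k$ an algebraically closed field of characteristic $p$, and $W$ its ring of Witt vectors. Let $\mathcal{O}$ be (the ring of integers of) a finite totally ramified extension of $W$, equipped with an automorphism $\sigma$ lifting the Frobenius of $W$, and let $|\cdot|$ be the $p$-adic absolute value on $\mathcal{O}[\frac1p]$ with $|p|=p^{-1}$. Consider the following rings of Laurent series. * $\Gamma_{\mathrm{an,con}}$ is the ring of series $\sum_{n\in\mathbb{Z}} c_n t^n$ with $c_n\in\mathcal{O}[\frac1p]$ such that $\limsup_{n\to+\infty}|c_n|^{1/n}\le 1$ and, for some $c,d>0$, $|c_n|\le p^{cn+d}$ for all $n\le 0$. * $\Gamma_{\mathrm{con}}$ is the subring of those series in $\Gamma_{\mathrm{an,con}}$ with all $c_n\in\mathcal{O}$ (the overconvergent series over $\mathcal{O}$). * $\Omega=\mathcal{O}[[t]]\subset\Gamma_{\mathrm{con}}$. Each of them carries the standard Frobenius $\sigma\colon\sum c_n t^n\mapsto\sum c_n^{\sigma}t^{pn}$. For $R$ one of these rings, an $F$-crystal over $R$ is a finite locally free $R$-module $M$ with an additive $\sigma$-linear map $F\colon M\to M$ such that, for some $\ell\in\mathbb{N}$,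 $p^\ell$ annihilates the kernel and the cokernel of the induced $R$-linear map $M\otimes_{R,\sigma}R\to M$. A morphism is an $R$-linear map commuting with $F$; $M_1$ and $M_2$ are isogenous if there are morphisms $f\colon M_1\to M_2$ and $g\colon M_2\to M_1$ such that $g\circ f$ and $f\circ g$ are multiplication by the same nonzero scalar of $R$. The base change along $R\to R'$ is $R'\otimes_R M$ with $F(s\otimes m)=s^\sigma\otimes F(m)$. A trivial $F$-crystal over $R$ is $R$ itself with $F(x)=c\,x^\sigma$, where $0\ne c\in\mathcal{O}$. An $F$-crystal over $\Gamma_{\mathrm{con}}$ is semistable if it is isogenous over $\Gamma_{\mathrm{con}}$ to the base change of an $F$-crystal over $\Omega$. An $F$-crystal over $\Gamma_{\mathrm{an,con}}$ is constant if there is an extension $\mathcal{O}'$ of $\mathcal{O}$, again finite totally ramified over $W$ and equipped with an automorphism extending $\sigma$, such that its base change to the ring $\Gamma_{\mathrm{an,con}}$ formed with $\mathcal{O}'$ in place of $\mathcal{O}$ is isogenous to a finite direct sum of trivial $F$-crystals (with constants $c\in\mathcal{O}'$). **Theorem.** Let $M$ be an $F$-crystal over $\Gamma_{\mathrm{con}}$.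 Then $M$ is semistable if and only if its base change to $\Gamma_{\mathrm{an,con}}$ is constant. -/

import Mathlib

universe u v

noncomputable section

/-! ### Laurent series converging on some annulus `r < |t| < 1` -/

namespace OverconvergentCrystal

/-- The growth conditions on the coefficients of `∑ xₙ tⁿ` (`n ∈ ℤ`): for `n → +∞` the series
converges on the open unit disc (that is, `limsup |xₙ|^(1/n) ≤ 1`), and for `n → -∞` one has
`|xₙ| ≤ p^(cn+d)` for some `c, d > 0` (write `r = p^(-c)`, `C = p^d`). -/
def IsAnCon {E : Type u} [NormedField E] (x : ℤ → E) : Prop :=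
  (∀ r : ℝ, 0 < r → r < 1 → ∃ C : ℝ, ∀ n : ℕ, ‖x n‖ * r ^ n ≤ C) ∧
    ∃ r : ℝ, 0 < r ∧ r < 1 ∧ ∃ C : ℝ, ∀ n : ℕ, ‖x (-n)‖ ≤ C * r ^ n

section Basic

variable {E : Type u} [NormedField E]

theorem IsAnCon.exists_summable {x : ℤ → E} (hx : IsAnCon x) :
    ∃ r₀ : ℝ, 0 < r₀ ∧ r₀ < 1 ∧
      ∀ r : ℝ, r₀ < r → r < 1 → Summable fun i : ℤ => ‖x i‖ * r ^ i := by
  obtain ⟨h1, r₀, h0, h01, C, hC⟩ := hx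
  refine ⟨r₀, h0, h01, fun r hr hr1 => ?_⟩
  have hrpos : 0 < r := h0.trans hr
  refine Summable.of_nat_of_neg ?_ ?_
  · obtain ⟨D, hD⟩ := h1 ((r + 1) / 2) (by linarith) (by linarith)
    have hs : 0 < (r + 1) / 2 := by linarith
    refine Summable.of_nonneg_of_le (fun n => by positivity) (fun n => ?_)
      ((summable_geometric_of_lt_one (r := r / ((r + 1) / 2)) (by positivity)
        (by rw [div_lt_one hs]; linarith)).mul_left D)
    have := hD n
    rw [zpow_natCast, div_pow]
    calc ‖x n‖ * r ^ n = (‖x n‖ * ((r + 1) / 2) ^ n) * (r ^ n / ((r + 1) / 2) ^ n) := by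
          field_simp
      _ ≤ _ := by gcongr
  · refine Summable.of_nonneg_of_le (fun n => by positivity) (fun n => ?_)
      ((summable_geometric_of_lt_one (r := r₀ / r) (by positivity)
        (by rwa [div_lt_one hrpos])).mul_left C)
    rw [zpow_neg, zpow_natCast, div_pow]
    calc ‖x (-n)‖ * (r ^ n)⁻¹ ≤ (C * r₀ ^ n) * (r ^ n)⁻¹ := by gcongr; exact hC n
      _ = _ := by field_simp

theorem isAnCon_of_summable {x : ℤ → E} {r₀ : ℝ} (h0 : 0 < r₀) (h01 : r₀ < 1)
    (h : ∀ r : ℝ, r₀ < r → r < 1 → Summable fun i : ℤ => ‖x i‖ * r ^ i) : IsAnCon x := by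
  have key : ∀ r : ℝ, r₀ < r → r < 1 → ∃ C : ℝ, ∀ i : ℤ, ‖x i‖ * r ^ i ≤ C := by
    intro r hr hr1
    have hrpos : 0 < r := h0.trans hr
    refine ⟨_, fun i => (h r hr hr1).le_tsum i fun j _ => ?_⟩
    positivity
  refine ⟨fun r hr hr1 => ?_, (r₀ + 1) / 2, by linarith, by linarith, ?_⟩
  · obtain ⟨C, hC⟩ := key (max r ((r₀ + 1) / 2)) (lt_max_of_lt_right (by linarith))
      (max_lt hr1 (by linarith))
    refine ⟨C, fun n => le_trans ?_ (hC n)⟩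
    rw [zpow_natCast]
    gcongr
    exact le_max_left _ _
  · have hp : 0 < (r₀ + 1) / 2 := by linarith
    obtain ⟨C, hC⟩ := key ((r₀ + 1) / 2) (by linarith) (by linarith)
    refine ⟨C, fun n => ?_⟩
    have := hC (-n)
    rw [zpow_neg, zpow_natCast] at this
    rwa [← div_eq_mul_inv, div_le_iff₀ (by positivity)] at this

/-- A common radius for two series. -/
theorem IsAnCon.exists_summable₂ {x y : ℤ → E} (hx : IsAnCon x) (hy : IsAnCon y) :
    ∃ r₀ : ℝ, 0 < r₀ ∧ r₀ < 1 ∧ ∀ r : ℝ, r₀ < r → r < 1 →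
      (Summable fun i : ℤ => ‖x i‖ * r ^ i) ∧ Summable fun i : ℤ => ‖y i‖ * r ^ i := by
  obtain ⟨r, h0, h1, h⟩ := hx.exists_summable
  obtain ⟨s, h0', h1', h'⟩ := hy.exists_summable
  exact ⟨max r s, lt_max_of_lt_left h0, max_lt h1 h1', fun q hq hq1 =>
    ⟨h q ((le_max_left _ _).trans_lt hq) hq1, h' q ((le_max_right _ _).trans_lt hq) hq1⟩⟩

theorem IsAnCon.add {x y : ℤ → E} (hx : IsAnCon x) (hy : IsAnCon y) : IsAnCon (x + y) := by
  obtain ⟨r₀, h0, h1, h⟩ := hx.exists_summable₂ hy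
  refine isAnCon_of_summable h0 h1 fun r hr hr1 => ?_
  have hrpos : 0 < r := h0.trans hr
  refine Summable.of_nonneg_of_le (fun n => by positivity) (fun n => ?_)
    ((h r hr hr1).1.add (h r hr hr1).2)
  rw [← add_mul]
  gcongr
  exact norm_add_le _ _

theorem isAnCon_single (a : E) : IsAnCon (Pi.single (0 : ℤ) a) := by
  refine isAnCon_of_summable (r₀ := 1 / 2) (by norm_num) (by norm_num) fun r _ _ => ?_
  refine summable_of_ne_finset_zero (s := {0}) fun i hi => ?_
  have : i ≠ 0 := by simpa using hi
  simp [Pi.single_eq_of_ne this]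

theorem isAnCon_zero : IsAnCon (0 : ℤ → E) := by
  simpa using isAnCon_single (0 : E)

theorem IsAnCon.neg {x : ℤ → E} (hx : IsAnCon x) : IsAnCon (-x) := by
  simpa [IsAnCon] using hx

/-- `(i, j) ↦ i + j`, as a change of coordinates `(n, i) ↦ (i, n - i)`. -/
def shear : ℤ × ℤ ≃ ℤ × ℤ where
  toFun q := (q.2, q.1 - q.2)
  invFun q := (q.1 + q.2, q.1)
  left_inv q := by ext <;> simp
  right_inv q := by ext <;> simp

theorem IsAnCon.summable_norm_mul {x y : ℤ → E} (hx : IsAnCon x) (hy : IsAnCon y) (n : ℤ) :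
    Summable fun i : ℤ => ‖x i * y (n - i)‖ := by
  obtain ⟨r₀, h0, h1, h⟩ := hx.exists_summable₂ hy
  obtain ⟨r, hr, hr1⟩ := exists_between h1
  have hrpos : 0 < r := h0.trans hr
  have h2 := (h r hr hr1).1.mul_of_nonneg (h r hr hr1).2 (fun i => by positivity)
    (fun i => by positivity)
  have h3 := ((shear.summable_iff.mpr h2).prod_factor n).mul_right (r ^ n)⁻¹
  refine h3.congr fun i => ?_
  have : r ^ n = r ^ i * r ^ (n - i) := by rw [← zpow_add₀ hrpos.ne']; congr 1; ring
  simp only [Function.comp, shear, Equiv.coe_fn_mk, norm_mul, this]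
  have h4 : r ^ i ≠ 0 := (zpow_pos hrpos _).ne'
  have h5 : r ^ (n - i) ≠ 0 := (zpow_pos hrpos _).ne'
  field_simp

/-- The Cauchy product of two Laurent series. -/
def conv (x y : ℤ → E) (n : ℤ) : E := ∑' i : ℤ, x i * y (n - i)

theorem IsAnCon.conv {x y : ℤ → E} (hx : IsAnCon x) (hy : IsAnCon y) : IsAnCon (conv x y) := by
  obtain ⟨r₀, h0, h1, h⟩ := hx.exists_summable₂ hy
  refine isAnCon_of_summable h0 h1 fun r hr hr1 => ?_
  have hrpos : 0 < r := h0.trans hr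
  have h2 := (h r hr hr1).1.mul_of_nonneg (h r hr hr1).2 (fun i => by positivity)
    (fun i => by positivity)
  refine Summable.of_nonneg_of_le (fun n => by positivity) (fun n => ?_)
    (shear.summable_iff.mpr h2).prod
  calc ‖OverconvergentCrystal.conv x y n‖ * r ^ n
      ≤ (∑' i : ℤ, ‖x i * y (n - i)‖) * r ^ n := by
        gcongr
        exact norm_tsum_le_tsum_norm (hx.summable_norm_mul hy n)
    _ = _ := by
        rw [← tsum_mul_right]
        refine tsum_congr fun i => ?_
        have : r ^ n = r ^ i * r ^ (n - i) := by rw [← zpow_add₀ hrpos.ne']; congr 1; ring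
        simp only [Function.comp, shear, Equiv.coe_fn_mk, norm_mul, this]
        ring

theorem conv_comm (x y : ℤ → E) : conv x y = conv y x := by
  funext n
  unfold conv
  rw [← (Equiv.subLeft n).tsum_eq]
  refine tsum_congr fun i => ?_
  simp [mul_comm]

theorem conv_one (x : ℤ → E) : conv x (Pi.single 0 1) = x := by
  funext n
  unfold conv
  rw [tsum_eq_single n]
  · simp
  · intro i hi
    have : n - i ≠ 0 := sub_ne_zero.mpr hi.symm
    simp [Pi.single_eq_of_ne this]

theorem conv_add [CompleteSpace E] {x y z : ℤ → E} (hx : IsAnCon x) (hy : IsAnCon y)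
    (hz : IsAnCon z) : conv x (y + z) = conv x y + conv x z := by
  funext n
  simp only [conv, Pi.add_apply, mul_add]
  exact (hx.summable_norm_mul hy n).of_norm.tsum_add (hx.summable_norm_mul hz n).of_norm

theorem conv_assoc [CompleteSpace E] {x y z : ℤ → E} (hx : IsAnCon x) (hy : IsAnCon y)
    (hz : IsAnCon z) : conv (conv x y) z = conv x (conv y z) := by
  funext n
  have hs : Summable (Function.uncurry fun i m : ℤ => x i * y (m - i) * z (n - m)) := by
    obtain ⟨r₀, h0, h1, h⟩ := hx.exists_summable₂ hy
    obtain ⟨s₀, k0, k1, k⟩ := hz.exists_summable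
    obtain ⟨r, hr, hr1⟩ := exists_between (max_lt h1 k1)
    have hr0 := (le_max_left _ _).trans_lt hr
    have hrpos : 0 < r := h0.trans hr0
    have h2 := (h r hr0 hr1).1.mul_of_nonneg (h r hr0 hr1).2 (fun i => by positivity)
      (fun i => by positivity)
    have hzs := k r ((le_max_right _ _).trans_lt hr) hr1
    have h3 := (shear.summable_iff.mpr h2)
    have h4 := (Equiv.prodComm ℤ ℤ).summable_iff.mpr h3
    refine Summable.of_norm (Summable.of_nonneg_of_le (fun _ => norm_nonneg _) ?_
      (h4.mul_right ((∑' i : ℤ, ‖z i‖ * r ^ i) * (r ^ n)⁻¹)))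
    rintro ⟨i, m⟩
    have hz' := hzs.le_tsum (n - m) fun j _ => by positivity
    have e1 : r ^ n = r ^ i * r ^ (m - i) * r ^ (n - m) := by
      rw [← zpow_add₀ hrpos.ne', ← zpow_add₀ hrpos.ne']; congr 1; ring
    have p1 : 0 < r ^ i := zpow_pos hrpos _
    have p2 : 0 < r ^ (m - i) := zpow_pos hrpos _
    have p3 : 0 < r ^ (n - m) := zpow_pos hrpos _
    simp only [Function.comp, shear, Equiv.coe_fn_mk, norm_mul, Function.uncurry,
      Equiv.prodComm_apply, Prod.swap]
    calc ‖x i‖ * ‖y (m - i)‖ * ‖z (n - m)‖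
        = ‖x i‖ * r ^ i * (‖y (m - i)‖ * r ^ (m - i)) *
            ((‖z (n - m)‖ * r ^ (n - m)) * (r ^ n)⁻¹) := by
          rw [e1]; field_simp
      _ ≤ _ := by gcongr
  calc conv (conv x y) z n = ∑' m : ℤ, ∑' i : ℤ, x i * y (m - i) * z (n - m) := by
        simp only [conv, tsum_mul_right]
    _ = ∑' i : ℤ, ∑' m : ℤ, x i * y (m - i) * z (n - m) := hs.tsum_comm
    _ = conv x (conv y z) n := by
        simp only [conv]
        refine tsum_congr fun i => ?_
        rw [← tsum_mul_left, ← (Equiv.addRight i).tsum_eq]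
        refine tsum_congr fun j => ?_
        simp only [Equiv.coe_addRight, add_sub_cancel_right]
        rw [mul_assoc]
        congr 3
        ring

variable (E) in
/-- The additive group of Laurent series satisfying `IsAnCon`. -/
def anConAddSubgroup : AddSubgroup (ℤ → E) where
  carrier := {x | IsAnCon x}
  zero_mem' := isAnCon_zero
  add_mem' hx hy := IsAnCon.add hx hy
  neg_mem' hx := IsAnCon.neg hx

variable (E) in
/-- The ring of Laurent series `∑ xₙ tⁿ` (`n ∈ ℤ`) with coefficients in `E` that converge on
some annulus `r < |t| < 1`, with the usual sum and the Cauchy product. -/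
def AnCon : Type u := anConAddSubgroup E

namespace AnCon

instance : AddCommGroup (AnCon E) := inferInstanceAs (AddCommGroup (anConAddSubgroup E))

/-- The coefficient of `tⁿ`. -/
def coeff (x : AnCon E) (n : ℤ) : E := x.1 n

theorem isAnCon (x : AnCon E) : IsAnCon x.coeff := x.2

/-- A series from its coefficients. -/
def mk (x : ℤ → E) (hx : IsAnCon x) : AnCon E := ⟨x, hx⟩

@[simp] theorem coeff_mk (x : ℤ → E) (hx : IsAnCon x) : (mk x hx).coeff = x := rfl

@[ext] theorem ext {x y : AnCon E} (h : ∀ n, x.coeff n = y.coeff n) : x = y :=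
  Subtype.ext (funext h)

@[simp] theorem coeff_zero : (0 : AnCon E).coeff = 0 := rfl

@[simp] theorem coeff_add (x y : AnCon E) : (x + y).coeff = x.coeff + y.coeff := rfl

@[simp] theorem coeff_neg (x : AnCon E) : (-x).coeff = -x.coeff := rfl

instance : One (AnCon E) := ⟨mk (Pi.single 0 1) (isAnCon_single 1)⟩

instance : Mul (AnCon E) := ⟨fun x y => mk (conv x.coeff y.coeff) (x.isAnCon.conv y.isAnCon)⟩

@[simp] theorem coeff_one : (1 : AnCon E).coeff = Pi.single 0 1 := rfl

@[simp] theorem coeff_mul (x y : AnCon E) : (x * y).coeff = conv x.coeff y.coeff := rfl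

theorem coeff_mul_apply (x y : AnCon E) (n : ℤ) :
    (x * y).coeff n = ∑' i : ℤ, x.coeff i * y.coeff (n - i) := rfl

theorem coeff_injective : Function.Injective (coeff : AnCon E → ℤ → E) :=
  fun _ _ h => ext (congrFun h)

instance [CompleteSpace E] : CommRing (AnCon E) where
  __ := (inferInstance : AddCommGroup (AnCon E))
  mul_assoc x y z := coeff_injective (conv_assoc x.isAnCon y.isAnCon z.isAnCon)
  mul_comm x y := coeff_injective (conv_comm _ _)
  one_mul x := coeff_injective ((conv_comm _ _).trans (conv_one _))
  mul_one x := coeff_injective (conv_one _)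
  left_distrib x y z := coeff_injective (conv_add x.isAnCon y.isAnCon z.isAnCon)
  right_distrib x y z := coeff_injective <| by
    simp only [coeff_mul, coeff_add]
    rw [conv_comm, conv_add z.isAnCon x.isAnCon y.isAnCon, conv_comm z.coeff,
      conv_comm z.coeff]
  zero_mul x := coeff_injective <| by funext n; simp [conv]
  mul_zero x := coeff_injective <| by funext n; simp [conv]

end AnCon

end Basic

section Functoriality

variable {E : Type u} [NormedField E]
variable {E' : Type u} [NormedField E']

theorem IsAnCon.map {f : E →+* E'} (hf : ∀ a, ‖f a‖ = ‖a‖) {x : ℤ → E} (hx : IsAnCon x) :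
    IsAnCon fun n => f (x n) := by
  simpa only [IsAnCon, hf] using hx

/-- The ring homomorphism `∑ xₙ tⁿ ↦ ∑ f(xₙ) tⁿ` given by an isometric embedding `f` of the
coefficient fields. -/
def AnCon.map [CompleteSpace E] [CompleteSpace E'] (f : E →+* E') (hf : ∀ a, ‖f a‖ = ‖a‖) :
    AnCon E →+* AnCon E' where
  toFun x := AnCon.mk (fun n => f (x.coeff n)) (x.isAnCon.map hf)
  map_zero' := by ext n; simp
  map_one' := by
    ext n
    rcases eq_or_ne n 0 with rfl | h
    · simp
    · simp [Pi.single_eq_of_ne h]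
  map_add' x y := by ext n; simp
  map_mul' x y := by
    ext n
    have hc : Continuous f := (AddMonoidHomClass.isometry_of_norm f hf).continuous
    simp only [AnCon.coeff_mk, AnCon.coeff_mul, conv]
    rw [(x.isAnCon.summable_norm_mul y.isAnCon n).of_norm.map_tsum f hc]
    simp only [map_mul]

/-- The coefficients of `∑ xₙ t^(qn)`. -/
def expandCoeff (q : ℕ) (x : ℤ → E) (n : ℤ) : E := if (q : ℤ) ∣ n then x (n / q) else 0

theorem expandCoeff_mul {q : ℕ} (hq : q ≠ 0) (x : ℤ → E) (n : ℤ) :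
    expandCoeff q x (q * n) = x n := by
  have hq' : (q : ℤ) ≠ 0 := by exact_mod_cast hq
  simp [expandCoeff, Int.mul_ediv_cancel_left _ hq']

theorem expandCoeff_of_not_dvd {q : ℕ} (x : ℤ → E) {n : ℤ} (h : ¬ (q : ℤ) ∣ n) :
    expandCoeff q x n = 0 := by
  simp [expandCoeff, h]

theorem IsAnCon.expand {q : ℕ} (hq : q ≠ 0) {x : ℤ → E} (hx : IsAnCon x) :
    IsAnCon (expandCoeff q x) := by
  have hq' : (q : ℤ) ≠ 0 := by exact_mod_cast hq
  obtain ⟨r₀, h0, h1, h⟩ := hx.exists_summable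
  have hqpos : (0 : ℝ) < q := by exact_mod_cast Nat.pos_of_ne_zero hq
  have hroot : (r₀ ^ ((q : ℝ)⁻¹)) ^ q = r₀ := Real.rpow_inv_natCast_pow h0.le hq
  have s0 : 0 < r₀ ^ ((q : ℝ)⁻¹) := by positivity
  refine isAnCon_of_summable s0 (Real.rpow_lt_one h0.le h1 (by positivity)) fun r hr hr1 => ?_
  have hrpos : 0 < r := s0.trans hr
  have hsum := h (r ^ q) (by
    rw [← hroot]; exact pow_lt_pow_left₀ hr s0.le hq) (pow_lt_one₀ hrpos.le hr1 hq)
  have hinj : Function.Injective fun n : ℤ => (q : ℤ) * n := fun a b hab => by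
    simpa [hq] using hab
  refine (hinj.summable_iff ?_).mp (hsum.congr fun n => ?_)
  · intro n hn
    have : ¬ (q : ℤ) ∣ n := fun ⟨m, hm⟩ => hn ⟨m, hm.symm⟩
    simp [expandCoeff_of_not_dvd x this]
  · simp only [Function.comp]
    rw [expandCoeff_mul hq, zpow_mul, zpow_natCast]

/-- The ring homomorphism `∑ xₙ tⁿ ↦ ∑ xₙ t^(qn)`, for `q ≥ 1`. -/
def AnCon.expand [CompleteSpace E] (q : ℕ) (hq : q ≠ 0) : AnCon E →+* AnCon E where
  toFun x := AnCon.mk (expandCoeff q x.coeff) (x.isAnCon.expand hq)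
  map_zero' := by ext n; simp [expandCoeff]
  map_one' := by
    ext n
    by_cases hn : (q : ℤ) ∣ n
    · obtain ⟨m, rfl⟩ := hn
      rw [AnCon.coeff_mk, expandCoeff_mul hq]
      rcases eq_or_ne m 0 with rfl | h
      · simp
      · have : (q : ℤ) * m ≠ 0 := mul_ne_zero (by exact_mod_cast hq) h
        simp [Pi.single_eq_of_ne h, Pi.single_eq_of_ne this]
    · have : n ≠ 0 := by rintro rfl; exact hn (dvd_zero _)
      simp [expandCoeff_of_not_dvd _ hn, Pi.single_eq_of_ne this]
  map_add' x y := by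
    ext n
    by_cases hn : (q : ℤ) ∣ n <;> simp [expandCoeff, hn]
  map_mul' x y := by
    ext n
    have hinj : Function.Injective fun n : ℤ => (q : ℤ) * n := fun a b hab => by
      simpa [hq] using hab
    simp only [AnCon.coeff_mk, AnCon.coeff_mul]
    have hsupp : Function.support
        (fun i => expandCoeff q x.coeff i * expandCoeff q y.coeff (n - i)) ⊆
          Set.range fun n : ℤ => (q : ℤ) * n := by
      intro i hi
      by_contra hi'
      have : ¬ (q : ℤ) ∣ i := fun ⟨m, hm⟩ => hi' ⟨m, hm.symm⟩
      exact hi (by simp [expandCoeff_of_not_dvd _ this])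
    rw [conv, ← hinj.tsum_eq hsupp]
    by_cases hn : (q : ℤ) ∣ n
    · obtain ⟨m, rfl⟩ := hn
      rw [expandCoeff_mul hq, conv]
      refine tsum_congr fun i => ?_
      rw [expandCoeff_mul hq, ← mul_sub, expandCoeff_mul hq]
    · rw [expandCoeff_of_not_dvd _ hn]
      symm
      convert tsum_zero with i
      have : ¬ (q : ℤ) ∣ n - q * i := fun h => hn ((dvd_sub_left (dvd_mul_right _ _)).mp h)
      rw [expandCoeff_of_not_dvd _ this, mul_zero]

end Functoriality

/-! ### Coefficient rings -/

/-- A coefficient ring: a finite totally ramified extension `𝒪` of the ring of Witt vectors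
`W(k)` (again a discrete valuation ring, with the same residue field), together with an
automorphism `σ` lifting the Frobenius of `W(k)`. -/
structure CoeffRing (p : ℕ) [Fact p.Prime] (k : Type v) [Field k] [IsAlgClosed k] [CharP k p] where
  /-- the underlying ring -/
  carrier : Type u
  [commRing : CommRing carrier]
  [isDomain : IsDomain carrier]
  [isDVR : IsDiscreteValuationRing carrier]
  [algebra : Algebra (WittVector p k) carrier]
  [finite : Module.Finite (WittVector p k) carrier]
  algebraMap_injective : Function.Injective (algebraMap (WittVector p k) carrier)
  residue_surjective : Function.Surjective fun w : WittVector p k =>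
    IsLocalRing.residue carrier (algebraMap (WittVector p k) carrier w)
  /-- the chosen automorphism -/
  σ : carrier ≃+* carrier
  σ_algebraMap : ∀ w : WittVector p k,
    σ (algebraMap (WittVector p k) carrier w) =
      algebraMap (WittVector p k) carrier (WittVector.frobenius w)

attribute [instance] CoeffRing.commRing CoeffRing.isDomain CoeffRing.isDVR CoeffRing.algebra
  CoeffRing.finite

namespace CoeffRing

variable {p : ℕ} [Fact p.Prime] {k : Type v} [Field k] [IsAlgClosed k] [CharP k p]

/-- An extension `O → O'` of coefficient rings: a homomorphism of `W(k)`-algebras compatible with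
the automorphisms `σ`. (It is automatically injective, finite and totally ramified.) -/
structure Hom (O O' : CoeffRing.{u, v} p k) where
  /-- the underlying ring homomorphism -/
  toRingHom : O.carrier →+* O'.carrier
  map_algebraMap : ∀ w : WittVector p k,
    toRingHom (algebraMap (WittVector p k) O.carrier w) = algebraMap (WittVector p k) O'.carrier w
  map_σ : ∀ a : O.carrier, toRingHom (O.σ a) = O'.σ (toRingHom a)

variable (O : CoeffRing.{u, v} p k)

instance : FaithfulSMul (WittVector p k) O.carrier :=
  (faithfulSMul_iff_algebraMap_injective _ _).mpr O.algebraMap_injective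

theorem p_ne_zero : (p : O.carrier) ≠ 0 := by
  have h := (map_ne_zero_iff _ O.algebraMap_injective).mpr (WittVector.p_nonzero p k)
  simpa using h

theorem not_isUnit_p : ¬ IsUnit (p : O.carrier) := by
  intro h
  have h' : IsUnit (algebraMap (WittVector p k) O.carrier p) := by simpa using h
  exact (WittVector.irreducible p).not_isUnit (isUnit_of_map_unit _ _ h')

/-- Every nonzero element has a power of the form unit times power of `p`. -/
theorem exists_pow_eq {x : O.carrier} (hx : x ≠ 0) :
    ∃ (e m : ℕ) (u : O.carrierˣ), e ≠ 0 ∧ x ^ e = u * (p : O.carrier) ^ m := by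
  obtain ⟨ϖ, hϖ⟩ := IsDiscreteValuationRing.exists_irreducible O.carrier
  obtain ⟨m, u₁, h₁⟩ := IsDiscreteValuationRing.eq_unit_mul_pow_irreducible hx hϖ
  obtain ⟨e, u₂, h₂⟩ := IsDiscreteValuationRing.eq_unit_mul_pow_irreducible O.p_ne_zero hϖ
  refine ⟨e, m, u₁ ^ e * (u₂ ^ m)⁻¹, ?_, ?_⟩
  · rintro rfl
    exact O.not_isUnit_p (by rw [h₂]; simp)
  · have : (u₂ : O.carrier) ^ m * ((u₂ ^ m)⁻¹ : O.carrierˣ) = 1 := by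
      rw [← Units.val_pow_eq_pow_val, Units.mul_inv]
    rw [h₁, h₂, mul_pow, mul_pow, Units.val_mul, Units.val_pow_eq_pow_val]
    calc (u₁ : O.carrier) ^ e * (ϖ ^ m) ^ e = (u₁ : O.carrier) ^ e * (ϖ ^ e) ^ m *
          ((u₂ : O.carrier) ^ m * ((u₂ ^ m)⁻¹ : O.carrierˣ)) := by
            rw [this, ← pow_mul, ← pow_mul, mul_comm m e, mul_one]
      _ = _ := by ring

/-- The absolute ramification index, i.e. the valuation of `p`. -/
def ramIdx : ℕ := (IsDiscreteValuationRing.addVal O.carrier (p : O.carrier)).toNat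

theorem ramIdx_spec {ϖ : O.carrier} (hϖ : Irreducible ϖ) :
    ∃ u : O.carrierˣ, (p : O.carrier) = u * ϖ ^ O.ramIdx := by
  obtain ⟨e, u, h⟩ := IsDiscreteValuationRing.eq_unit_mul_pow_irreducible O.p_ne_zero hϖ
  have : O.ramIdx = e := by
    rw [ramIdx, IsDiscreteValuationRing.addVal_def _ u hϖ e h]; rfl
  exact ⟨u, this ▸ h⟩

theorem ramIdx_ne_zero : O.ramIdx ≠ 0 := by
  intro h
  obtain ⟨ϖ, hϖ⟩ := IsDiscreteValuationRing.exists_irreducible O.carrier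
  obtain ⟨u, hu⟩ := O.ramIdx_spec hϖ
  rw [h] at hu
  exact O.not_isUnit_p (by rw [hu]; simp)

theorem one_lt_base : (1 : NNReal) < (p : NNReal) ^ ((O.ramIdx : ℝ)⁻¹) := by
  have h1 : (1 : NNReal) < p := by exact_mod_cast (Fact.out : p.Prime).one_lt
  have h2 : (0 : ℝ) < O.ramIdx := by exact_mod_cast Nat.pos_of_ne_zero O.ramIdx_ne_zero
  exact NNReal.one_lt_rpow h1 (by positivity)

/-- The fraction field `𝒪[1/p]` of `𝒪`. -/
def FracField : Type u := FractionRing O.carrier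

instance : Field O.FracField := inferInstanceAs (Field (FractionRing O.carrier))

instance : Algebra O.carrier O.FracField :=
  inferInstanceAs (Algebra O.carrier (FractionRing O.carrier))

instance : IsFractionRing O.carrier O.FracField :=
  inferInstanceAs (IsFractionRing O.carrier (FractionRing O.carrier))

/-- The `p`-adic absolute value on `𝒪[1/p]`, normalized by `|p| = p⁻¹`, that is,
`|ϖ| = p^(-1/e)` for a uniformizer `ϖ`. -/
def absVal : AbsoluteValue O.FracField ℝ :=
  (IsDiscreteValuationRing.maximalIdeal O.carrier).adicAbv O.one_lt_base

instance : NormedField O.FracField := O.absVal.toNormedField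

theorem norm_def (x : O.FracField) : ‖x‖ = O.absVal x := rfl

theorem norm_algebraMap_le_one (a : O.carrier) : ‖algebraMap O.carrier O.FracField a‖ ≤ 1 :=
  IsDedekindDomain.HeightOneSpectrum.adicAbv_coe_le_one _ O.one_lt_base a

theorem norm_algebraMap_eq_one_iff (a : O.carrier) :
    ‖algebraMap O.carrier O.FracField a‖ = 1 ↔ IsUnit a := by
  refine (IsDedekindDomain.HeightOneSpectrum.adicAbv_coe_eq_one_iff
    (IsDiscreteValuationRing.maximalIdeal O.carrier) O.one_lt_base a).trans ?_
  exact IsLocalRing.notMem_maximalIdeal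

theorem norm_uniformizer {ϖ : O.carrier} (hϖ : Irreducible ϖ) :
    ‖algebraMap O.carrier O.FracField ϖ‖ = ((p : ℝ) ^ ((O.ramIdx : ℝ)⁻¹))⁻¹ := by
  have h : (IsDiscreteValuationRing.maximalIdeal O.carrier).valuation O.FracField
      (algebraMap _ _ ϖ) = WithZero.exp (-1) := by
    rw [IsDedekindDomain.HeightOneSpectrum.valuation_of_algebraMap]
    exact IsDedekindDomain.HeightOneSpectrum.intValuation_singleton _ hϖ.ne_zero hϖ.maximalIdeal_eq
  change ((WithZeroMulInt.toNNReal (ne_zero_of_lt O.one_lt_base)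
    ((IsDiscreteValuationRing.maximalIdeal O.carrier).valuation O.FracField
      (algebraMap O.carrier O.FracField ϖ)) : NNReal) : ℝ) = _
  have hu : Multiplicative.toAdd (WithZero.unzero (WithZero.exp_ne_zero (a := (-1 : ℤ)))) = -1 := rfl
  rw [h, WithZeroMulInt.toNNReal_neg_apply _ WithZero.exp_ne_zero, hu]
  simp

theorem norm_p : ‖(p : O.FracField)‖ = (p : ℝ)⁻¹ := by
  obtain ⟨ϖ, hϖ⟩ := IsDiscreteValuationRing.exists_irreducible O.carrier
  obtain ⟨u, hu⟩ := O.ramIdx_spec hϖ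
  have h1 : (p : O.FracField) = algebraMap O.carrier O.FracField (p : O.carrier) := by simp
  rw [h1, hu, map_mul, map_pow, norm_mul, norm_pow, O.norm_uniformizer hϖ,
    (O.norm_algebraMap_eq_one_iff _).mpr u.isUnit, one_mul, inv_pow,
    Real.rpow_inv_natCast_pow (by positivity) O.ramIdx_ne_zero]

theorem exists_of_norm_le_one {x : O.FracField} (hx : ‖x‖ ≤ 1) :
    ∃ a : O.carrier, algebraMap O.carrier O.FracField a = x := by
  rcases ValuationRing.isInteger_or_isInteger O.carrier x with ⟨a, ha⟩ | ⟨a, ha⟩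
  · exact ⟨a, ha⟩
  · rcases eq_or_ne x 0 with rfl | hx0
    · exact ⟨0, map_zero _⟩
    have h1 : 1 ≤ ‖algebraMap O.carrier O.FracField a‖ := by
      rw [ha, norm_inv]
      exact (one_le_inv₀ (norm_pos_iff.mpr hx0)).mpr hx
    obtain ⟨u, rfl⟩ := (O.norm_algebraMap_eq_one_iff a).mp (le_antisymm (O.norm_algebraMap_le_one a) h1)
    refine ⟨(u⁻¹ : O.carrierˣ), ?_⟩
    have h2 : algebraMap O.carrier O.FracField (u⁻¹ : O.carrierˣ) * x⁻¹ = 1 := by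
      rw [← ha, ← map_mul, Units.inv_mul, map_one]
    exact (mul_inv_eq_one₀ hx0).mp h2

/-- `𝒪` is `p`-adically complete, being finite free over `W(k)`. -/
theorem exists_limit (a : ℕ → O.carrier)
    (ha : ∀ m n, m ≤ n → (p : O.carrier) ^ m ∣ a m - a n) :
    ∃ L : O.carrier, ∀ n, (p : O.carrier) ^ n ∣ a n - L := by
  have : Module.IsTorsionFree (WittVector p k) O.carrier := inferInstance
  have : Module.Free (WittVector p k) O.carrier := Module.free_of_finite_type_torsion_free'
  let b := Module.Free.chooseBasis (WittVector p k) O.carrier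
  have hsm : ∀ (n : ℕ) (y : O.carrier), (p : O.carrier) ^ n * y = ((p : WittVector p k) ^ n) • y := by
    intro n y
    rw [Algebra.smul_def]; simp
  have hdvd : ∀ (n : ℕ) (w w' : WittVector p k),
      w ≡ w' [SMOD (Ideal.span {(p : WittVector p k)} ^ n • ⊤ :
        Submodule (WittVector p k) (WittVector p k))] ↔
        (p : WittVector p k) ^ n ∣ w - w' := by
    intro n w w'
    rw [SModEq.sub_mem, smul_eq_mul, Ideal.mul_top, Ideal.span_singleton_pow,
      Ideal.mem_span_singleton]
  have hc : ∀ i, ∃ L : WittVector p k, ∀ n, (p : WittVector p k) ^ n ∣ b.repr (a n) i - L := by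
    intro i
    obtain ⟨L, hL⟩ := IsPrecomplete.prec
      (WittVector.isAdicCompleteIdealSpanP (p := p) (k := k)).toIsPrecomplete
      (f := fun n => b.repr (a n) i) (by
        intro m n hmn
        rw [hdvd]
        obtain ⟨y, hy⟩ := ha m n hmn
        rw [hsm] at hy
        refine ⟨b.repr y i, ?_⟩
        rw [← Finsupp.sub_apply, ← map_sub, hy]
        simp)
    exact ⟨L, fun n => (hdvd n _ _).mp (hL n)⟩
  choose L hL using hc
  choose q hq using hL
  refine ⟨∑ i, L i • b i, fun n => ⟨∑ i, q i n • b i, ?_⟩⟩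
  conv_lhs => rw [← b.sum_repr (a n)]
  rw [hsm, ← Finset.sum_sub_distrib, Finset.smul_sum]
  refine Finset.sum_congr rfl fun i _ => ?_
  rw [← sub_smul, hq, mul_smul]

instance : CompleteSpace O.FracField := by
  have hp1 : (1 : ℝ) < p := by exact_mod_cast (Fact.out : p.Prime).one_lt
  have hp0 : (0 : ℝ) < p := one_pos.trans hp1
  have hpF : (p : O.FracField) ≠ 0 := by
    rw [← norm_pos_iff, O.norm_p]; positivity
  have hnp : ∀ n : ℕ, ‖(p : O.FracField) ^ n‖ = ((p : ℝ)⁻¹) ^ n := fun n => by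
    rw [norm_pow, O.norm_p]
  have hdvd : ∀ (n : ℕ) (a : O.carrier),
      ‖algebraMap O.carrier O.FracField a‖ ≤ ((p : ℝ)⁻¹) ^ n → (p : O.carrier) ^ n ∣ a := by
    intro n a h
    obtain ⟨c, hc⟩ := O.exists_of_norm_le_one
      (x := algebraMap O.carrier O.FracField a / (p : O.FracField) ^ n) (by
        rw [norm_div, hnp]
        exact div_le_one_of_le₀ h (by positivity))
    refine ⟨c, IsFractionRing.injective O.carrier O.FracField ?_⟩
    rw [map_mul, hc, map_pow, map_natCast]
    field_simp
  have hdvd' : ∀ (n : ℕ) (a : O.carrier), (p : O.carrier) ^ n ∣ a →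
      ‖algebraMap O.carrier O.FracField a‖ ≤ ((p : ℝ)⁻¹) ^ n := by
    rintro n a ⟨c, rfl⟩
    rw [map_mul, norm_mul, map_pow, map_natCast, hnp]
    exact mul_le_of_le_one_right (by positivity) (O.norm_algebraMap_le_one c)
  refine Metric.complete_of_convergent_controlled_sequences (fun n => ((p : ℝ)⁻¹) ^ n)
    (fun n => by positivity) fun u hu => ?_
  have h0 : ∀ n, ∃ a : O.carrier, algebraMap O.carrier O.FracField a = u n - u 0 := fun n =>
    O.exists_of_norm_le_one (by
      have := hu 0 n 0 (Nat.zero_le _) le_rfl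
      rw [dist_eq_norm, pow_zero] at this
      exact this.le)
  choose a ha using h0
  obtain ⟨L, hL⟩ := O.exists_limit a fun m n hmn => hdvd m _ (by
    rw [map_sub, ha, ha, sub_sub_sub_cancel_right, ← dist_eq_norm]
    exact (hu m m n le_rfl hmn).le)
  refine ⟨u 0 + algebraMap O.carrier O.FracField L, ?_⟩
  rw [tendsto_iff_dist_tendsto_zero]
  refine squeeze_zero (fun _ => dist_nonneg) (fun n => ?_)
    (tendsto_pow_atTop_nhds_zero_of_lt_one (r := (p : ℝ)⁻¹) (by positivity)
      (inv_lt_one_of_one_lt₀ hp1))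
  rw [dist_eq_norm, ← sub_sub, ← ha, ← map_sub]
  exact hdvd' n _ (hL n)

section Maps

variable {O}
variable {O' : CoeffRing.{u, v} p k} (f : O.carrier →+* O'.carrier)

theorem norm_map_int (a : O.carrier) :
    ‖algebraMap O'.carrier O'.FracField (f a)‖ = ‖algebraMap O.carrier O.FracField a‖ := by
  rcases eq_or_ne a 0 with rfl | ha
  · simp
  obtain ⟨e, m, u, he, h⟩ := O.exists_pow_eq ha
  have h' : f a ^ e = f u * (p : O'.carrier) ^ m := by
    rw [← map_pow, h, map_mul, map_pow, map_natCast]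
  refine (pow_left_inj₀ (norm_nonneg _) (norm_nonneg _) he).mp ?_
  rw [← norm_pow, ← norm_pow, ← map_pow (algebraMap _ _),
    ← map_pow (algebraMap O.carrier _), h', h, map_mul, map_mul, norm_mul, norm_mul,
    (O.norm_algebraMap_eq_one_iff _).mpr u.isUnit,
    (O'.norm_algebraMap_eq_one_iff _).mpr (u.isUnit.map f)]
  simp only [map_pow, map_natCast, norm_pow, norm_p]

theorem map_injective : Function.Injective f := by
  rw [injective_iff_map_eq_zero]
  intro a ha
  have := norm_map_int f a
  rw [ha, map_zero, norm_zero] at this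
  exact (IsFractionRing.injective O.carrier O.FracField) (by
    rw [norm_eq_zero.mp this.symm, map_zero])

/-- The homomorphism of fraction fields induced by a homomorphism of coefficient rings. -/
def fracMap : O.FracField →+* O'.FracField :=
  IsFractionRing.lift (A := O.carrier) (g := (algebraMap O'.carrier O'.FracField).comp f)
    ((IsFractionRing.injective O'.carrier O'.FracField).comp (map_injective f))

@[simp] theorem fracMap_algebraMap (a : O.carrier) :
    fracMap f (algebraMap O.carrier O.FracField a) = algebraMap O'.carrier O'.FracField (f a) :=
  IsFractionRing.lift_algebraMap _ a

theorem norm_fracMap (x : O.FracField) : ‖fracMap f x‖ = ‖x‖ := by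
  obtain ⟨a, b, hb, rfl⟩ := IsFractionRing.div_surjective (A := O.carrier) x
  rw [map_div₀, norm_div, norm_div, fracMap_algebraMap, fracMap_algebraMap, norm_map_int,
    norm_map_int]

end Maps

end CoeffRing

/-! ### The rings `Γ_an,con ⊇ Γ_con ⊇ Ω` with their standard Frobenius -/

namespace AnCon

variable {E : Type u} [NormedField E] [CompleteSpace E]

/-- The constant series. -/
def const : E →+* AnCon E where
  toFun a := mk (Pi.single 0 a) (isAnCon_single a)
  map_zero' := by ext n; simp
  map_one' := rfl
  map_add' a b := by ext n; simp [Pi.single_add]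
  map_mul' a b := by
    ext n
    rw [coeff_mul, coeff_mk, coeff_mk, coeff_mk, conv, tsum_eq_single 0]
    · rcases eq_or_ne n 0 with rfl | h
      · simp
      · simp [Pi.single_eq_of_ne h]
    · intro i hi
      simp [Pi.single_eq_of_ne hi]

end AnCon

namespace CoeffRing

variable {p : ℕ} [Fact p.Prime] {k : Type v} [Field k] [IsAlgClosed k] [CharP k p]
variable (O : CoeffRing.{u, v} p k)

/-- For a series with coefficients in `𝒪`, the growth conditions `IsAnCon` amount to
overconvergence: `v_n(x) ≥ -cn - d` for all `n ≥ 0`, where `v_n(x)` is the least `j` with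
`|x_j| ≥ p^(-n)`. -/
theorem isAnCon_iff_overconvergent {x : ℤ → O.FracField} (hx : ∀ n, ‖x n‖ ≤ 1) :
    IsAnCon x ↔ ∃ c d : ℝ, 0 < c ∧ 0 < d ∧ ∀ n : ℝ, 0 ≤ n →
      ∀ j : ℤ, (p : ℝ) ^ (-n) ≤ ‖x j‖ → -c * n - d ≤ j := by
  have hp1 : (1 : ℝ) < p := by exact_mod_cast (Fact.out : p.Prime).one_lt
  have hp0 : (0 : ℝ) < p := one_pos.trans hp1
  have hlp : 0 < Real.log p := Real.log_pos hp1
  constructor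
  · rintro ⟨-, r, hr0, hr1, C, hC⟩
    have hlr : 0 < -Real.log r := by have := Real.log_neg hr0 hr1; linarith
    refine ⟨Real.log p / (-Real.log r), (|Real.log C| + 1) / (-Real.log r), by positivity,
      by positivity, fun n hn j hj => ?_⟩
    rcases le_total 0 j with h | h
    · have h1 : (0 : ℝ) ≤ j := by exact_mod_cast h
      have h2 : 0 ≤ Real.log p / (-Real.log r) * n := by positivity
      have h3 : 0 ≤ (|Real.log C| + 1) / (-Real.log r) := by positivity
      linarith
    · obtain ⟨m, rfl⟩ : ∃ m : ℕ, j = -m := ⟨j.natAbs, by omega⟩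
      have h1 := hj.trans (hC m)
      have hpn : 0 < (p : ℝ) ^ (-n) := by positivity
      have hC0 : 0 < C := by
        by_contra hneg
        have : C * r ^ m ≤ 0 := mul_nonpos_of_nonpos_of_nonneg (not_lt.mp hneg) (by positivity)
        linarith
      have h2 := Real.log_le_log hpn h1
      rw [Real.log_rpow hp0, Real.log_mul hC0.ne' (by positivity), Real.log_pow] at h2
      have h3 := le_abs_self (Real.log C)
      have h4 : (m : ℝ) * (-Real.log r) ≤ Real.log p * n + (|Real.log C| + 1) := by linarith
      have h5 := (le_div_iff₀ hlr).mpr h4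
      push_cast
      have h6 : (Real.log p * n + (|Real.log C| + 1)) / (-Real.log r) =
        Real.log p / (-Real.log r) * n + (|Real.log C| + 1) / (-Real.log r) := by ring
      linarith
  · rintro ⟨c, d, hc, hd, h⟩
    refine ⟨fun r hr hr1 => ⟨1, fun n => ?_⟩, (p : ℝ) ^ (-(1 / c)), by positivity,
      Real.rpow_lt_one_of_one_lt_of_neg hp1 (by simpa using hc), (p : ℝ) ^ (d / c), fun m => ?_⟩
    · exact mul_le_one₀ (hx n) (by positivity) (pow_le_one₀ hr.le hr1.le)
    · rcases eq_or_ne (x (-m)) 0 with h0 | h0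
      · rw [h0, norm_zero]; positivity
      have hpos : 0 < ‖x (-m)‖ := norm_pos_iff.mpr h0
      have hn : (p : ℝ) ^ (-(-Real.logb p ‖x (-m)‖)) = ‖x (-m)‖ := by
        rw [neg_neg, Real.rpow_logb hp0 hp1.ne' hpos]
      have h1 := h (-Real.logb p ‖x (-m)‖)
        (by have := Real.logb_nonpos hp1 hpos.le (hx (-m)); linarith) (-m) hn.le
      push_cast at h1
      rw [← Real.rpow_natCast, ← Real.rpow_mul hp0.le, ← Real.rpow_add hp0]
      calc ‖x (-m)‖ = (p : ℝ) ^ (Real.logb p ‖x (-m)‖) := (Real.rpow_logb hp0 hp1.ne' hpos).symm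
        _ ≤ _ := by
          refine Real.rpow_le_rpow_of_exponent_le hp1.le ?_
          have h2 : c * Real.logb p ‖x (-m)‖ ≤ d - m := by linarith
          have h3 : Real.logb p ‖x (-m)‖ ≤ (d - m) / c := by
            rw [le_div_iff₀ hc]; linarith
          calc _ ≤ _ := h3
            _ = _ := by ring

/-- The ring `Γ_an,con`: Laurent series `∑ xₙ tⁿ` (`n ∈ ℤ`) with coefficients in `𝒪[1/p]`
satisfying `IsAnCon`. -/
abbrev GammaAnCon : Type u := AnCon O.FracField

/-- The standard Frobenius `∑ xₙ tⁿ ↦ ∑ σ(xₙ) t^(pn)` on `Γ_an,con`. -/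
def frobAnCon : O.GammaAnCon →+* O.GammaAnCon :=
  (AnCon.expand p (Fact.out : p.Prime).ne_zero).comp
    (AnCon.map (fracMap (O.σ : O.carrier →+* O.carrier)) (norm_fracMap _))

theorem isUltrametricDist : IsUltrametricDist O.FracField :=
  IsUltrametricDist.isUltrametricDist_of_forall_norm_add_le_max_norm fun x y =>
    (IsDiscreteValuationRing.maximalIdeal O.carrier).isNonarchimedean_adicAbv O.one_lt_base x y

theorem isIntegral_iff {x : O.FracField} :
    (∃ a : O.carrier, algebraMap O.carrier O.FracField a = x) ↔ ‖x‖ ≤ 1 := by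
  refine ⟨?_, fun h => O.exists_of_norm_le_one h⟩
  rintro ⟨a, rfl⟩
  exact O.norm_algebraMap_le_one a

/-- The ring `Γ_con` of overconvergent series with coefficients in `𝒪`
(see `isAnCon_iff_overconvergent`), as a subring of `Γ_an,con`. -/
def GammaCon : Subring O.GammaAnCon where
  carrier := {x | ∀ n, ∃ a : O.carrier, algebraMap O.carrier O.FracField a = x.coeff n}
  zero_mem' n := ⟨0, map_zero _⟩
  one_mem' n := by
    rcases eq_or_ne n 0 with rfl | h
    · exact ⟨1, by simp⟩
    · exact ⟨0, by simp [Pi.single_eq_of_ne h]⟩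
  add_mem' hx hy n := by
    obtain ⟨a, ha⟩ := hx n
    obtain ⟨b, hb⟩ := hy n
    exact ⟨a + b, by simp [ha, hb]⟩
  neg_mem' hx n := by
    obtain ⟨a, ha⟩ := hx n
    exact ⟨-a, by simp [ha]⟩
  mul_mem' {x y} hx hy n := by
    have := O.isUltrametricDist
    rw [isIntegral_iff, AnCon.coeff_mul, conv]
    refine IsUltrametricDist.norm_tsum_le_of_forall_le_of_nonneg zero_le_one fun i => ?_
    rw [norm_mul]
    exact mul_le_one₀ (O.isIntegral_iff.mp (hx i)) (norm_nonneg _) (O.isIntegral_iff.mp (hy _))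

theorem frobAnCon_mem {x : O.GammaAnCon} (hx : x ∈ O.GammaCon) :
    O.frobAnCon x ∈ O.GammaCon := by
  intro n
  change ∃ a : O.carrier, algebraMap O.carrier O.FracField a =
    expandCoeff p (fun i => fracMap (O.σ : O.carrier →+* O.carrier) (x.coeff i)) n
  unfold expandCoeff
  split_ifs
  · obtain ⟨a, ha⟩ := hx (n / p)
    exact ⟨O.σ a, by simp [← ha]⟩
  · exact ⟨0, map_zero _⟩

/-- The standard Frobenius on `Γ_con`. -/
def frobCon : O.GammaCon →+* O.GammaCon :=
  O.frobAnCon.restrict O.GammaCon O.GammaCon fun _ hx => O.frobAnCon_mem hx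

/-- The ring `Ω = 𝒪⟦t⟧` of series `∑ xₙ tⁿ`, `n ≥ 0`, with coefficients in `𝒪`, as a subring of
`Γ_con`. -/
def Omega : Subring O.GammaCon where
  carrier := {x | ∀ n < 0, (x : O.GammaAnCon).coeff n = 0}
  zero_mem' n _ := rfl
  one_mem' n hn := by simp [Pi.single_eq_of_ne hn.ne]
  add_mem' hx hy n hn := by simp [hx n hn, hy n hn]
  neg_mem' hx n hn := by simp [hx n hn]
  mul_mem' {x y} hx hy n hn := by
    rw [Subring.coe_mul, AnCon.coeff_mul, conv]
    convert tsum_zero with i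
    rcases lt_or_ge i 0 with h | h
    · rw [hx i h, zero_mul]
    · rw [hy (n - i) (by omega), mul_zero]

theorem frobCon_mem {x : O.GammaCon} (hx : x ∈ O.Omega) : O.frobCon x ∈ O.Omega := by
  intro n hn
  change expandCoeff p
    (fun i => fracMap (O.σ : O.carrier →+* O.carrier) ((x : O.GammaAnCon).coeff i)) n = 0
  unfold expandCoeff
  split_ifs with h
  · have hp : (0 : ℤ) < p := by exact_mod_cast (Fact.out : p.Prime).pos
    have h0 := hx _ (Int.ediv_neg_of_neg_of_pos hn hp)
    simp only [h0, map_zero]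
  · rfl

/-- The standard Frobenius on `Ω`. -/
def frobOmega : O.Omega →+* O.Omega :=
  O.frobCon.restrict O.Omega O.Omega fun _ hx => O.frobCon_mem hx

theorem algebraMap_frobCon (x : O.GammaCon) :
    algebraMap O.GammaCon O.GammaAnCon (O.frobCon x) =
      O.frobAnCon (algebraMap O.GammaCon O.GammaAnCon x) := rfl

theorem algebraMap_frobOmega (x : O.Omega) :
    algebraMap O.Omega O.GammaCon (O.frobOmega x) =
      O.frobCon (algebraMap O.Omega O.GammaCon x) := rfl

/-- The homomorphism of the rings `Γ_an,con` induced by an extension of coefficient rings. -/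
def Hom.mapAnCon {O O' : CoeffRing.{u, v} p k} (f : Hom O O') : O.GammaAnCon →+* O'.GammaAnCon :=
  AnCon.map (fracMap f.toRingHom) (norm_fracMap _)

theorem Hom.mapAnCon_frobAnCon {O O' : CoeffRing.{u, v} p k} (f : Hom O O') (x : O.GammaAnCon) :
    f.mapAnCon (O.frobAnCon x) = O'.frobAnCon (f.mapAnCon x) := by
  have key : ∀ a : O.FracField,
      fracMap f.toRingHom (fracMap (O.σ : O.carrier →+* O.carrier) a) =
        fracMap (O'.σ : O'.carrier →+* O'.carrier) (fracMap f.toRingHom a) := by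
    intro a
    obtain ⟨a, b, hb, rfl⟩ := IsFractionRing.div_surjective (A := O.carrier) a
    simp [f.map_σ]
  ext n
  change fracMap f.toRingHom (expandCoeff p _ n) = expandCoeff p _ n
  unfold expandCoeff
  split_ifs
  · exact key _
  · exact map_zero _

end CoeffRing

/-! ### `F`-crystals -/

open scoped TensorProduct

/-- A module over `R` with an additive, `φ`-semilinear endomorphism `F`. -/
structure FModule (R : Type u) [CommRing R] (φ : R →+* R) where
  /-- the underlying module -/
  carrier : Type u
  [addCommGroup : AddCommGroup carrier]
  [module : Module R carrier]
  /-- the semilinear endomorphism -/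
  F : carrier →ₛₗ[φ] carrier

attribute [instance] FModule.addCommGroup FModule.module

/-- The ring `R`, viewed as an `R`-algebra through `φ : R → R`. -/
def Twist {R : Type u} [CommRing R] (_φ : R →+* R) : Type u := R

namespace Twist

variable {R : Type u} [CommRing R] (φ : R →+* R)

instance : CommRing (Twist φ) := inferInstanceAs (CommRing R)

/-- The identity map `R → Twist φ`. -/
def of : R ≃+* Twist φ := RingEquiv.refl R

instance : Algebra R (Twist φ) := ((of φ : R →+* Twist φ).comp φ).toAlgebra

theorem of_symm_smul (r : R) (s : Twist φ) : (of φ).symm (r • s) = φ r * (of φ).symm s := rfl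

end Twist

namespace FModule

variable {R : Type u} [CommRing R] {φ : R →+* R}

/-- The linear map `M^φ = M ⊗_{R,φ} R → M`, `s ⊗ m ↦ s F(m)` corresponding to `F`. -/
def linearization (M : FModule R φ) : Twist φ ⊗[R] M.carrier →+ M.carrier :=
  TensorProduct.liftAddHom
    (AddMonoidHom.mk' (fun s => AddMonoidHom.mk' (fun m => (Twist.of φ).symm s • M.F m)
        fun m m' => by rw [map_add, smul_add])
      fun s s' => by ext m; simp [add_smul])
    fun r s m => by
      simp only [AddMonoidHom.mk'_apply, Twist.of_symm_smul, LinearMap.map_smulₛₗ, smul_smul]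
      rw [mul_comm]

/-- `M` is an `F`-crystal: it is finite and locally free over `R`, and `p^ℓ` annihilates the kernel
and the cokernel of the linear map `M^φ → M` for some `ℓ`. -/
structure IsFCrystal (p : ℕ) (M : FModule R φ) : Prop where
  finite : Module.Finite R M.carrier
  projective : Module.Projective R M.carrier
  exists_pow : ∃ ℓ : ℕ, (∀ z, M.linearization z = 0 → p ^ ℓ • z = 0) ∧
    ∀ m : M.carrier, ∃ z, M.linearization z = p ^ ℓ • m

/-- `M` and `N` are isogenous: there are morphisms `f : M → N` and `g : N → M` such that `g ∘ f` and
`f ∘ g` are multiplication by the same nonzero scalar. -/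
def IsIsogenous (M N : FModule R φ) : Prop :=
  ∃ (f : M.carrier →ₗ[R] N.carrier) (g : N.carrier →ₗ[R] M.carrier) (a : R),
    (∀ m, f (M.F m) = N.F (f m)) ∧ (∀ n, g (N.F n) = M.F (g n)) ∧
    a ≠ 0 ∧ (∀ m, g (f m) = a • m) ∧ ∀ n, f (g n) = a • n

/-- The additive map `s ⊗ m ↦ ψ(s) ⊗ F(m)`. -/
def baseChangeAux {S : Type u} [CommRing S] [Algebra R S] (ψ : S →+* S)
    (h : ∀ r, algebraMap R S (φ r) = ψ (algebraMap R S r)) (M : FModule R φ) :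
    S ⊗[R] M.carrier →+ S ⊗[R] M.carrier :=
  TensorProduct.liftAddHom
    (AddMonoidHom.mk' (fun s => AddMonoidHom.mk' (fun m => ψ s ⊗ₜ[R] M.F m)
        fun m m' => by rw [map_add, TensorProduct.tmul_add])
      fun s s' => by ext m; simp [TensorProduct.add_tmul])
    fun r s m => by
      simp only [AddMonoidHom.mk'_apply, LinearMap.map_smulₛₗ, Algebra.smul_def, map_mul]
      rw [← h, ← Algebra.smul_def, TensorProduct.smul_tmul]

/-- The base change `S ⊗_R M`, with `F(s ⊗ m) = ψ(s) ⊗ F(m)`. -/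
def baseChange {S : Type u} [CommRing S] [Algebra R S] (ψ : S →+* S)
    (h : ∀ r, algebraMap R S (φ r) = ψ (algebraMap R S r)) (M : FModule R φ) : FModule S ψ where
  carrier := S ⊗[R] M.carrier
  F :=
    { toFun := M.baseChangeAux ψ h
      map_add' := map_add _
      map_smul' := fun s z => by
        induction z with
        | zero => simp
        | add x y hx hy => rw [smul_add, map_add, map_add, smul_add, hx, hy]
        | tmul s' m =>
          change ψ (s * s') ⊗ₜ[R] M.F m = ψ s • (ψ s' ⊗ₜ[R] M.F m)
          rw [map_mul, TensorProduct.smul_tmul', smul_eq_mul] }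

theorem baseChange_F_tmul {S : Type u} [CommRing S] [Algebra R S] (ψ : S →+* S)
    (h : ∀ r, algebraMap R S (φ r) = ψ (algebraMap R S r)) (M : FModule R φ) (s : S)
    (m : M.carrier) : (M.baseChange ψ h).F (s ⊗ₜ[R] m) = ψ s ⊗ₜ[R] M.F m := rfl

theorem linearization_tmul (M : FModule R φ) (s : R) (m : M.carrier) :
    M.linearization (Twist.of φ s ⊗ₜ[R] m) = s • M.F m := rfl

/-- The rank one module `R` with `F(x) = c φ(x)`. -/
def rankOne (φ : R →+* R) (c : R) : FModule R φ where
  carrier := R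
  F :=
    { toFun := fun x => c * φ x
      map_add' := fun x y => by rw [map_add, mul_add]
      map_smul' := fun r x => by simp only [smul_eq_mul, map_mul]; ring }

/-- Finite direct sums. -/
def directSum {n : ℕ} (M : Fin n → FModule R φ) : FModule R φ where
  carrier := ∀ i, (M i).carrier
  F :=
    { toFun := fun x i => (M i).F (x i)
      map_add' := fun x y => by ext i; simp
      map_smul' := fun r x => by ext i; simp }

end FModule

/-! ### Semistable and constant crystals -/

section Crystals

variable {p : ℕ} [Fact p.Prime] {k : Type v} [Field k] [IsAlgClosed k] [CharP k p]
variable {O : CoeffRing.{u, v} p k}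

/-- A module over `Γ_con` is semistable if it is isogenous over `Γ_con` to (the base change of) an
`F`-crystal over `Ω`. -/
def IsSemistable (M : FModule O.GammaCon O.frobCon) : Prop :=
  ∃ N : FModule O.Omega O.frobOmega, N.IsFCrystal p ∧
    (N.baseChange O.frobCon O.algebraMap_frobOmega).IsIsogenous M

/-- The trivial crystal over `Γ_an,con` attached to `c ∈ 𝒪`: the rank one module with
`F(x) = c x^σ`. -/
def trivialCrystal (O : CoeffRing.{u, v} p k) (c : O.carrier) :
    FModule O.GammaAnCon O.frobAnCon :=
  FModule.rankOne O.frobAnCon (AnCon.const (algebraMap O.carrier O.FracField c))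

/-- A module over `Γ_an,con` is constant if, after replacing `𝒪` by a suitable extension, it becomes
isogenous to a direct sum of trivial crystals. -/
def IsConstant (M : FModule O.GammaAnCon O.frobAnCon) : Prop :=
  ∃ (O' : CoeffRing.{u, v} p k) (f : CoeffRing.Hom O O') (n : ℕ) (c : Fin n → O'.carrier),
    (∀ i, c i ≠ 0) ∧
    letI : Algebra O.GammaAnCon O'.GammaAnCon := f.mapAnCon.toAlgebra
    (M.baseChange O'.frobAnCon f.mapAnCon_frobAnCon).IsIsogenous
      (FModule.directSum fun i => trivialCrystal O' (c i))

end Crystals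

end OverconvergentCrystal

end

/-! `Ω` and `Γ_con` are local rings, so F-crystals over them are free, and the theorem is about
matrices `A`, invertible up to a power of `p`, modulo the changes of basis `A ↦ W⁻¹ A W^σ`.

Semistable implies constant. A crystal over `Ω` has a matrix `A` with entries in `𝒪⟦t⟧`. With `A₀ =
A(0)`, the iteration `U ↦ A U^σ A₀⁻¹` converges `t`-adically, because Frobenius multiplies the order
of vanishing by `p`. The `m`-th iterate has coefficients of size at most `p^(lm)`, and the
coefficient of `tⁿ` is settled after about `log_p n` steps; so the coefficients of the limit grow
polynomially and the limit converges on the open disc (Dwork's trick: `exists_frobenius_conj`,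
`exists_conj_constant_term`). What remains is the constant matrix `A₀`, an isocrystal over an
algebraically closed residue field. The Dieudonné–Manin theorem makes it diagonal once roots of
`σ`-fixed uniformizers are adjoined (`exists_hom_diagonal`).

Constant implies semistable. The scalar of the given isogeny is fixed by Frobenius, hence a nonzero
constant, so over some `𝒪'` the crystal is isomorphic to a constant one. To descend to `𝒪`, bounded
`𝒪[1/p]`-linear functionals on `𝒪'[1/p]` are applied coefficientwise to the trivialising vectors;
the results are again constant in the trivialising basis (`functional_eq_const`,
`exists_const_conj_descend`). This yields an invertible `U` over `Γ_an,con` with `U A = Z U^σ` and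
`Z` constant over `𝒪[1/p]`.

The crystal over `Ω` is then the lattice of those `x` in `Γ_conⁿ` for which `U x` has no negative
exponents (`nonnegLattice`). A Birkhoff factorization (`exists_birkhoff`) provides a matrix `V` over
`Γ_con`, invertible up to a power of `p`, such that `U V` has no negative exponents: so the lattice
has full rank, and the same result for the transposed inverse of `U` shows that it is finitely
generated. It is saturated with respect to the uniformizer, which makes a minimal generating family
independent over `Γ_con` (`exists_lattice_basis`). Frobenius preserves the lattice because `Z` is
constant, and it has bounded cokernel there because `1, t, …, t^(p-1)` span `Γ_con` over its
Frobenius image (`exists_eq_frob_of_mem`). -/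

noncomputable section
set_option linter.unusedSectionVars false
open scoped TensorProduct Matrix

namespace OverconvergentCrystal

/-! ### Supports and Gauss norms of Laurent series, and their behaviour under Frobenius -/

section

namespace AnCon

section Basic

variable {E : Type u} [NormedField E] [CompleteSpace E]

/-- The coefficients of `tⁱ` vanish for `i < k`. -/
def SuppGE (k : ℤ) (x : AnCon E) : Prop := ∀ i < k, x.coeff i = 0

/-- The Gauss norm at radius `r` is at most `B`. -/
def Bd (r B : ℝ) (x : AnCon E) : Prop := ∀ i : ℤ, ‖x.coeff i‖ * r ^ i ≤ B

theorem coeff_sub (x y : AnCon E) : (x - y).coeff = x.coeff - y.coeff := rfl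

/-- Taking a coefficient, as an additive map. -/
def coeffHom (n : ℤ) : AnCon E →+ E where
  toFun x := x.coeff n
  map_zero' := rfl
  map_add' _ _ := rfl

theorem coeff_sum {ι : Type*} (s : Finset ι) (f : ι → AnCon E) (n : ℤ) :
    (∑ i ∈ s, f i).coeff n = ∑ i ∈ s, (f i).coeff n :=
  map_sum (coeffHom n) f s

namespace SuppGE

variable {k l : ℤ} {x y : AnCon E}

theorem zero (k : ℤ) : SuppGE k (0 : AnCon E) := fun _ _ => rfl

theorem mono (h : l ≤ k) (hx : SuppGE k x) : SuppGE l x := fun i hi => hx i (hi.trans_le h)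

theorem add (hx : SuppGE k x) (hy : SuppGE k y) : SuppGE k (x + y) := fun i hi => by
  rw [coeff_add, Pi.add_apply, hx i hi, hy i hi, add_zero]

theorem neg (hx : SuppGE k x) : SuppGE k (-x) := fun i hi => by
  rw [coeff_neg, Pi.neg_apply, hx i hi, neg_zero]

theorem sub (hx : SuppGE k x) (hy : SuppGE k y) : SuppGE k (x - y) := by
  rw [sub_eq_add_neg]; exact hx.add hy.neg

theorem sum {ι : Type*} {s : Finset ι} {f : ι → AnCon E} (h : ∀ i ∈ s, SuppGE k (f i)) :
    SuppGE k (∑ i ∈ s, f i) := fun j hj => by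
  rw [coeff_sum]; exact Finset.sum_eq_zero fun i hi => h i hi j hj

theorem mul (hx : SuppGE k x) (hy : SuppGE l y) : SuppGE (k + l) (x * y) := fun n hn => by
  rw [coeff_mul_apply]
  convert tsum_zero with i
  rcases lt_or_ge i k with h | h
  · rw [hx i h, zero_mul]
  · rw [hy (n - i) (by omega), mul_zero]

theorem coeff_mul_add (hx : SuppGE k x) (hy : SuppGE l y) :
    (x * y).coeff (k + l) = x.coeff k * y.coeff l := by
  rw [coeff_mul_apply, tsum_eq_single k]
  · congr 2; ring
  · intro i hi
    rcases lt_or_gt_of_ne hi with h | h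
    · rw [hx i h, zero_mul]
    · rw [hy _ (by omega), mul_zero]

end SuppGE

theorem eq_zero_of_suppGE {x : AnCon E} {f : ℕ → ℤ} (hf : ∀ n : ℤ, ∃ k, n < f k)
    (h : ∀ k, SuppGE (f k) x) : x = 0 := by
  ext n
  obtain ⟨k, hk⟩ := hf n
  exact h k n hk

namespace Bd

variable {r B C : ℝ} {x y : AnCon E}

theorem zero (hB : 0 ≤ B) : Bd r B (0 : AnCon E) := fun i => by simpa using hB

theorem mono (h : B ≤ C) (hx : Bd r B x) : Bd r C x := fun i => (hx i).trans h

theorem nonneg (hr : 0 < r) (hx : Bd r B x) : 0 ≤ B := le_trans (by positivity) (hx 0)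

theorem neg (hx : Bd r B x) : Bd r B (-x) := fun i => by
  simpa using hx i

variable [IsUltrametricDist E]

theorem add (hr : 0 < r) (hx : Bd r B x) (hy : Bd r B y) : Bd r B (x + y) := fun i => by
  have h := IsUltrametricDist.norm_add_le_max (x.coeff i) (y.coeff i)
  calc _ ≤ max ‖x.coeff i‖ ‖y.coeff i‖ * r ^ i := by
        rw [coeff_add, Pi.add_apply]; gcongr
    _ ≤ B := by
        rcases max_choice ‖x.coeff i‖ ‖y.coeff i‖ with h | h <;> rw [h]
        exacts [hx i, hy i]

theorem sub (hr : 0 < r) (hx : Bd r B x) (hy : Bd r B y) : Bd r B (x - y) := by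
  rw [sub_eq_add_neg]; exact hx.add hr hy.neg

theorem sum (hr : 0 < r) (hB : 0 ≤ B) {ι : Type*} {s : Finset ι} {f : ι → AnCon E}
    (h : ∀ i ∈ s, Bd r B (f i)) : Bd r B (∑ i ∈ s, f i) := by
  classical
  induction s using Finset.induction_on with
  | empty => simpa using zero hB
  | insert a s ha ih =>
    rw [Finset.sum_insert ha]
    exact (h a (by simp)).add hr (ih fun i hi => h i (by simp [hi]))

theorem mul (hr : 0 < r) (hx : Bd r B x) (hy : Bd r C y) : Bd r (B * C) (x * y) := fun n => by
  have hB := hx.nonneg hr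
  have hC := hy.nonneg hr
  have hn : 0 < r ^ n := zpow_pos hr n
  rw [coeff_mul_apply, ← le_div_iff₀ hn]
  refine IsUltrametricDist.norm_tsum_le_of_forall_le_of_nonneg (by positivity) fun i => ?_
  rw [le_div_iff₀ hn, norm_mul]
  have e : r ^ n = r ^ i * r ^ (n - i) := by rw [← zpow_add₀ hr.ne']; congr 1; ring
  calc _ = (‖x.coeff i‖ * r ^ i) * (‖y.coeff (n - i)‖ * r ^ (n - i)) := by rw [e]; ring
    _ ≤ _ := mul_le_mul (hx i) (hy _) (by positivity) hB

end Bd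

theorem eq_zero_of_bd {x : AnCon E} {r ρ B : ℝ} (hr : 0 < r) (h0 : 0 ≤ ρ) (h1 : ρ < 1)
    (h : ∀ k : ℕ, Bd r (B * ρ ^ k) x) : x = 0 := by
  ext n
  have hn : 0 < r ^ n := zpow_pos hr n
  have ht : Filter.Tendsto (fun k : ℕ => B * ρ ^ k) Filter.atTop (nhds (B * 0)) :=
    (tendsto_pow_atTop_nhds_zero_of_lt_one h0 h1).const_mul B
  have h2 := ge_of_tendsto' ht fun k => h k n
  rw [mul_zero] at h2
  have h3 : ‖x.coeff n‖ ≤ 0 := by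
    by_contra hlt
    push Not at hlt
    have := mul_pos hlt hn
    linarith
  simpa using norm_le_zero_iff.mp h3

/-- A sequence of series whose coefficients converge geometrically has a coefficientwise limit. -/
theorem exists_coeff_limit {y : ℕ → AnCon E} {r ρ B : ℝ} (hr : 0 < r) (h1 : ρ < 1)
    (h : ∀ k, Bd r (B * ρ ^ k) (y (k + 1) - y k)) :
    ∃ z : ℤ → E, ∀ k i, ‖z i - (y k).coeff i‖ * r ^ i ≤ B / (1 - ρ) * ρ ^ k := by
  have key : ∀ i : ℤ, ∀ k, dist ((y k).coeff i) ((y (k + 1)).coeff i) ≤ (B / r ^ i) * ρ ^ k := by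
    intro i k
    have hi : 0 < r ^ i := zpow_pos hr i
    have := h k i
    rw [coeff_sub, Pi.sub_apply, ← le_div_iff₀ hi] at this
    rw [dist_comm, dist_eq_norm]
    calc _ ≤ _ := this
      _ = _ := by ring
  have hc : ∀ i : ℤ, ∃ a, Filter.Tendsto (fun k => (y k).coeff i) Filter.atTop (nhds a) := fun i =>
    cauchySeq_tendsto_of_complete (cauchySeq_of_le_geometric ρ _ h1 (key i))
  choose z hz using hc
  refine ⟨z, fun k i => ?_⟩
  have hi : 0 < r ^ i := zpow_pos hr i
  have := dist_le_of_le_geometric_of_tendsto ρ _ h1 (key i) (hz i) k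
  rw [dist_comm, dist_eq_norm] at this
  calc _ ≤ (B / r ^ i * ρ ^ k / (1 - ρ)) * r ^ i := by gcongr
    _ = _ := by field_simp

/-- The monomial `a tᵐ`. -/
theorem isAnCon_single' (m : ℤ) (a : E) : IsAnCon (Pi.single m a) := by
  refine isAnCon_of_summable (r₀ := 1 / 2) (by norm_num) (by norm_num) fun r _ _ => ?_
  refine summable_of_ne_finset_zero (s := {m}) fun i hi => ?_
  have : i ≠ m := by simpa using hi
  simp [Pi.single_eq_of_ne this]

/-- The monomial `a tᵐ`. -/
def monomial (m : ℤ) (a : E) : AnCon E := mk (Pi.single m a) (isAnCon_single' m a)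

@[simp] theorem coeff_monomial (m : ℤ) (a : E) : (monomial m a).coeff = Pi.single m a := rfl

theorem const_eq_monomial (a : E) : const a = monomial 0 a := rfl

@[simp] theorem coeff_const (a : E) : (const a).coeff = Pi.single 0 a := rfl

theorem coeff_monomial_mul (m : ℤ) (a : E) (x : AnCon E) (n : ℤ) :
    (monomial m a * x).coeff n = a * x.coeff (n - m) := by
  rw [coeff_mul_apply, tsum_eq_single m]
  · simp
  · intro i hi; simp [Pi.single_eq_of_ne hi]

theorem coeff_const_mul (a : E) (x : AnCon E) (n : ℤ) :
    (const a * x).coeff n = a * x.coeff n := by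
  rw [const_eq_monomial, coeff_monomial_mul, sub_zero]

theorem monomial_mul_monomial (m n : ℤ) (a b : E) :
    monomial m a * monomial n b = monomial (m + n) (a * b) := by
  ext i
  rw [coeff_monomial_mul, coeff_monomial, coeff_monomial]
  by_cases h : i = m + n
  · subst h; simp
  · rw [Pi.single_eq_of_ne h, Pi.single_eq_of_ne (by omega), mul_zero]

theorem monomial_zero_one : monomial 0 (1 : E) = 1 := rfl

theorem const_injective : Function.Injective (const : E →+* AnCon E) := fun a b h => by
  have := congrArg (fun x : AnCon E => x.coeff 0) h
  simpa using this

instance : Nontrivial (AnCon E) := (const_injective (E := E)).nontrivial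

theorem suppGE_const (a : E) : SuppGE 0 (const a) := fun i hi => by
  simp [Pi.single_eq_of_ne hi.ne]

theorem suppGE_one : SuppGE 0 (1 : AnCon E) := suppGE_const 1

theorem bd_monomial {r : ℝ} (m : ℤ) (a : E) : Bd r (max 0 (‖a‖ * r ^ m)) (monomial m a) := fun i => by
  by_cases h : i = m
  · subst h; simp
  · simp [Pi.single_eq_of_ne h]

theorem bd_const {r : ℝ} (a : E) : Bd r ‖a‖ (const a) := by
  have := bd_monomial (r := r) 0 a
  rw [const_eq_monomial]
  simpa using this

theorem bd_one {r : ℝ} : Bd r 1 (1 : AnCon E) := by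
  simpa using bd_const (r := r) (1 : E)

/-- The restriction of a series to a set of exponents. -/
def trunc (s : Set ℤ) [DecidablePred (· ∈ s)] (x : AnCon E) : AnCon E :=
  mk (fun i => if i ∈ s then x.coeff i else 0) <| by
    obtain ⟨r₀, h0, h1, h⟩ := x.isAnCon.exists_summable
    refine isAnCon_of_summable h0 h1 fun r hr hr1 => ?_
    have hrpos : 0 < r := h0.trans hr
    refine Summable.of_nonneg_of_le (fun n => by positivity) (fun n => ?_) (h r hr hr1)
    gcongr
    split_ifs <;> simp

theorem coeff_trunc (s : Set ℤ) [DecidablePred (· ∈ s)] (x : AnCon E) (i : ℤ) :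
    (trunc s x).coeff i = if i ∈ s then x.coeff i else 0 := rfl

theorem Bd.trunc {r B : ℝ} (hr : 0 < r) (s : Set ℤ) [DecidablePred (· ∈ s)] {x : AnCon E}
    (hx : Bd r B x) : Bd r B (trunc s x) := fun i => by
  rw [coeff_trunc]
  split_ifs
  · exact hx i
  · simpa using hx.nonneg hr

end Basic

end AnCon

namespace CoeffRing

open AnCon

variable {p : ℕ} [Fact p.Prime] {k : Type v} [Field k] [IsAlgClosed k] [CharP k p]
variable (O : CoeffRing.{u, v} p k)

instance : IsUltrametricDist O.FracField := O.isUltrametricDist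

/-- The automorphism `σ` on the fraction field. -/
abbrev σF : O.FracField →+* O.FracField := fracMap (O.σ : O.carrier →+* O.carrier)

theorem norm_σF (x : O.FracField) : ‖O.σF x‖ = ‖x‖ := norm_fracMap _ x

theorem σF_surjective : Function.Surjective O.σF := by
  intro x
  obtain ⟨a, b, hb, rfl⟩ := IsFractionRing.div_surjective (A := O.carrier) x
  refine ⟨algebraMap _ _ (O.σ.symm a) / algebraMap _ _ (O.σ.symm b), ?_⟩
  simp [σF]

theorem frobAnCon_coeff (x : O.GammaAnCon) (n : ℤ) :
    (O.frobAnCon x).coeff n = if (p : ℤ) ∣ n then O.σF (x.coeff (n / p)) else 0 := rfl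

theorem p_pos : (0 : ℤ) < p := by exact_mod_cast (Fact.out : p.Prime).pos

theorem frobAnCon_coeff_mul (x : O.GammaAnCon) (n : ℤ) :
    (O.frobAnCon x).coeff (p * n) = O.σF (x.coeff n) := by
  rw [frobAnCon_coeff, if_pos (dvd_mul_right _ _), Int.mul_ediv_cancel_left _ (p_pos).ne']

theorem frobAnCon_const (a : O.FracField) : O.frobAnCon (const a) = const (O.σF a) := by
  ext n
  rw [frobAnCon_coeff]
  split_ifs with h
  · obtain ⟨m, rfl⟩ := h
    rw [Int.mul_ediv_cancel_left _ (p_pos).ne']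
    rcases eq_or_ne m 0 with rfl | hm
    · simp
    · have : (p : ℤ) * m ≠ 0 := mul_ne_zero (p_pos).ne' hm
      simp [Pi.single_eq_of_ne hm, Pi.single_eq_of_ne this]
  · have : n ≠ 0 := by rintro rfl; exact h (dvd_zero _)
    simp [Pi.single_eq_of_ne this]

variable {O}

theorem suppGE_frob {m : ℤ} {x : O.GammaAnCon} (hx : SuppGE m x) :
    SuppGE (p * m) (O.frobAnCon x) := fun i hi => by
  rw [frobAnCon_coeff]
  split_ifs with h
  · obtain ⟨j, rfl⟩ := h
    rw [Int.mul_ediv_cancel_left _ (p_pos).ne', hx j (lt_of_mul_lt_mul_left hi (p_pos).le),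
      map_zero]
  · rfl

theorem bd_one_frob {B : ℝ} {x : O.GammaAnCon} (hx : Bd 1 B x) :
    Bd 1 B (O.frobAnCon x) := fun i => by
  rw [frobAnCon_coeff]
  split_ifs with h
  · rw [norm_σF]; simpa using hx (i / p)
  · simpa using hx.nonneg one_pos

theorem mem_gammaCon_iff {x : O.GammaAnCon} : x ∈ O.GammaCon ↔ ∀ i, ‖x.coeff i‖ ≤ 1 :=
  forall_congr' fun _ => O.isIntegral_iff

theorem mem_gammaCon_iff_bd {x : O.GammaAnCon} : x ∈ O.GammaCon ↔ Bd 1 1 x := by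
  rw [mem_gammaCon_iff]; simp [Bd]

/-- A series all of whose conjugation-type relations force its exponents to be divisible by every
power of `p` is constant. -/
theorem eq_const_of_dvd {x : O.GammaAnCon}
    (h : ∀ (m : ℕ) (n : ℤ), x.coeff n ≠ 0 → (p : ℤ) ^ m ∣ n) : x = const (x.coeff 0) := by
  ext n
  rcases eq_or_ne n 0 with rfl | hn
  · simp
  · rw [coeff_const, Pi.single_eq_of_ne hn]
    by_contra hne
    obtain ⟨m, hm⟩ := (Int.finiteMultiplicity_iff (a := (p : ℤ)) (b := n)).mpr
      ⟨by simpa using (Fact.out : p.Prime).one_lt.ne', hn⟩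
    exact hm (h _ n hne)

/-- Comparing coefficients, every exponent occurring in `x` is `p` times another one that occurs;
iterating, it is divisible by all powers of `p`. -/
theorem eq_const_of_frob_eq {x : O.GammaAnCon} (hx : O.frobAnCon x = x) :
    x = const (x.coeff 0) := by
  refine eq_const_of_dvd fun m => ?_
  induction m with
  | zero => simp
  | succ m ih =>
    intro n hn
    rw [← hx, frobAnCon_coeff] at hn
    split_ifs at hn with h
    · obtain ⟨j, rfl⟩ := h
      rw [Int.mul_ediv_cancel_left _ (p_pos).ne', (map_ne_zero _)] at hn
      rw [pow_succ']
      exact mul_dvd_mul_left _ (ih j hn)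
    · exact absurd rfl hn

variable (O)

theorem isUnit_natCast_p : IsUnit (p : O.GammaAnCon) := by
  have h : (p : O.FracField) ≠ 0 := by
    rw [← norm_pos_iff, O.norm_p]
    have : (0 : ℝ) < p := by exact_mod_cast (Fact.out : p.Prime).pos
    positivity
  have := h.isUnit.map (const : O.FracField →+* O.GammaAnCon)
  simpa using this

end CoeffRing

end

/-! ### Units of `Γ_con` and `Ω`; both rings are local -/

section

namespace AnCon

variable {E : Type u} [NormedField E] [CompleteSpace E]

/-- Bounded coefficients settle the positive exponents for all radii at once, so the negative
exponents need a bound at a single radius only. -/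
theorem isAnCon_of_bounded {x : ℤ → E} {r B C : ℝ} (h0 : 0 < r) (h1 : r < 1)
    (hB : ∀ i, ‖x i‖ ≤ B) (hC : ∀ i, ‖x i‖ * r ^ i ≤ C) : IsAnCon x := by
  refine ⟨fun s hs hs1 => ⟨B, fun n => ?_⟩, r, h0, h1, C, fun n => ?_⟩
  · calc _ ≤ B * 1 := mul_le_mul (hB n) (pow_le_one₀ hs.le hs1.le) (by positivity)
          ((norm_nonneg _).trans (hB 0))
      _ = B := mul_one B
  · have := hC (-n)
    rwa [zpow_neg, zpow_natCast, ← div_eq_mul_inv, div_le_iff₀ (by positivity)] at this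

theorem SuppGE.bd {x : AnCon E} {r B : ℝ} (h0 : 0 < r) (h1 : r ≤ 1) (hx : SuppGE 0 x)
    (hB : Bd 1 B x) : Bd r B x := fun i => by
  have hB0 := hB.nonneg one_pos
  rcases lt_or_ge i 0 with h | h
  · simpa [hx i h] using hB0
  · obtain ⟨n, rfl⟩ := Int.eq_ofNat_of_zero_le h
    have := hB n
    rw [one_zpow, mul_one] at this
    have h2 : r ^ (n : ℤ) ≤ 1 := by rw [zpow_natCast]; exact pow_le_one₀ h0.le h1
    calc _ ≤ B * 1 := mul_le_mul this h2 (by positivity) hB0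
      _ = B := mul_one B

end AnCon

namespace CoeffRing

open AnCon

variable {p : ℕ} [Fact p.Prime] {k : Type v} [Field k] [IsAlgClosed k] [CharP k p]
variable (O : CoeffRing.{u, v} p k)

theorem norm_le_one_of_tendsto {z : O.FracField} {y : ℕ → O.FracField} {C ρ : ℝ} (h0 : 0 ≤ ρ)
    (h1 : ρ < 1) (hy : ∀ n, ‖y n‖ ≤ 1) (h : ∀ n, ‖z - y n‖ ≤ C * ρ ^ n) : ‖z‖ ≤ 1 := by
  have ht : Filter.Tendsto (fun n : ℕ => C * ρ ^ n) Filter.atTop (nhds (C * 0)) :=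
    (tendsto_pow_atTop_nhds_zero_of_lt_one h0 h1).const_mul C
  rw [mul_zero] at ht
  obtain ⟨n, hn⟩ := (ht.eventually_lt_const one_pos).exists
  have := IsUltrametricDist.norm_add_le_max (z - y n) (y n)
  rw [sub_add_cancel] at this
  exact this.trans (max_le ((h n).trans hn.le) (hy n))

theorem const_algebraMap_mem (a : O.carrier) :
    (const (algebraMap O.carrier O.FracField a) : O.GammaAnCon) ∈ O.GammaCon := by
  intro n
  rcases eq_or_ne n 0 with rfl | h
  · exact ⟨a, by simp⟩
  · exact ⟨0, by simp [Pi.single_eq_of_ne h]⟩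

theorem monomial_one_mem (m : ℤ) : (monomial m 1 : O.GammaAnCon) ∈ O.GammaCon := by
  rw [mem_gammaCon_iff]
  intro n
  by_cases h : n = m
  · subst h; simp
  · simp [Pi.single_eq_of_ne h]

theorem trunc_mem (s : Set ℤ) [DecidablePred (· ∈ s)] {x : O.GammaAnCon} (hx : x ∈ O.GammaCon) :
    trunc s x ∈ O.GammaCon := by
  rw [mem_gammaCon_iff_bd] at *; exact hx.trunc one_pos s

/-- Power series over `𝒪` as elements of `Γ_an,con`. -/
def ofPowerSeries : PowerSeries O.carrier →+* O.GammaAnCon where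
  toFun f := AnCon.mk
    (fun n => if 0 ≤ n then algebraMap O.carrier O.FracField (PowerSeries.coeff n.toNat f) else 0) <| by
      refine isAnCon_of_bounded (r := 1 / 2) (B := 1) (C := 1) (by norm_num) (by norm_num)
        (fun i => ?_) (fun i => ?_)
      · split_ifs
        · exact O.norm_algebraMap_le_one _
        · simp
      · split_ifs with h
        · obtain ⟨n, rfl⟩ := Int.eq_ofNat_of_zero_le h
          refine mul_le_one₀ (O.norm_algebraMap_le_one _) (by positivity) ?_
          rw [zpow_natCast]; exact pow_le_one₀ (by norm_num) (by norm_num)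
        · simp
  map_zero' := by ext n; simp
  map_one' := by
    ext n
    rcases lt_trichotomy n 0 with h | rfl | h
    · simp [Pi.single_eq_of_ne h.ne, h]
    · simp
    · rw [coeff_mk, coeff_one, Pi.single_eq_of_ne h.ne', if_pos h.le, PowerSeries.coeff_one,
        if_neg (by omega), map_zero]
  map_add' f g := by
    ext n
    simp only [coeff_mk, coeff_add, Pi.add_apply]
    split_ifs <;> simp
  map_mul' f g := by
    ext n
    rw [coeff_mk, coeff_mul_apply, coeff_mk, coeff_mk]
    split_ifs with h
    · obtain ⟨n, rfl⟩ := Int.eq_ofNat_of_zero_le h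
      rw [← Function.Injective.tsum_eq (g := fun i : ℕ => (i : ℤ)) Nat.cast_injective,
        tsum_eq_sum (s := Finset.range (n + 1))]
      · rw [Int.toNat_natCast, PowerSeries.coeff_mul, map_sum,
          Finset.Nat.sum_antidiagonal_eq_sum_range_succ_mk]
        refine Finset.sum_congr rfl fun i hi => ?_
        have hi' : i ≤ n := by simpa [Nat.lt_succ_iff] using hi
        rw [if_pos (by omega), if_pos (by omega), map_mul, Int.toNat_natCast]
        congr 3
        congr 1
        omega
      · intro i hi
        have hi' : n < i := by simpa using hi
        rw [if_neg (c := 0 ≤ (n : ℤ) - i) (by omega), mul_zero]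
      · intro i hi
        by_contra hi'
        refine hi ?_
        beta_reduce
        rw [if_neg, zero_mul]
        intro h0
        obtain ⟨j, rfl⟩ := Int.eq_ofNat_of_zero_le h0
        exact hi' ⟨j, rfl⟩
    · symm
      convert tsum_zero with i
      by_cases h0 : 0 ≤ i
      · rw [if_neg (c := 0 ≤ n - i) (by omega), mul_zero]
      · rw [if_neg h0, zero_mul]

theorem coeff_ofPowerSeries (f : PowerSeries O.carrier) (n : ℤ) : (O.ofPowerSeries f).coeff n =
    if 0 ≤ n then algebraMap O.carrier O.FracField (PowerSeries.coeff n.toNat f) else 0 := rfl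

theorem ofPowerSeries_mem (f : PowerSeries O.carrier) : O.ofPowerSeries f ∈ O.GammaCon := by
  intro n
  rw [coeff_ofPowerSeries]
  split_ifs
  exacts [⟨_, rfl⟩, ⟨0, map_zero _⟩]

theorem suppGE_ofPowerSeries (f : PowerSeries O.carrier) : SuppGE 0 (O.ofPowerSeries f) :=
  fun n hn => by rw [coeff_ofPowerSeries, if_neg (by omega)]

theorem exists_ofPowerSeries {x : O.GammaAnCon} (hx : x ∈ O.GammaCon) (h0 : SuppGE 0 x) :
    ∃ f, O.ofPowerSeries f = x := by
  choose a ha using hx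
  refine ⟨PowerSeries.mk fun n => a n, ?_⟩
  ext n
  rw [coeff_ofPowerSeries]
  split_ifs with h
  · rw [PowerSeries.coeff_mk, ha, Int.toNat_of_nonneg h]
  · exact (h0 n (by omega)).symm

/-- Power series over `𝒪` as elements of `Ω`. -/
def powerSeriesToOmega : PowerSeries O.carrier →+* O.Omega :=
  (O.ofPowerSeries.codRestrict O.GammaCon O.ofPowerSeries_mem).codRestrict O.Omega
    O.suppGE_ofPowerSeries

theorem powerSeriesToOmega_surjective : Function.Surjective O.powerSeriesToOmega := by
  intro x
  obtain ⟨f, hf⟩ := O.exists_ofPowerSeries x.1.2 x.2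
  exact ⟨f, Subtype.ext (Subtype.ext hf)⟩

instance : IsNoetherianRing O.Omega :=
  isNoetherianRing_of_surjective _ _ _ O.powerSeriesToOmega_surjective

theorem exists_mul_eq_one_of_suppGE {x : O.GammaAnCon} (hx : x ∈ O.GammaCon) (h0 : SuppGE 0 x)
    (h1 : ‖x.coeff 0‖ = 1) : ∃ y ∈ O.GammaCon, SuppGE 0 y ∧ x * y = 1 := by
  obtain ⟨f, rfl⟩ := O.exists_ofPowerSeries hx h0
  rw [coeff_ofPowerSeries, if_pos le_rfl, norm_algebraMap_eq_one_iff] at h1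
  have hf : IsUnit f := PowerSeries.isUnit_iff_constantCoeff.mpr (by simpa using h1)
  obtain ⟨g, hg⟩ := hf.exists_right_inv
  exact ⟨_, O.ofPowerSeries_mem g, O.suppGE_ofPowerSeries g, by rw [← map_mul, hg, map_one]⟩

theorem isUnit_omega {x : O.Omega} (h1 : ‖(x : O.GammaAnCon).coeff 0‖ = 1) : IsUnit x := by
  obtain ⟨y, hy, hy0, h⟩ := O.exists_mul_eq_one_of_suppGE x.1.2 x.2 h1
  exact IsUnit.of_mul_eq_one (⟨⟨y, hy⟩, hy0⟩ : O.Omega) (Subtype.ext (Subtype.ext h))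

variable {O}

/-- The geometric series in `-w` converges for the Gauss norm at radius `r`. Its partial sums have
integral coefficients, hence so has the coefficientwise limit, and the two facts together place the
limit in `Γ_con`. -/
theorem exists_one_add_mul_eq_one {w : O.GammaAnCon} (hw : w ∈ O.GammaCon) {r ρ : ℝ} (hr : 0 < r)
    (hr1 : r < 1) (hρ : ρ < 1) (hb : Bd r ρ w) : ∃ z ∈ O.GammaCon, (1 + w) * z = 1 := by
  have hρ0 := hb.nonneg hr
  have hpow : ∀ j : ℕ, Bd r (ρ ^ j) ((-w) ^ j) := by
    intro j
    induction j with
    | zero => simpa using bd_one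
    | succ j ih => rw [pow_succ, pow_succ]; exact ih.mul hr hb.neg
  set y : ℕ → O.GammaAnCon := fun n => ∑ j ∈ Finset.range n, (-w) ^ j with hy
  have hym : ∀ n, y n ∈ O.GammaCon := fun n =>
    Subring.sum_mem _ fun j _ => Subring.pow_mem _ (Subring.neg_mem _ hw) j
  obtain ⟨z, hz⟩ := exists_coeff_limit (y := y) (B := 1) hr hρ fun n => by
    simpa [hy, Finset.sum_range_succ] using hpow n
  have hz1 : ∀ i, ‖z i‖ ≤ 1 := fun i => by
    have hi : 0 < r ^ i := zpow_pos hr i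
    refine O.norm_le_one_of_tendsto (C := 1 / (1 - ρ) / r ^ i) hρ0 hρ
      (fun n => mem_gammaCon_iff.mp (hym n) i) (fun n => ?_)
    have := hz n i
    rw [← le_div_iff₀ hi] at this
    exact this.trans_eq (by ring)
  have hz2 : ∀ i, ‖z i‖ * r ^ i ≤ 1 / (1 - ρ) := fun i => by simpa [hy] using hz 0 i
  set Z : O.GammaAnCon := AnCon.mk z (isAnCon_of_bounded hr hr1 hz1 hz2)
  refine ⟨Z, mem_gammaCon_iff.mpr hz1, ?_⟩
  rw [← sub_eq_zero]
  refine eq_zero_of_bd (B := max 1 (1 / (1 - ρ))) hr hρ0 hρ fun n => ?_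
  have e : (1 + w) * Z - 1 = (1 + w) * (Z - y n) - (-w) ^ n := by
    have := mul_neg_geom_sum (-w) n
    rw [sub_neg_eq_add] at this
    rw [mul_sub, this]; ring
  rw [e]
  have h1w : Bd r 1 (1 + w) := bd_one.add hr (hb.mono hρ.le)
  have hZ : Bd r (1 / (1 - ρ) * ρ ^ n) (Z - y n) := fun i => hz n i
  refine Bd.sub hr ((h1w.mul hr hZ).mono ?_) ((hpow n).mono ?_)
  · rw [one_mul]; gcongr; exact le_max_right _ _
  · calc ρ ^ n = 1 * ρ ^ n := (one_mul _).symm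
      _ ≤ _ := by gcongr; exact le_max_left _ _

variable (O) in
theorem exists_norm_lt_one : ∃ q : ℝ, 0 < q ∧ q < 1 ∧ (∀ x : O.FracField, ‖x‖ < 1 → ‖x‖ ≤ q) ∧
    ∃ ϖ : O.carrier, Irreducible ϖ ∧ ‖algebraMap O.carrier O.FracField ϖ‖ = q := by
  obtain ⟨ϖ, hϖ⟩ := IsDiscreteValuationRing.exists_irreducible O.carrier
  have hϖ0 : algebraMap O.carrier O.FracField ϖ ≠ 0 := by
    simpa using hϖ.ne_zero
  refine ⟨‖algebraMap O.carrier O.FracField ϖ‖, norm_pos_iff.mpr hϖ0, ?_, fun x hx => ?_,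
    ϖ, hϖ, rfl⟩
  · refine lt_of_le_of_ne (O.norm_algebraMap_le_one _) fun h => hϖ.not_isUnit ?_
    exact (O.norm_algebraMap_eq_one_iff _).mp h
  · obtain ⟨a, rfl⟩ := O.exists_of_norm_le_one hx.le
    have ha : a ∈ IsLocalRing.maximalIdeal O.carrier := by
      rw [IsLocalRing.mem_maximalIdeal, mem_nonunits_iff, ← O.norm_algebraMap_eq_one_iff]
      exact hx.ne
    rw [hϖ.maximalIdeal_eq, Ideal.mem_span_singleton] at ha
    obtain ⟨b, rfl⟩ := ha
    rw [map_mul, norm_mul]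
    exact mul_le_of_le_one_right (norm_nonneg _) (O.norm_algebraMap_le_one b)

/-- Two bounds are interpolated. By discreteness every coefficient has absolute value at most some
`q < 1`, and `|x₋ₙ| ≤ C rⁿ`. If `q^s C < q`, they combine to `|x₋ₙ|^(s+1) ≤ q rⁿ`, which is a bound
by `q^(1/(s+1)) < 1` at radius `r^(1/(s+1))`. -/
theorem exists_bd_of_norm_lt_one {x : O.GammaAnCon} (hneg : ∀ i, 0 ≤ i → x.coeff i = 0)
    (h : ∀ i, ‖x.coeff i‖ < 1) : ∃ r ρ : ℝ, 0 < r ∧ r < 1 ∧ ρ < 1 ∧ Bd r ρ x := by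
  obtain ⟨q, q0, q1, hq, -⟩ := O.exists_norm_lt_one
  obtain ⟨-, r, hr0, hr1, C, hC⟩ := x.isAnCon
  have ht : Filter.Tendsto (fun n : ℕ => q ^ n * C) Filter.atTop (nhds (0 * C)) :=
    (tendsto_pow_atTop_nhds_zero_of_lt_one q0.le q1).mul_const C
  rw [zero_mul] at ht
  obtain ⟨s, hs⟩ := (ht.eventually_lt_const q0).exists
  have hs1 : (s + 1 : ℕ) ≠ 0 := Nat.succ_ne_zero s
  have hroot : ∀ a : ℝ, 0 ≤ a → (a ^ (((s + 1 : ℕ) : ℝ)⁻¹)) ^ (s + 1) = a := fun a ha =>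
    Real.rpow_inv_natCast_pow ha hs1
  refine ⟨r ^ (((s + 1 : ℕ) : ℝ)⁻¹), q ^ (((s + 1 : ℕ) : ℝ)⁻¹), by positivity,
    Real.rpow_lt_one hr0.le hr1 (by positivity), Real.rpow_lt_one q0.le q1 (by positivity),
    fun i => ?_⟩
  rcases le_or_gt 0 i with hi | hi
  · rw [hneg i hi]; simp; positivity
  obtain ⟨n, rfl⟩ : ∃ n : ℕ, i = -n := ⟨i.natAbs, by omega⟩
  rw [zpow_neg, zpow_natCast, ← div_eq_mul_inv, div_le_iff₀ (by positivity)]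
  refine (pow_le_pow_iff_left₀ (norm_nonneg _) (by positivity) hs1).mp ?_
  rw [mul_pow, hroot q q0.le, ← pow_mul, mul_comm n, pow_mul, hroot r hr0.le]
  calc ‖x.coeff (-n)‖ ^ (s + 1) = ‖x.coeff (-n)‖ ^ s * ‖x.coeff (-n)‖ := pow_succ _ _
    _ ≤ q ^ s * (C * r ^ n) := by
        gcongr
        · exact hq _ (h _)
        · exact hC n
    _ = (q ^ s * C) * r ^ n := by ring
    _ ≤ q * r ^ n := by gcongr

/-- The exponents of the coefficients of absolute value one are bounded below. -/
theorem exists_le_of_norm_eq_one (x : O.GammaAnCon) : ∃ b : ℤ, ∀ z : ℤ, ‖x.coeff z‖ = 1 → b ≤ z := by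
  obtain ⟨-, r, hr0, hr1, C, hC⟩ := x.isAnCon
  have ht : Filter.Tendsto (fun n : ℕ => C * r ^ n) Filter.atTop (nhds (C * 0)) :=
    (tendsto_pow_atTop_nhds_zero_of_lt_one hr0.le hr1).const_mul C
  rw [mul_zero] at ht
  obtain ⟨N, hN⟩ := Filter.eventually_atTop.mp (ht.eventually_lt_const one_pos)
  refine ⟨-N, fun z hz => ?_⟩
  by_contra hlt
  have h1 := hN z.natAbs (by omega)
  have h2 := hC z.natAbs
  rw [show -(z.natAbs : ℤ) = z by omega, hz] at h2
  linarith

/-- Modulo the uniformizer, `x` has a least exponent `m`. In `t⁻ᵐ x` the nonnegative part is a power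
series with unit constant term, and the negative part has its coefficients in the maximal ideal,
hence is small at some radius. Dividing by the nonnegative part leaves `1 + w` with `w` small. -/
theorem exists_mul_eq_one {x : O.GammaAnCon} (hx : x ∈ O.GammaCon) {i : ℤ}
    (hi : ‖x.coeff i‖ = 1) : ∃ y ∈ O.GammaCon, x * y = 1 := by
  obtain ⟨m, hm, hmin⟩ := Int.exists_least_of_bdd (exists_le_of_norm_eq_one x) ⟨i, hi⟩
  set x' : O.GammaAnCon := monomial (-m) 1 * x with hx'
  have hx'm : x' ∈ O.GammaCon := Subring.mul_mem _ (O.monomial_one_mem _) hx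
  have hc : ∀ n, x'.coeff n = x.coeff (n + m) := fun n => by
    rw [hx', coeff_monomial_mul, one_mul, sub_neg_eq_add]
  set xp := trunc {n : ℤ | 0 ≤ n} x' with hxp
  have hxpm : xp ∈ O.GammaCon := O.trunc_mem _ hx'm
  have hxp0 : SuppGE 0 xp := fun n hn => by
    rw [hxp, coeff_trunc, if_neg]; simpa using hn
  obtain ⟨zp, hzm, hz0, hz⟩ := O.exists_mul_eq_one_of_suppGE hxpm hxp0 (by
    rw [hxp, coeff_trunc, if_pos (by simp), hc, zero_add, hm])
  have hcn : ∀ n, (x' - xp).coeff n = if 0 ≤ n then 0 else x.coeff (n + m) := fun n => by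
    rw [coeff_sub, Pi.sub_apply, hxp, coeff_trunc, hc]
    simp only [Set.mem_ofPred_eq]
    split_ifs <;> simp
  obtain ⟨r, ρ, hr, hr1, hρ, hb⟩ := exists_bd_of_norm_lt_one (x := x' - xp)
    (fun n hn => by rw [hcn, if_pos hn]) (fun n => by
      rw [hcn]
      split_ifs with h
      · simp
      · refine lt_of_le_of_ne (mem_gammaCon_iff.mp hx _) fun h1 => ?_
        have := hmin _ h1
        omega)
  have hbz : Bd r 1 zp := hz0.bd hr hr1.le (mem_gammaCon_iff_bd.mp hzm)
  obtain ⟨y, hy, h⟩ := exists_one_add_mul_eq_one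
    (Subring.mul_mem _ (Subring.sub_mem _ hx'm hxpm) hzm) hr hr1 hρ (by
      simpa using hb.mul hr hbz)
  refine ⟨monomial (-m) 1 * (zp * y), Subring.mul_mem _ (O.monomial_one_mem _)
    (Subring.mul_mem _ hzm hy), ?_⟩
  calc x * (monomial (-m) 1 * (zp * y)) = x' * zp * y := by rw [hx']; ring
    _ = (1 + (x' - xp) * zp) * y := by rw [sub_mul, hz]; ring
    _ = 1 := h

theorem isUnit_gammaCon {x : O.GammaCon} {i : ℤ} (hi : ‖(x : O.GammaAnCon).coeff i‖ = 1) :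
    IsUnit x := by
  obtain ⟨y, hy, h⟩ := exists_mul_eq_one x.2 hi
  exact IsUnit.of_mul_eq_one (⟨y, hy⟩ : O.GammaCon) (Subtype.ext h)

variable (O) in
-- If no coefficient of `x` is a unit, then `1 - x` has a unit constant term.
theorem isLocalRing_gammaCon : IsLocalRing O.GammaCon := by
  refine IsLocalRing.of_isUnit_or_isUnit_one_sub_self fun x => ?_
  by_cases h : ∃ i, ‖(x : O.GammaAnCon).coeff i‖ = 1
  · exact Or.inl (isUnit_gammaCon h.choose_spec)
  · push Not at h
    have h0 : ‖(x : O.GammaAnCon).coeff 0‖ < 1 :=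
      lt_of_le_of_ne (mem_gammaCon_iff.mp x.2 0) (h 0)
    refine Or.inr (isUnit_gammaCon (i := 0) ?_)
    rw [AddSubgroupClass.coe_sub, coeff_sub, Pi.sub_apply]
    have : ‖((1 : O.GammaCon) : O.GammaAnCon).coeff 0‖ = 1 := by simp
    rw [← this] at h0
    rw [sub_eq_add_neg, IsUltrametricDist.norm_add_eq_max_of_norm_ne_norm (by rw [norm_neg]; exact h0.ne'),
      norm_neg, max_eq_left h0.le, this]

variable (O) in
theorem isLocalRing_omega : IsLocalRing O.Omega := by
  refine IsLocalRing.of_isUnit_or_isUnit_one_sub_self fun x => ?_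
  by_cases h : ‖(x : O.GammaAnCon).coeff 0‖ = 1
  · exact Or.inl (O.isUnit_omega h)
  · have h0 : ‖(x : O.GammaAnCon).coeff 0‖ < 1 :=
      lt_of_le_of_ne (mem_gammaCon_iff.mp x.1.2 0) h
    refine Or.inr (O.isUnit_omega ?_)
    rw [AddSubgroupClass.coe_sub, AddSubgroupClass.coe_sub, coeff_sub, Pi.sub_apply]
    have : ‖(((1 : O.Omega) : O.GammaCon) : O.GammaAnCon).coeff 0‖ = 1 := by simp
    rw [← this] at h0
    rw [sub_eq_add_neg, IsUltrametricDist.norm_add_eq_max_of_norm_ne_norm (by rw [norm_neg]; exact h0.ne'),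
      norm_neg, max_eq_left h0.le, this]

/-- Once the largest power of the uniformizer dividing all coefficients is split off, the quotient
has a unit coefficient, hence an inverse in `Γ_con`. -/
theorem exists_eq_const_mul {x : O.GammaAnCon} (hx : x ∈ O.GammaCon) (hx0 : x ≠ 0)
    {ϖ : O.carrier} (hϖ : Irreducible ϖ) :
    ∃ (m : ℕ) (y z : O.GammaAnCon), z ∈ O.GammaCon ∧ y * z = 1 ∧
      x = const (algebraMap O.carrier O.FracField ϖ) ^ m * y := by
  obtain ⟨q, q0, q1, hq, ϖ', hϖ', hn'⟩ := O.exists_norm_lt_one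
  have hn : ‖algebraMap O.carrier O.FracField ϖ‖ = q := by
    rw [← hn', O.norm_uniformizer hϖ, O.norm_uniformizer hϖ']
  obtain ⟨i, hi⟩ : ∃ i, x.coeff i ≠ 0 := by
    by_contra h
    push Not at h
    exact hx0 (AnCon.ext h)
  have hex : ∃ m : ℕ, ∃ i, q ^ m < ‖x.coeff i‖ := by
    obtain ⟨m, hm⟩ := exists_pow_lt_of_lt_one (norm_pos_iff.mpr hi) q1
    exact ⟨m, i, hm⟩
  classical
  -- The least exponent `e` such that some coefficient exceeds `q^e` is positive by integrality, so
  -- `e = m + 1` and all coefficients are at most `q^m`. Equality holds at `j`, since no absolute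
  -- value lies strictly between `q^(m+1)` and `q^m`.
  obtain ⟨j, hj⟩ := Nat.find_spec hex
  have hmin := fun m => Nat.find_min hex (m := m)
  obtain ⟨m, hm⟩ : ∃ m, Nat.find hex = m + 1 := by
    refine Nat.exists_eq_succ_of_ne_zero fun h => ?_
    rw [h, pow_zero] at hj
    exact absurd (mem_gammaCon_iff.mp hx j) (not_le.mpr hj)
  rw [hm] at hj
  have hle : ∀ i, ‖x.coeff i‖ ≤ q ^ m := fun i => by
    have := hmin m (by omega)
    push Not at this
    exact this i
  set c := algebraMap O.carrier O.FracField ϖ with hc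
  have hc0 : c ≠ 0 := by rw [← norm_pos_iff, hn]; exact q0
  have hy : ∀ i, ‖(const (c ^ m)⁻¹ * x).coeff i‖ = (q ^ m)⁻¹ * ‖x.coeff i‖ := fun i => by
    rw [coeff_const_mul, norm_mul, norm_inv, norm_pow, hn]
  have hqm : 0 < q ^ m := pow_pos q0 m
  have hle1 : ∀ i, ‖(const (c ^ m)⁻¹ * x).coeff i‖ ≤ 1 := fun i => by
    rw [hy, inv_mul_le_iff₀ hqm, mul_one]; exact hle i
  obtain ⟨z, hz, hyz⟩ := exists_mul_eq_one (x := const (c ^ m)⁻¹ * x) (i := j)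
    (mem_gammaCon_iff.mpr hle1) (by
      by_contra hne
      have h2 := hq _ (lt_of_le_of_ne (hle1 j) hne)
      rw [hy, inv_mul_le_iff₀ hqm, ← pow_succ] at h2
      linarith)
  refine ⟨m, const (c ^ m)⁻¹ * x, z, hz, hyz, ?_⟩
  rw [← map_pow, ← mul_assoc, ← map_mul, mul_inv_cancel₀ (pow_ne_zero m hc0), map_one, one_mul]

end CoeffRing

end

/-! ### Modules with Frobenius in terms of matrices; isomorphism, isogeny and base change -/

section

namespace FModule

variable {R : Type u} [CommRing R] {φ : R →+* R}

/-- Two modules with semilinear endomorphisms are isomorphic. -/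
def Iso (M N : FModule R φ) : Prop :=
  ∃ e : M.carrier ≃ₗ[R] N.carrier, ∀ m, e (M.F m) = N.F (e m)

theorem Iso.symm {M N : FModule R φ} (h : Iso M N) : Iso N M := by
  obtain ⟨e, he⟩ := h
  exact ⟨e.symm, fun n => e.injective (by simp [he])⟩

theorem Iso.trans {M N P : FModule R φ} (h : Iso M N) (h' : Iso N P) : Iso M P := by
  obtain ⟨e, he⟩ := h
  obtain ⟨f, hf⟩ := h'
  exact ⟨e.trans f, fun m => by simp [he, hf]⟩

theorem IsIsogenous.of_iso {M N M' N' : FModule R φ} (h : IsIsogenous M N) (hM : Iso M M')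
    (hN : Iso N N') : IsIsogenous M' N' := by
  obtain ⟨f, g, a, hf, hg, ha, hgf, hfg⟩ := h
  obtain ⟨e, he⟩ := hM
  obtain ⟨e', he'⟩ := hN
  have he1 : ∀ m, e.symm (M'.F m) = M.F (e.symm m) := fun n => e.injective (by simp [he])
  have he2 : ∀ m, e'.symm (N'.F m) = N.F (e'.symm m) := fun n => e'.injective (by simp [he'])
  exact ⟨e'.toLinearMap ∘ₗ f ∘ₗ e.symm.toLinearMap, e.toLinearMap ∘ₗ g ∘ₗ e'.symm.toLinearMap, a,
    fun m => by simp [he1, hf, he'], fun n => by simp [he2, hg, he], ha,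
    fun m => by simp [hgf], fun n => by simp [hfg]⟩

/-- The underlying module of a base change. -/
def baseChangeEquiv {S : Type u} [CommRing S] [Algebra R S] (ψ : S →+* S)
    (h : ∀ r, algebraMap R S (φ r) = ψ (algebraMap R S r)) (M : FModule R φ) :
    (M.baseChange ψ h).carrier ≃ₗ[S] S ⊗[R] M.carrier := LinearEquiv.refl S _

theorem baseChangeEquiv_symm_F {S : Type u} [CommRing S] [Algebra R S] (ψ : S →+* S)
    (h : ∀ r, algebraMap R S (φ r) = ψ (algebraMap R S r)) (M : FModule R φ) (s : S)
    (m : M.carrier) : (M.baseChange ψ h).F ((M.baseChangeEquiv ψ h).symm (s ⊗ₜ[R] m)) =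
      (M.baseChangeEquiv ψ h).symm (ψ s ⊗ₜ[R] M.F m) := rfl

/-- The morphism of base changes induced by a linear map. -/
def baseChangeMap {S : Type u} [CommRing S] [Algebra R S] (ψ : S →+* S)
    (h : ∀ r, algebraMap R S (φ r) = ψ (algebraMap R S r)) {M N : FModule R φ}
    (f : M.carrier →ₗ[R] N.carrier) : (M.baseChange ψ h).carrier →ₗ[S] (N.baseChange ψ h).carrier :=
  (N.baseChangeEquiv ψ h).symm.toLinearMap ∘ₗ f.baseChange S ∘ₗ
    (M.baseChangeEquiv ψ h).toLinearMap

section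

variable {S : Type u} [CommRing S] [Algebra R S] (ψ : S →+* S)
    (h : ∀ r, algebraMap R S (φ r) = ψ (algebraMap R S r))

theorem baseChangeMap_tmul {M N : FModule R φ}
    (f : M.carrier →ₗ[R] N.carrier) (s : S) (m : M.carrier) :
    baseChangeMap ψ h f ((M.baseChangeEquiv ψ h).symm (s ⊗ₜ[R] m)) =
      (N.baseChangeEquiv ψ h).symm (s ⊗ₜ[R] f m) := by
  simp [baseChangeMap]

theorem baseChange_induction {M : FModule R φ} {P : (M.baseChange ψ h).carrier → Prop}
    (h0 : P 0) (hadd : ∀ x y, P x → P y → P (x + y))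
    (ht : ∀ (s : S) (m : M.carrier), P ((M.baseChangeEquiv ψ h).symm (s ⊗ₜ[R] m))) (z) : P z := by
  obtain ⟨z, rfl⟩ := (M.baseChangeEquiv ψ h).symm.surjective z
  induction z using TensorProduct.induction_on with
  | zero => rwa [map_zero]
  | add x y hx hy => rw [map_add]; exact hadd _ _ hx hy
  | tmul s m => exact ht s m

theorem baseChangeMap_F {M N : FModule R φ} {f : M.carrier →ₗ[R] N.carrier}
    (hf : ∀ m, f (M.F m) = N.F (f m)) (z) :
    baseChangeMap ψ h f ((M.baseChange ψ h).F z) =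
      (N.baseChange ψ h).F (baseChangeMap ψ h f z) := by
  induction z using baseChange_induction with
  | h0 => simp only [map_zero]
  | hadd x y hx hy => simp only [map_add, hx, hy]
  | ht s m => simp only [baseChangeMap_tmul, baseChangeEquiv_symm_F, hf]

theorem baseChangeMap_smul {M N : FModule R φ} {f : M.carrier →ₗ[R] N.carrier}
    {g : N.carrier →ₗ[R] M.carrier} {a : R} (hf : ∀ m, g (f m) = a • m) (z) :
    baseChangeMap ψ h g (baseChangeMap ψ h f z) = algebraMap R S a • z := by
  induction z using baseChange_induction with
  | h0 => simp only [map_zero, smul_zero]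
  | hadd x y hx hy => simp only [map_add, smul_add, hx, hy]
  | ht s m =>
    rw [baseChangeMap_tmul, baseChangeMap_tmul, hf, TensorProduct.tmul_smul, ← map_smul,
      algebraMap_smul]

theorem Iso.baseChange {M N : FModule R φ} (hMN : Iso M N) :
    Iso (M.baseChange ψ h) (N.baseChange ψ h) := by
  obtain ⟨e, he⟩ := hMN
  refine ⟨LinearEquiv.ofLinearMap (baseChangeMap ψ h e.toLinearMap)
    (baseChangeMap ψ h e.symm.toLinearMap) ?_ ?_, baseChangeMap_F ψ h he⟩ <;>
  · ext z
    simpa using baseChangeMap_smul ψ h (a := 1) (by simp) z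

theorem IsIsogenous.baseChange
    (hinj : Function.Injective (algebraMap R S)) {M N : FModule R φ} (hMN : IsIsogenous M N) :
    IsIsogenous (M.baseChange ψ h) (N.baseChange ψ h) := by
  obtain ⟨f, g, a, hf, hg, ha, hgf, hfg⟩ := hMN
  exact ⟨baseChangeMap ψ h f, baseChangeMap ψ h g, algebraMap R S a, baseChangeMap_F ψ h hf,
    baseChangeMap_F ψ h hg, (map_ne_zero_iff _ hinj).mpr ha, baseChangeMap_smul ψ h hgf,
    baseChangeMap_smul ψ h hfg⟩

end

/-- The free module `Rⁿ` with `F(x) = A φ(x)`. -/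
def ofMatrix (φ : R →+* R) {n : ℕ} (A : Matrix (Fin n) (Fin n) R) : FModule R φ where
  carrier := Fin n → R
  F :=
    { toFun := fun x => A *ᵥ fun i => φ (x i)
      map_add' := fun x y => by
        rw [← Matrix.mulVec_add]; congr 1; ext i; simp
      map_smul' := fun r x => by
        rw [← Matrix.mulVec_smul]; congr 1; ext i; simp }

/-- The underlying module of `ofMatrix φ A`. -/
def ofMatrixEquiv (φ : R →+* R) {n : ℕ} (A : Matrix (Fin n) (Fin n) R) :
    (Fin n → R) ≃ₗ[R] (ofMatrix φ A).carrier := LinearEquiv.refl R _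

theorem ofMatrix_F {n : ℕ} (A : Matrix (Fin n) (Fin n) R) (x : Fin n → R) :
    (ofMatrix φ A).F (ofMatrixEquiv φ A x) = ofMatrixEquiv φ A (A *ᵥ fun i => φ (x i)) := rfl

theorem ofMatrix_F_single {n : ℕ} (A : Matrix (Fin n) (Fin n) R) (i : Fin n) :
    (ofMatrix φ A).F (ofMatrixEquiv φ A (Pi.single i 1)) = ofMatrixEquiv φ A (A.col i) := by
  rw [ofMatrix_F]
  congr 1
  have e2 : (fun j => φ (Pi.single (M := fun _ => R) i 1 j)) = Pi.single i 1 := by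
    ext j; by_cases hj : j = i
    · subst hj; simp
    · simp [Pi.single_eq_of_ne hj]
  rw [e2, Matrix.mulVec_single_one]

theorem iso_ofMatrix (M : FModule R φ) {n : ℕ} (b : Module.Basis (Fin n) R M.carrier) :
    Iso M (ofMatrix φ (Matrix.of fun i j => b.repr (M.F (b j)) i)) := by
  refine ⟨b.equivFun.trans (ofMatrixEquiv φ _), fun m => ?_⟩
  rw [LinearEquiv.trans_apply, LinearEquiv.trans_apply, ofMatrix_F]
  congr 1
  conv_lhs => rw [← b.sum_repr m, map_sum]
  ext i
  simp [Matrix.mulVec, dotProduct, Finset.sum_apply, mul_comm]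

theorem ofMatrix_baseChange_iso {S : Type u} [CommRing S] [Algebra R S] (ψ : S →+* S)
    (h : ∀ r, algebraMap R S (φ r) = ψ (algebraMap R S r)) {n : ℕ}
    (A : Matrix (Fin n) (Fin n) R) :
    Iso ((ofMatrix φ A).baseChange ψ h) (ofMatrix ψ (A.map (algebraMap R S))) := by
  refine ⟨(((ofMatrix φ A).baseChangeEquiv ψ h).trans
    ((ofMatrixEquiv φ A).symm.baseChange R S _ _)).trans
      ((TensorProduct.piScalarRight R S S (Fin n)).trans (ofMatrixEquiv ψ _)), fun m => ?_⟩
  induction m using baseChange_induction with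
  | h0 => simp only [map_zero]
  | hadd x y hx hy => simp only [map_add, hx, hy]
  | ht s m =>
    obtain ⟨m, rfl⟩ := (ofMatrixEquiv φ A).surjective m
    rw [baseChangeEquiv_symm_F, ofMatrix_F]
    simp only [LinearEquiv.trans_apply, LinearEquiv.apply_symm_apply, LinearEquiv.baseChange_tmul,
      LinearEquiv.symm_apply_apply, TensorProduct.piScalarRight_apply,
      TensorProduct.piScalarRightHom_tmul, ofMatrix_F]
    congr 1
    ext i
    simp only [Algebra.smul_def, Matrix.mulVec, dotProduct, map_mul, ← h, map_sum,
      Finset.sum_mul, Matrix.map_apply, mul_assoc]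

theorem isIsogenous_ofMatrix_iff {n m : ℕ} {A : Matrix (Fin n) (Fin n) R}
    {A' : Matrix (Fin m) (Fin m) R} : IsIsogenous (ofMatrix φ A) (ofMatrix φ A') ↔
      ∃ (G : Matrix (Fin m) (Fin n) R) (H : Matrix (Fin n) (Fin m) R) (a : R),
        G * A = A' * G.map φ ∧ H * A' = A * H.map φ ∧ a ≠ 0 ∧ H * G = Matrix.scalar _ a ∧
          G * H = Matrix.scalar _ a := by
  have key : ∀ {n m : ℕ} (A : Matrix (Fin n) (Fin n) R) (A' : Matrix (Fin m) (Fin m) R)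
      (G : Matrix (Fin m) (Fin n) R), (∀ x : Fin n → R, G *ᵥ (A *ᵥ fun i => φ (x i)) =
        A' *ᵥ fun i => φ ((G *ᵥ x) i)) ↔ G * A = A' * G.map φ := by
    intro n m A A' G
    have e : ∀ x : Fin n → R, (fun i => φ ((G *ᵥ x) i)) = G.map φ *ᵥ fun i => φ (x i) := by
      intro x; ext i; simp [Matrix.mulVec, dotProduct]
    constructor
    · intro h
      refine Matrix.ext_of_mulVec_single fun i => ?_
      have := h (Pi.single i 1)
      rw [e, Matrix.mulVec_mulVec, Matrix.mulVec_mulVec] at this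
      have e2 : (fun j => φ (Pi.single (M := fun _ => R) i 1 j)) = Pi.single i 1 := by
        ext j; by_cases hj : j = i
        · subst hj; simp
        · simp [Pi.single_eq_of_ne hj]
      rwa [e2] at this
    · intro h x
      rw [e, Matrix.mulVec_mulVec, Matrix.mulVec_mulVec, h]
  have key2 : ∀ {n : ℕ} (G : Matrix (Fin n) (Fin n) R) (a : R),
      (∀ x : Fin n → R, G *ᵥ x = a • x) ↔ G = Matrix.scalar _ a := by
    intro n G a
    constructor
    · intro h
      refine Matrix.ext_of_mulVec_single fun i => ?_
      rw [h]; ext j; simp [Pi.single_apply, eq_comm]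
    · rintro rfl x
      ext j; simp [Matrix.mulVec_diagonal]
  set e := ofMatrixEquiv φ A
  set e' := ofMatrixEquiv φ A'
  constructor
  · rintro ⟨f, g, a, hf, hg, ha, hgf, hfg⟩
    let f' : (Fin n → R) →ₗ[R] (Fin m → R) := e'.symm.toLinearMap ∘ₗ f ∘ₗ e.toLinearMap
    let g' : (Fin m → R) →ₗ[R] (Fin n → R) := e.symm.toLinearMap ∘ₗ g ∘ₗ e'.toLinearMap
    have hf' : ∀ x, f (e x) = e' (f' x) := fun x => by simp [f']
    have hg' : ∀ x, g (e' x) = e (g' x) := fun x => by simp [g']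
    refine ⟨LinearMap.toMatrix' f', LinearMap.toMatrix' g', a, ?_, ?_, ha, ?_, ?_⟩
    · rw [← key]; intro x; rw [LinearMap.toMatrix'_mulVec, LinearMap.toMatrix'_mulVec]
      apply e'.injective
      rw [← hf', ← ofMatrix_F, ← ofMatrix_F, hf, hf']
    · rw [← key]; intro x; rw [LinearMap.toMatrix'_mulVec, LinearMap.toMatrix'_mulVec]
      apply e.injective
      rw [← hg', ← ofMatrix_F, ← ofMatrix_F, hg, hg']
    · rw [← key2]; intro x
      rw [← Matrix.mulVec_mulVec, LinearMap.toMatrix'_mulVec, LinearMap.toMatrix'_mulVec]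
      apply e.injective
      rw [← hg', ← hf', hgf, map_smul]
    · rw [← key2]; intro x
      rw [← Matrix.mulVec_mulVec, LinearMap.toMatrix'_mulVec, LinearMap.toMatrix'_mulVec]
      apply e'.injective
      rw [← hf', ← hg', hfg, map_smul]
  · rintro ⟨G, H, a, h1, h2, ha, h3, h4⟩
    refine ⟨e'.toLinearMap ∘ₗ G.mulVecLin ∘ₗ e.symm.toLinearMap,
      e.toLinearMap ∘ₗ H.mulVecLin ∘ₗ e'.symm.toLinearMap, a, fun x => ?_, fun x => ?_, ha,
      fun x => ?_, fun x => ?_⟩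
    · obtain ⟨x, rfl⟩ := e.surjective x
      simp only [LinearMap.comp_apply, LinearEquiv.coe_coe, LinearEquiv.symm_apply_apply,
        Matrix.mulVecLin_apply, ofMatrix_F, e, e', (key A A' G).mpr h1 x]
    · obtain ⟨x, rfl⟩ := e'.surjective x
      simp only [LinearMap.comp_apply, LinearEquiv.coe_coe, LinearEquiv.symm_apply_apply,
        Matrix.mulVecLin_apply, ofMatrix_F, e, e', (key A' A H).mpr h2 x]
    · obtain ⟨x, rfl⟩ := e.surjective x
      have := (key2 _ a).mpr h3 x
      rw [← Matrix.mulVec_mulVec] at this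
      simp only [LinearMap.comp_apply, LinearEquiv.coe_coe, LinearEquiv.symm_apply_apply,
        Matrix.mulVecLin_apply, this, map_smul]
    · obtain ⟨x, rfl⟩ := e'.surjective x
      have := (key2 _ a).mpr h4 x
      rw [← Matrix.mulVec_mulVec] at this
      simp only [LinearMap.comp_apply, LinearEquiv.coe_coe, LinearEquiv.symm_apply_apply,
        Matrix.mulVecLin_apply, this, map_smul]

theorem directSum_rankOne {n : ℕ} (c : Fin n → R) :
    directSum (fun i => rankOne φ (c i)) = ofMatrix φ (Matrix.diagonal c) := by
  have : (fun x : Fin n → R => Matrix.diagonal c *ᵥ fun i => φ (x i)) =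
      fun x i => c i * φ (x i) := by
    ext x i; rw [Matrix.mulVec_diagonal]
  unfold directSum ofMatrix
  simp only [this]
  rfl

/-- Sums of tensors `sᵢ ⊗ eᵢ` exhaust the twisted module, and in these coordinates the linearization
is multiplication by `A`. So `B A = p^l` bounds the kernel and `A B = p^l` the cokernel. -/
theorem isFCrystal_ofMatrix (p : ℕ) {n : ℕ} {A B : Matrix (Fin n) (Fin n) R} {l : ℕ}
    (hAB : A * B = Matrix.scalar _ ((p : R) ^ l)) (hBA : B * A = Matrix.scalar _ ((p : R) ^ l)) :
    (ofMatrix φ A).IsFCrystal p where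
  finite := inferInstanceAs (Module.Finite R (Fin n → R))
  projective := inferInstanceAs (Module.Projective R (Fin n → R))
  exists_pow := by
    classical
    set e := ofMatrixEquiv φ A
    have hz : ∀ z : Twist φ ⊗[R] (ofMatrix φ A).carrier, ∃ s : Fin n → R,
        z = ∑ i, Twist.of φ (s i) ⊗ₜ[R] e (Pi.single i 1) := by
      intro z
      induction z using TensorProduct.induction_on with
      | zero => exact ⟨0, by simp⟩
      | add x y hx hy =>
        obtain ⟨s, rfl⟩ := hx
        obtain ⟨s', rfl⟩ := hy
        exact ⟨s + s', by simp [TensorProduct.add_tmul, Finset.sum_add_distrib]⟩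
      | tmul x m =>
        obtain ⟨m, rfl⟩ := e.surjective m
        refine ⟨fun i => (Twist.of φ).symm (m i • x), ?_⟩
        conv_lhs => rw [pi_eq_sum_univ' m, map_sum, TensorProduct.tmul_sum]
        refine Finset.sum_congr rfl fun i _ => ?_
        rw [map_smul, TensorProduct.tmul_smul, TensorProduct.smul_tmul',
          RingEquiv.apply_symm_apply]
    have hlin : ∀ s : Fin n → R, (ofMatrix φ A).linearization
        (∑ i, Twist.of φ (s i) ⊗ₜ[R] e (Pi.single i 1)) = e (A *ᵥ s) := by
      intro s
      rw [map_sum]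
      simp only [linearization_tmul, e, ofMatrix_F_single]
      simp only [← map_smul, ← map_sum]
      congr 1
      ext i
      simp [Matrix.mulVec, dotProduct, Finset.sum_apply, mul_comm]
    refine ⟨l, fun z hz0 => ?_, fun m => ?_⟩
    · obtain ⟨s, rfl⟩ := hz z
      rw [hlin, map_eq_zero_iff _ e.injective] at hz0
      have h1 : ((p : R) ^ l) • s = 0 := by
        have h2 : (B * A) *ᵥ s = 0 := by
          rw [← Matrix.mulVec_mulVec, hz0, Matrix.mulVec_zero]
        rw [hBA] at h2
        rw [← h2]; ext j; simp [Matrix.mulVec_diagonal]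
      rw [Finset.smul_sum]
      refine Finset.sum_eq_zero fun i _ => ?_
      have h3 : (p : R) ^ l * s i = 0 := congrFun h1 i
      rw [TensorProduct.smul_tmul', nsmul_eq_mul]
      have : ((p ^ l : ℕ) : Twist φ) * Twist.of φ (s i) = Twist.of φ ((p : R) ^ l * s i) := by
        rw [map_mul, map_pow, map_natCast]; push_cast; rfl
      rw [this, h3, map_zero, TensorProduct.zero_tmul]
    · obtain ⟨m, rfl⟩ := e.surjective m
      refine ⟨∑ i, Twist.of φ ((B *ᵥ m) i) ⊗ₜ[R] e (Pi.single i 1), ?_⟩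
      rw [hlin, Matrix.mulVec_mulVec, hAB, ← Nat.cast_smul_eq_nsmul R, ← map_smul]
      congr 1
      ext j; simp [Matrix.mulVec_diagonal]

/-- The matrix comes from the cokernel condition: a preimage of `p^l bⱼ` under the linearization,
written in coordinates, is the `j`-th column of `B`. -/
theorem IsFCrystal.exists_matrix {p : ℕ} {M : FModule R φ} (hM : M.IsFCrystal p) {n : ℕ}
    (b : Module.Basis (Fin n) R M.carrier) : ∃ (B : Matrix (Fin n) (Fin n) R) (l : ℕ),
      (Matrix.of fun i j => b.repr (M.F (b j)) i) * B = Matrix.scalar _ ((p : R) ^ l) := by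
  obtain ⟨l, -, hl⟩ := hM.exists_pow
  set A : Matrix (Fin n) (Fin n) R := Matrix.of fun i j => b.repr (M.F (b j)) i with hA
  have hz : ∀ z : Twist φ ⊗[R] M.carrier, ∃ s : Fin n → R,
      b.equivFun (M.linearization z) = A *ᵥ s := by
    intro z
    induction z using TensorProduct.induction_on with
    | zero => exact ⟨0, by simp⟩
    | add x y hx hy =>
      obtain ⟨s, hs⟩ := hx
      obtain ⟨s', hs'⟩ := hy
      exact ⟨s + s', by rw [map_add, map_add, hs, hs', Matrix.mulVec_add]⟩
    | tmul x m =>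
      refine ⟨(Twist.of φ).symm x • fun i => φ (b.repr m i), ?_⟩
      obtain ⟨x, rfl⟩ := (Twist.of φ).surjective x
      rw [linearization_tmul, RingEquiv.symm_apply_apply, map_smul, Matrix.mulVec_smul]
      congr 1
      conv_lhs => rw [← b.sum_repr m, map_sum]
      ext i
      simp [hA, Matrix.mulVec, dotProduct, Finset.sum_apply, mul_comm]
  have hs : ∀ j, ∃ s : Fin n → R, A *ᵥ s = fun i => if i = j then (p : R) ^ l else 0 := by
    intro j
    obtain ⟨z, hz'⟩ := hl (b j)
    obtain ⟨s, hs⟩ := hz z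
    refine ⟨s, ?_⟩
    rw [← hs, hz', ← Nat.cast_smul_eq_nsmul R, map_smul]
    ext i
    simp [Finsupp.single_apply, eq_comm]
  choose s hs using hs
  refine ⟨Matrix.of fun i j => s j i, l, ?_⟩
  ext i j
  have := congrFun (hs j) i
  rw [Matrix.scalar_apply, Matrix.diagonal_apply, ← this]
  rfl

end FModule

end

/-! ### Semilinear equations over `𝒪` and its fraction field -/

section

namespace CoeffRing

open AnCon IsLocalRing

variable {p : ℕ} [Fact p.Prime] {k : Type v} [Field k] [IsAlgClosed k] [CharP k p]
variable (O : CoeffRing.{u, v} p k)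

theorem residue_natCast_p : residue O.carrier (p : O.carrier) = 0 := by
  rw [residue_eq_zero_iff, mem_maximalIdeal, mem_nonunits_iff]
  exact O.not_isUnit_p

/-- `W(k)/p = k` maps onto the residue field since the extension is totally ramified, and a
surjection between fields is an isomorphism. -/
theorem exists_ringEquiv_residueField : Nonempty (k ≃+* ResidueField O.carrier) := by
  have hs : Function.Surjective (WittVector.constantCoeff (p := p) (R := k)) :=
    fun x => ⟨WittVector.teichmuller p x, by simp⟩
  let g : WittVector p k →+* ResidueField O.carrier :=
    (residue O.carrier).comp (algebraMap (WittVector p k) O.carrier)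
  have hg : RingHom.ker (WittVector.constantCoeff (p := p) (R := k)) ≤ RingHom.ker g := by
    rw [WittVector.ker_constantCoeff, Ideal.span_singleton_le_iff_mem, RingHom.mem_ker]
    change residue O.carrier (algebraMap _ _ (p : WittVector p k)) = 0
    rw [map_natCast, O.residue_natCast_p]
  let j := RingHom.liftOfSurjective WittVector.constantCoeff hs ⟨g, hg⟩
  have hj : Function.Surjective j := by
    intro y
    obtain ⟨w, rfl⟩ := O.residue_surjective y
    exact ⟨WittVector.constantCoeff w, RingHom.liftOfRightInverse_comp_apply _ _ _ ⟨g, hg⟩ w⟩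
  exact ⟨RingEquiv.ofBijective j ⟨j.injective, hj⟩⟩

theorem exists_root_residueField (P : Polynomial (ResidueField O.carrier)) (hP : P.degree ≠ 0) :
    ∃ x, P.eval x = 0 := by
  obtain ⟨e⟩ := O.exists_ringEquiv_residueField
  obtain ⟨x, hx⟩ := IsAlgClosed.exists_root (P.map (e.symm : ResidueField O.carrier →+* k))
    (by rwa [Polynomial.degree_map])
  refine ⟨e x, e.symm.injective ?_⟩
  rw [Polynomial.IsRoot, Polynomial.eval_map] at hx
  have := Polynomial.eval₂_at_apply (p := P) (e.symm : ResidueField O.carrier →+* k) (e x)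
  rw [map_zero, ← hx]
  simpa using this.symm

/-- Modulo the maximal ideal, which `σ` respects, `a` agrees with an element of `W(k)`, where `σ` is
the Witt vector Frobenius. -/
theorem residue_σ (a : O.carrier) : residue O.carrier (O.σ a) = residue O.carrier a ^ p := by
  obtain ⟨w, hw⟩ := O.residue_surjective (residue O.carrier a)
  obtain ⟨ϖ, hϖ⟩ := IsDiscreteValuationRing.exists_irreducible O.carrier
  have hpp : ∀ w : WittVector p k, residue O.carrier (algebraMap _ _ (WittVector.frobenius w)) =
      residue O.carrier (algebraMap _ _ w) ^ p := by
    intro w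
    have h1 : WittVector.frobenius w - w ^ p ∈
        RingHom.ker (WittVector.constantCoeff (p := p) (R := k)) := by
      rw [RingHom.mem_ker, map_sub, map_pow, sub_eq_zero]
      exact WittVector.coeff_frobenius_charP _ w 0
    rw [WittVector.ker_constantCoeff, Ideal.mem_span_singleton] at h1
    obtain ⟨b, hb⟩ := h1
    have h2 : residue O.carrier (algebraMap (WittVector p k) O.carrier
        (WittVector.frobenius w - w ^ p)) = 0 := by
      rw [hb, map_mul, map_mul, map_natCast, O.residue_natCast_p, zero_mul]
    rwa [map_sub, map_sub, sub_eq_zero, map_pow, map_pow] at h2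
  have hσm : ∀ b : O.carrier, residue O.carrier b = 0 → residue O.carrier (O.σ b) = 0 := by
    intro b hb
    rw [residue_eq_zero_iff, mem_maximalIdeal, mem_nonunits_iff] at hb ⊢
    rwa [MulEquiv.isUnit_map O.σ]
  have h3 := hσm (a - algebraMap _ _ w) (by rw [map_sub, sub_eq_zero]; exact hw.symm)
  rw [map_sub, map_sub, sub_eq_zero, O.σ_algebraMap, hpp] at h3
  rw [h3]
  exact congrArg (· ^ p) hw

/-- The powers of `σ`. -/
abbrev σpow (j : ℕ) : O.carrier →+* O.carrier := (O.σ : O.carrier →+* O.carrier) ^ j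

theorem σpow_succ_apply (j : ℕ) (a : O.carrier) : O.σpow (j + 1) a = O.σ (O.σpow j a) := by
  simp only [σpow, pow_succ']; rfl

theorem residue_σpow (j : ℕ) (a : O.carrier) :
    residue O.carrier (O.σpow j a) = residue O.carrier a ^ p ^ j := by
  induction j with
  | zero => simp
  | succ j ih => rw [σpow_succ_apply, residue_σ, ih, ← pow_mul, pow_succ]

variable {O}

theorem dvd_iff_residue {ϖ : O.carrier} (hϖ : Irreducible ϖ) (a : O.carrier) :
    ϖ ∣ a ↔ residue O.carrier a = 0 := by
  rw [residue_eq_zero_iff, hϖ.maximalIdeal_eq, Ideal.mem_span_singleton]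

theorem eq_zero_of_forall_pow_dvd {ϖ : O.carrier} (hϖ : Irreducible ϖ) {a : O.carrier}
    (h : ∀ n, ϖ ^ n ∣ a) : a = 0 := by
  by_contra ha
  obtain ⟨n, hn⟩ := FiniteMultiplicity.of_not_isUnit hϖ.not_isUnit ha
  exact hn (h _)

/-- Successive approximation in `𝒪`. -/
theorem exists_eq_of_approx (T : O.carrier →+ O.carrier) {ϖ : O.carrier} (hϖ : Irreducible ϖ)
    (hT : ∀ n a, ϖ ^ n ∣ a → ϖ ^ n ∣ T a)
    (hS : ∀ n e, ϖ ^ n ∣ e → ∃ y, ϖ ^ n ∣ y ∧ ϖ ^ (n + 1) ∣ e - T y) {z₀ e : O.carrier}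
    (h : ϖ ∣ e - T z₀) : ∃ z, ϖ ∣ z - z₀ ∧ T z = e := by
  have step : ∀ n z, ϖ ^ (n + 1) ∣ e - T z →
      ∃ z', ϖ ^ (n + 1) ∣ z' - z ∧ ϖ ^ (n + 1 + 1) ∣ e - T z' := by
    intro n z hz
    obtain ⟨y, hy, hy'⟩ := hS _ _ hz
    exact ⟨z + y, by simpa using hy, by rwa [map_add, ← sub_sub]⟩
  choose! f hf1 hf2 using step
  let a : ℕ → O.carrier := fun n => Nat.rec z₀ (fun n z => f n z) n
  have ha : ∀ n, ϖ ^ (n + 1) ∣ e - T (a n) := by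
    intro n
    induction n with
    | zero =>
      change ϖ ^ (0 + 1) ∣ e - T z₀
      simpa using h
    | succ n ih => exact hf2 n _ ih
  have hcau : ∀ m n, m ≤ n → ϖ ^ (m + 1) ∣ a n - a m := by
    intro m n hmn
    induction n, hmn using Nat.le_induction with
    | base => simp
    | succ n hmn ih =>
      have h1 : ϖ ^ (m + 1) ∣ a (n + 1) - a n := (pow_dvd_pow _ (by omega)).trans (hf1 n _ (ha n))
      have := dvd_add h1 ih
      rwa [sub_add_sub_cancel] at this
  obtain ⟨w, hw⟩ := O.ramIdx_spec hϖ
  -- Divisibility by `p^n` is divisibility by `ϖ^(en)`, with `e` the ramification index; therefore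
  -- `p`-adic completeness is applied to the terms of index `en`.
  have hwp : ∀ n, ((p : O.carrier) ^ n ∣ · ) = (ϖ ^ (O.ramIdx * n) ∣ ·) := by
    intro n
    funext x
    rw [hw, mul_pow, ← pow_mul]
    exact propext ((w.isUnit.pow n).mul_left_dvd)
  have hr : ∀ n, n ≤ O.ramIdx * n := fun n => Nat.le_mul_of_pos_left n
    (Nat.pos_of_ne_zero O.ramIdx_ne_zero)
  obtain ⟨L, hL⟩ := O.exists_limit (fun n => a (O.ramIdx * n)) fun m n hmn => by
    have := congrFun (hwp m) (a (O.ramIdx * m) - a (O.ramIdx * n))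
    rw [this, dvd_sub_comm]
    exact (pow_dvd_pow _ (Nat.le_succ _)).trans (hcau _ _ (Nat.mul_le_mul_left _ hmn))
  have hL' : ∀ n, ϖ ^ n ∣ a (O.ramIdx * n) - L := fun n => by
    have h1 := hL n
    rw [congrFun (hwp n)] at h1
    exact (pow_dvd_pow _ (hr n)).trans h1
  refine ⟨L, ?_, ?_⟩
  · have h1 := hL' 1
    have h2 := hcau 0 (O.ramIdx * 1) (Nat.zero_le _)
    rw [pow_one] at h1
    rw [zero_add, pow_one] at h2
    have := dvd_sub h2 h1
    rwa [sub_sub_sub_cancel_left] at this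
  · symm
    rw [← sub_eq_zero]
    refine eq_zero_of_forall_pow_dvd hϖ fun n => ?_
    have h1 : ϖ ^ n ∣ e - T (a (O.ramIdx * n)) := by
      refine (pow_dvd_pow _ ?_).trans (ha _)
      have := hr n
      omega
    have h2 := dvd_add h1 (hT n _ (hL' n))
    rwa [map_sub, sub_add_sub_cancel] at h2

theorem dvd_σpow {ϖ : O.carrier} (hϖ : Irreducible ϖ) (j : ℕ) : ϖ ∣ O.σpow j ϖ := by
  rw [dvd_iff_residue hϖ, residue_σpow, (dvd_iff_residue hϖ _).mp dvd_rfl,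
    zero_pow (pow_ne_zero _ (Fact.out : p.Prime).ne_zero)]

theorem pow_dvd_σpow {ϖ : O.carrier} (hϖ : Irreducible ϖ) (j n : ℕ) {a : O.carrier}
    (h : ϖ ^ n ∣ a) : ϖ ^ n ∣ O.σpow j a := by
  obtain ⟨b, rfl⟩ := h
  rw [map_mul, map_pow]
  exact (pow_dvd_pow_of_dvd (dvd_σpow hϖ j) n).mul_right _

/-- The operator `x ↦ x - ∑ bⱼ σʲ⁺¹(x)`. -/
def frobOp {m : ℕ} (b : Fin m → O.carrier) : O.carrier →+ O.carrier where
  toFun x := x - ∑ j, b j * O.σpow (j + 1) x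
  map_zero' := by simp
  map_add' x y := by simp only [map_add, mul_add, Finset.sum_add_distrib]; ring

theorem frobOp_apply {m : ℕ} (b : Fin m → O.carrier) (x : O.carrier) :
    frobOp b x = x - ∑ j, b j * O.σpow (j + 1) x := rfl

/-- Write `σʲ⁺¹(ϖ) = ϖ wⱼ` and divide by `ϖⁿ`. Modulo `ϖ` the equation becomes `y - ∑ b̄ⱼ w̄ⱼⁿ
y^(p^(j+1)) = ē`, a polynomial equation with linear coefficient `1`; being nonconstant, it has a
root in the algebraically closed residue field. -/
theorem frobOp_approx {ϖ : O.carrier} (hϖ : Irreducible ϖ) {m : ℕ} (b : Fin m → O.carrier) (n : ℕ)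
    (e : O.carrier) (he : ϖ ^ n ∣ e) : ∃ y, ϖ ^ n ∣ y ∧ ϖ ^ (n + 1) ∣ e - frobOp b y := by
  obtain ⟨e, rfl⟩ := he
  choose w hw using fun j : Fin m => dvd_σpow hϖ (j + 1)
  let P : Polynomial (ResidueField O.carrier) := Polynomial.X -
    ∑ j : Fin m, Polynomial.C (residue _ (b j * w j ^ n)) * Polynomial.X ^ (p ^ ((j : ℕ) + 1)) -
      Polynomial.C (residue _ e)
  have hp1 : ∀ j : ℕ, p ^ (j + 1) ≠ 1 := fun j h => by
    have := (Nat.pow_eq_one.mp h)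
    have h2 := (Fact.out : p.Prime).one_lt
    omega
  have hP : P.coeff 1 = 1 := by
    simp only [P, Polynomial.coeff_sub, Polynomial.coeff_X_one, Polynomial.finsetSum_coeff,
      Polynomial.coeff_C_mul, Polynomial.coeff_X_pow]
    rw [Finset.sum_eq_zero]
    · simp
    · intro j _
      rw [if_neg (hp1 j).symm, mul_zero]
  have hdeg : P.degree ≠ 0 := by
    intro h
    rw [Polynomial.eq_C_of_degree_eq_zero h, Polynomial.coeff_C] at hP
    simp at hP
  obtain ⟨y, hy⟩ := O.exists_root_residueField P hdeg
  obtain ⟨y, rfl⟩ := IsLocalRing.residue_surjective y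
  refine ⟨ϖ ^ n * y, dvd_mul_right _ _, ?_⟩
  have e1 : ϖ ^ n * e - frobOp b (ϖ ^ n * y) =
      ϖ ^ n * (e - (y - ∑ j, (b j * w j ^ n) * O.σpow (j + 1) y)) := by
    rw [frobOp_apply]
    have : ∀ j : Fin m, b j * O.σpow (j + 1) (ϖ ^ n * y) =
        ϖ ^ n * ((b j * w j ^ n) * O.σpow (j + 1) y) := by
      intro j
      rw [map_mul, map_pow, hw, mul_pow]; ring
    simp only [this, ← Finset.mul_sum]
    ring
  rw [e1, pow_succ]
  refine mul_dvd_mul_left _ ?_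
  rw [dvd_iff_residue hϖ, map_sub, map_sub, map_sum]
  simp only [map_mul (residue O.carrier) (b _ * w _ ^ n), residue_σpow]
  simp only [P, Polynomial.eval_sub, Polynomial.eval_X, Polynomial.eval_finsetSum,
    Polynomial.eval_mul, Polynomial.eval_C, Polynomial.eval_pow] at hy
  rw [← neg_eq_zero, neg_sub]
  exact hy

theorem pow_dvd_frobOp {ϖ : O.carrier} (hϖ : Irreducible ϖ) {m : ℕ} (b : Fin m → O.carrier)
    (n : ℕ) (a : O.carrier) (h : ϖ ^ n ∣ a) : ϖ ^ n ∣ frobOp b a :=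
  dvd_sub h (Finset.dvd_sum fun _ _ => (pow_dvd_σpow hϖ _ n h).mul_left _)

theorem frobOp_surjective {m : ℕ} (b : Fin m → O.carrier) : Function.Surjective (frobOp b) := by
  intro e
  obtain ⟨ϖ, hϖ⟩ := IsDiscreteValuationRing.exists_irreducible O.carrier
  obtain ⟨y, -, hy⟩ := frobOp_approx hϖ b 0 e (by simp)
  obtain ⟨z, -, hz⟩ := exists_eq_of_approx (frobOp b) hϖ (pow_dvd_frobOp hϖ b)
    (frobOp_approx hϖ b) (by simpa using hy)
  exact ⟨z, hz⟩

/-- Divided by the unknown, the equation reads `1 = ∑ b̄ⱼ y^(p^(j+1) - 1)` in the residue field. The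
unit `b j₀` keeps the polynomial nonconstant, and its constant term `1` makes every root nonzero.
Successive approximation lifts a root without changing its residue. -/
theorem exists_isUnit_frobOp_eq_zero {m : ℕ} (b : Fin m → O.carrier) {j₀ : Fin m}
    (hb : IsUnit (b j₀)) : ∃ z, IsUnit z ∧ z = ∑ j, b j * O.σpow (j + 1) z := by
  obtain ⟨ϖ, hϖ⟩ := IsDiscreteValuationRing.exists_irreducible O.carrier
  have hp1 : ∀ j : ℕ, 1 < p ^ (j + 1) := fun j =>
    Nat.one_lt_pow (by omega) (Fact.out : p.Prime).one_lt
  let P : Polynomial (ResidueField O.carrier) := 1 -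
    ∑ j : Fin m, Polynomial.C (residue _ (b j)) * Polynomial.X ^ (p ^ ((j : ℕ) + 1) - 1)
  have hP : P.coeff (p ^ ((j₀ : ℕ) + 1) - 1) = - residue _ (b j₀) := by
    have h1 : p ^ ((j₀ : ℕ) + 1) - 1 ≠ 0 := by have := hp1 j₀; omega
    simp only [P, Polynomial.coeff_sub, Polynomial.finsetSum_coeff,
      Polynomial.coeff_C_mul, Polynomial.coeff_X_pow, Polynomial.coeff_one]
    rw [if_neg h1, Finset.sum_eq_single j₀]
    · simp
    · intro j _ hj
      rw [if_neg, mul_zero]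
      intro h
      have h2 := hp1 j
      have h3 := hp1 j₀
      have h4 := Nat.pow_right_injective (Fact.out : p.Prime).two_le
        (show p ^ ((j : ℕ) + 1) = p ^ ((j₀ : ℕ) + 1) by omega)
      exact hj (Fin.ext (by omega))
    · simp
  have hdeg : P.degree ≠ 0 := by
    intro h
    rw [Polynomial.eq_C_of_degree_eq_zero h, Polynomial.coeff_C, if_neg] at hP
    · have h2 : residue O.carrier (b j₀) = 0 := by simpa using hP.symm
      exact residue_ne_zero_iff_isUnit _ |>.mpr hb h2
    · have := hp1 j₀; omega
  obtain ⟨y, hy⟩ := O.exists_root_residueField P hdeg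
  obtain ⟨y, rfl⟩ := IsLocalRing.residue_surjective y
  simp only [P, Polynomial.eval_sub, Polynomial.eval_X, Polynomial.eval_finsetSum,
    Polynomial.eval_mul, Polynomial.eval_C, Polynomial.eval_pow, Polynomial.eval_one] at hy
  have hy0 : residue O.carrier y ≠ 0 := by
    intro h
    rw [h, Finset.sum_eq_zero] at hy
    · simp at hy
    · intro j _
      rw [zero_pow, mul_zero]
      have := hp1 j; omega
  have h0 : ϖ ∣ 0 - frobOp b y := by
    rw [zero_sub, dvd_neg, dvd_iff_residue hϖ, frobOp_apply, map_sub, map_sum]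
    simp only [map_mul, residue_σpow]
    have := congrArg (residue O.carrier y * ·) hy
    simp only [mul_zero, mul_sub, mul_one, Finset.mul_sum] at this
    rw [← this]
    congr 1
    refine Finset.sum_congr rfl fun j _ => ?_
    rw [mul_left_comm, ← pow_succ', Nat.sub_add_cancel (hp1 j).le]
  obtain ⟨z, hz1, hz⟩ := exists_eq_of_approx (frobOp b) hϖ (pow_dvd_frobOp hϖ b)
    (frobOp_approx hϖ b) h0
  refine ⟨z, ?_, sub_eq_zero.mp hz⟩
  rw [← residue_ne_zero_iff_isUnit]
  rw [dvd_iff_residue hϖ, map_sub, sub_eq_zero] at hz1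
  rwa [hz1]

/-- As `δ` lies in the maximal ideal, `y ↦ δ σ⁻¹(y)` gains one power of the uniformizer, and `y = e`
is already a solution to one more digit. -/
theorem exists_sub_mul_σ_symm_eq {δ : O.carrier} (hδ : ¬ IsUnit δ) (e : O.carrier) :
    ∃ y, y - δ * O.σ.symm y = e := by
  obtain ⟨ϖ, hϖ⟩ := IsDiscreteValuationRing.exists_irreducible O.carrier
  have hδ' : ϖ ∣ δ := by
    rw [dvd_iff_residue hϖ, residue_eq_zero_iff]; exact hδ
  let T : O.carrier →+ O.carrier :=
    { toFun := fun y => y - δ * O.σ.symm y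
      map_zero' := by simp
      map_add' := fun x y => by rw [map_add]; ring }
  have hsymm : ∀ n a, ϖ ^ n ∣ a → ϖ ^ n ∣ O.σ.symm a := by
    rintro n a ⟨c, rfl⟩
    have h1 : ϖ ∣ O.σ.symm ϖ := by
      rw [dvd_iff_residue hϖ, residue_eq_zero_iff, mem_maximalIdeal, mem_nonunits_iff,
        MulEquiv.isUnit_map O.σ.symm]
      exact hϖ.not_isUnit
    rw [map_mul, map_pow]
    exact (pow_dvd_pow_of_dvd h1 n).mul_right _
  have hS : ∀ n e, ϖ ^ n ∣ e → ∃ y, ϖ ^ n ∣ y ∧ ϖ ^ (n + 1) ∣ e - T y := fun n e he => by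
    refine ⟨e, he, ?_⟩
    have : e - T e = δ * O.σ.symm e := by simp [T]
    rw [this, pow_succ']
    exact mul_dvd_mul hδ' (hsymm n e he)
  obtain ⟨y, -, hy⟩ := hS 0 e (by simp)
  obtain ⟨z, -, hz⟩ := exists_eq_of_approx T hϖ
    (fun n a h => dvd_sub h ((hsymm n a h).mul_left _)) hS (by simpa using hy)
  exact ⟨z, hz⟩

variable (O) in
-- If `σ(ϖ) = ϖ w`, a unit `z` with `z = w σ(z)` makes `z ϖ` fixed. A fixed uniformizer is wanted
-- because `σ` then extends to the ring obtained by adjoining one of its roots.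
theorem exists_irreducible_fixed : ∃ ϖ : O.carrier, Irreducible ϖ ∧ O.σ ϖ = ϖ := by
  obtain ⟨ϖ, hϖ⟩ := IsDiscreteValuationRing.exists_irreducible O.carrier
  have h1 : Irreducible (O.σ ϖ) := (MulEquiv.irreducible_iff O.σ).mpr hϖ
  obtain ⟨w, hw⟩ := IsDiscreteValuationRing.associated_of_irreducible _ hϖ h1
  obtain ⟨z, hz, hz'⟩ := exists_isUnit_frobOp_eq_zero (fun _ : Fin 1 => (w : O.carrier))
    (j₀ := 0) w.isUnit
  have hz2 : z = w * O.σ z := by simpa [σpow] using hz'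
  refine ⟨z * ϖ, (irreducible_isUnit_mul hz).mpr hϖ, ?_⟩
  rw [map_mul, ← hw]
  conv_rhs => rw [hz2]
  ring

/-- Solving `c σ(x) - d x = b` in the fraction field. -/
theorem exists_mul_σF_sub_mul_eq {c d : O.FracField} (hc : c ≠ 0) (hd : d ≠ 0) (b : O.FracField) :
    ∃ x, c * O.σF x - d * x = b := by
  have hp : (p : O.FracField) ≠ 0 := by
    have := (map_ne_zero_iff _ (IsFractionRing.injective O.carrier O.FracField)).mpr O.p_ne_zero
    simpa using this
  have hpn : 0 < ‖(p : O.FracField)‖ := norm_pos_iff.mpr hp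
  have hp1 : ‖(p : O.FracField)‖ < 1 := by
    rw [O.norm_p]
    exact inv_lt_one_of_one_lt₀ (by exact_mod_cast (Fact.out : p.Prime).one_lt)
  have hscale : ∀ x : O.FracField, ∃ (n : ℕ) (a : O.carrier),
      algebraMap O.carrier O.FracField a = (p : O.FracField) ^ n * x := by
    intro x
    obtain ⟨n, hn⟩ := exists_pow_lt_of_lt_one (y := ‖(p : O.FracField)‖) (x := (‖x‖ + 1)⁻¹)
      (by positivity) hp1
    obtain ⟨a, ha⟩ := O.exists_of_norm_le_one (x := (p : O.FracField) ^ n * x) (by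
      rw [norm_mul, norm_pow]
      calc _ ≤ (‖x‖ + 1)⁻¹ * (‖x‖ + 1) := by gcongr; linarith
        _ = 1 := inv_mul_cancel₀ (by positivity))
    exact ⟨n, a, ha⟩
  have hσp : ∀ n : ℕ, O.σF ((p : O.FracField) ^ n) = (p : O.FracField) ^ n := by simp
  -- If `|c| ≤ |d|`, division by `d` gives the operator `x - (c/d) σ(x)` with integral coefficient.
  -- Otherwise division by `c` and the substitution `x = σ⁻¹(y)` give `y - (d/c) σ⁻¹(y)`, with `d/c`
  -- in the maximal ideal.
  rcases le_or_gt ‖c‖ ‖d‖ with h | h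
  · obtain ⟨g, hg⟩ := O.exists_of_norm_le_one (x := c / d) (by
      rw [norm_div]; exact div_le_one_of_le₀ h (norm_nonneg _))
    obtain ⟨n, a, ha⟩ := hscale (-b / d)
    obtain ⟨z, hz⟩ := frobOp_surjective (fun _ : Fin 1 => g) a
    have hz2 : z - g * O.σ z = a := by simpa [frobOp_apply, σpow] using hz
    have hz3 := congrArg (algebraMap O.carrier O.FracField) hz2
    rw [map_sub, map_mul, hg, ha] at hz3
    have hσ : algebraMap O.carrier O.FracField (O.σ z) = O.σF (algebraMap _ _ z) := by simp
    rw [hσ] at hz3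
    refine ⟨algebraMap _ _ z / (p : O.FracField) ^ n, ?_⟩
    rw [map_div₀, hσp]
    field_simp at hz3 ⊢
    linear_combination -hz3
  · obtain ⟨g, hg⟩ := O.exists_of_norm_le_one (x := d / c) (by
      rw [norm_div]; exact div_le_one_of_le₀ h.le (norm_nonneg _))
    obtain ⟨n, a, ha⟩ := hscale (b / c)
    have hgu : ¬ IsUnit g := by
      rw [← O.norm_algebraMap_eq_one_iff, hg, norm_div]
      exact ((div_lt_one (norm_pos_iff.mpr hc)).mpr h).ne
    obtain ⟨y, hy⟩ := exists_sub_mul_σ_symm_eq hgu a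
    have hy3 := congrArg (algebraMap O.carrier O.FracField) hy
    rw [map_sub, map_mul, hg, ha] at hy3
    have hσ : algebraMap O.carrier O.FracField y = O.σF (algebraMap _ _ (O.σ.symm y)) := by simp
    rw [hσ] at hy3
    refine ⟨algebraMap _ _ (O.σ.symm y) / (p : O.FracField) ^ n, ?_⟩
    rw [map_div₀, hσp]
    field_simp at hy3 ⊢
    linear_combination hy3

end CoeffRing

end

/-! ### Adjoining roots of a uniformizer -/

section

namespace CoeffRing

open AnCon IsLocalRing Polynomial

variable {p : ℕ} [Fact p.Prime] {k : Type v} [Field k] [IsAlgClosed k] [CharP k p]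

section Kummer

variable {R : Type u} [CommRing R] [IsDomain R] [IsDiscreteValuationRing R] {ϖ : R} {N : ℕ}

/-- The polynomial `X^N - ϖ`. -/
abbrev kummerPoly (ϖ : R) (N : ℕ) : R[X] := X ^ N - C ϖ

theorem kummerPoly_monic (hN : N ≠ 0) : (kummerPoly ϖ N).Monic := monic_X_pow_sub_C ϖ hN

/-- Eisenstein's criterion gives irreducibility, and `R[X]` is factorial. -/
theorem kummerPoly_prime (hϖ : Irreducible ϖ) (hN : N ≠ 0) : Prime (kummerPoly ϖ N) := by
  have hm := kummerPoly_monic (ϖ := ϖ) hN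
  have hd : (kummerPoly ϖ N).natDegree = N := natDegree_X_pow_sub_C
  refine UniqueFactorizationMonoid.irreducible_iff_prime.mp ?_
  refine IsEisensteinAt.irreducible (𝓟 := maximalIdeal R) ?_ inferInstance hm.isPrimitive
    (by omega)
  refine hm.isEisensteinAt_of_mem_of_notMem (maximalIdeal.isMaximal R).ne_top (fun {n} hn => ?_) ?_
  · rw [hd] at hn
    rw [kummerPoly, Polynomial.coeff_sub, coeff_X_pow, if_neg hn.ne, zero_sub, neg_mem_iff, coeff_C]
    split_ifs
    · rw [hϖ.maximalIdeal_eq]; exact Ideal.mem_span_singleton_self ϖ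
    · exact Ideal.zero_mem _
  · rw [kummerPoly, Polynomial.coeff_sub, coeff_X_pow, if_neg hN.symm, zero_sub, neg_mem_iff, coeff_C_zero,
      hϖ.maximalIdeal_eq, Ideal.span_singleton_pow, Ideal.mem_span_singleton]
    intro h
    have h1 : ϖ * ϖ ∣ ϖ * 1 := by rwa [mul_one, ← sq]
    exact hϖ.not_isUnit (isUnit_of_dvd_one ((mul_dvd_mul_iff_left hϖ.ne_zero).mp h1))

/-- The ring `R[X]/(X^N - ϖ)`. -/
abbrev Kummer (ϖ : R) (N : ℕ) : Type u := AdjoinRoot (kummerPoly ϖ N)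

theorem Kummer.root_pow : (AdjoinRoot.root (kummerPoly ϖ N)) ^ N = AdjoinRoot.of _ ϖ := by
  have := AdjoinRoot.eval₂_root (kummerPoly ϖ N)
  rwa [eval₂_sub, eval₂_X_pow, eval₂_C, sub_eq_zero] at this

theorem Kummer.exists_eq (s : Kummer ϖ N) :
    ∃ (a : R) (t : Kummer ϖ N), s = AdjoinRoot.of _ a + AdjoinRoot.root _ * t := by
  obtain ⟨g, rfl⟩ := AdjoinRoot.mk_surjective s
  refine ⟨g.coeff 0, AdjoinRoot.mk _ g.divX, ?_⟩
  conv_lhs => rw [← divX_mul_X_add g]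
  rw [map_add, map_mul, AdjoinRoot.mk_X, AdjoinRoot.mk_C, add_comm, mul_comm]

theorem Kummer.isDomain (hϖ : Irreducible ϖ) (hN : N ≠ 0) : IsDomain (Kummer ϖ N) :=
  AdjoinRoot.isDomain_of_prime (kummerPoly_prime hϖ hN)

theorem Kummer.not_isUnit_root (hϖ : Irreducible ϖ) (hN : N ≠ 0) :
    ¬ IsUnit (AdjoinRoot.root (kummerPoly ϖ N)) := by
  intro h
  have h1 := h.map (AdjoinRoot.lift (residue R) 0 (by
    rw [eval₂_sub, eval₂_X_pow, eval₂_C, zero_pow hN, zero_sub, neg_eq_zero, residue_eq_zero_iff,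
      hϖ.maximalIdeal_eq]
    exact Ideal.mem_span_singleton_self ϖ))
  rw [AdjoinRoot.lift_root] at h1
  exact not_isUnit_zero h1

/-- A nonunit `s` lies in a maximal ideal, which by integrality contracts to the maximal ideal of
`R`. So that ideal contains `ϖ`, a power of the root, hence the root itself; then the constant term
of `s` lies in it too and is divisible by `ϖ`. -/
theorem Kummer.isUnit_iff (hϖ : Irreducible ϖ) (hN : N ≠ 0) (s : Kummer ϖ N) :
    ¬ IsUnit s ↔ AdjoinRoot.root _ ∣ s := by
  constructor
  · intro hs
    have := (kummerPoly_monic (ϖ := ϖ) hN).finite_adjoinRoot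
    obtain ⟨I, hI, hsI⟩ := exists_max_ideal_of_mem_nonunits hs
    have h1 := Ideal.isMaximal_comap_of_isIntegral_of_isMaximal (R := R) I
    have h2 := eq_maximalIdeal h1
    have h3 : ϖ ∈ maximalIdeal R := by
      rw [hϖ.maximalIdeal_eq]; exact Ideal.mem_span_singleton_self ϖ
    rw [← h2, Ideal.mem_comap, AdjoinRoot.algebraMap_eq, ← Kummer.root_pow] at h3
    have hx := hI.isPrime.mem_of_pow_mem _ h3
    obtain ⟨a, t, rfl⟩ := Kummer.exists_eq s
    have h4 : AdjoinRoot.of _ a ∈ I := by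
      have := I.sub_mem hsI (I.mul_mem_right t hx)
      rwa [add_sub_cancel_right] at this
    have h5 : a ∈ maximalIdeal R := by
      rw [← h2, Ideal.mem_comap, AdjoinRoot.algebraMap_eq]; exact h4
    rw [hϖ.maximalIdeal_eq, Ideal.mem_span_singleton] at h5
    obtain ⟨b, rfl⟩ := h5
    rw [map_mul, ← Kummer.root_pow]
    exact dvd_add ((dvd_pow_self _ hN).mul_right _) (dvd_mul_right _ _)
  · rintro h hu
    exact Kummer.not_isUnit_root hϖ hN (isUnit_of_dvd_unit h hu)

theorem Kummer.isLocalRing (hϖ : Irreducible ϖ) (hN : N ≠ 0) : IsLocalRing (Kummer ϖ N) := by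
  have := Kummer.isDomain hϖ hN
  refine IsLocalRing.of_nonunits_add fun a b ha hb => ?_
  rw [mem_nonunits_iff, Kummer.isUnit_iff hϖ hN] at *
  exact dvd_add ha hb

theorem Kummer.root_ne_zero (hϖ : Irreducible ϖ) (hN : N ≠ 0) :
    AdjoinRoot.root (kummerPoly ϖ N) ≠ 0 := by
  intro h
  have h1 := Kummer.root_pow (ϖ := ϖ) (N := N)
  rw [h, zero_pow hN] at h1
  have hinj : Function.Injective (AdjoinRoot.of (kummerPoly ϖ N)) :=
    AdjoinRoot.of.injective_of_degree_ne_zero (by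
      rw [degree_X_pow_sub_C (Nat.pos_of_ne_zero hN)]; exact_mod_cast hN)
  exact hϖ.ne_zero (hinj (by rw [← h1, map_zero]))

theorem Kummer.isDiscreteValuationRing (hϖ : Irreducible ϖ) (hN : N ≠ 0) :
    letI := Kummer.isDomain hϖ hN
    IsDiscreteValuationRing (Kummer ϖ N) := by
  have := Kummer.isDomain hϖ hN
  have := Kummer.isLocalRing hϖ hN
  have hf : ¬ IsField (Kummer ϖ N) := fun h =>
    Kummer.not_isUnit_root hϖ hN (by
      obtain ⟨b, hb⟩ := h.mul_inv_cancel (Kummer.root_ne_zero hϖ hN)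
      exact IsUnit.of_mul_eq_one b hb)
  -- A Noetherian local domain that is not a field is a discrete valuation ring as soon as its
  -- maximal ideal is principal.
  have h := (IsDiscreteValuationRing.TFAE (Kummer ϖ N) hf).out 0 4
  refine h.mpr ⟨AdjoinRoot.root (kummerPoly ϖ N), ?_⟩
  ext s
  rw [mem_maximalIdeal, mem_nonunits_iff, Kummer.isUnit_iff hϖ hN]
  exact Ideal.mem_span_singleton.symm

end Kummer

variable (O : CoeffRing.{u, v} p k)

/-- The extension of `σ` fixing the root. -/
def kummerσ {ϖ : O.carrier} (hσ : O.σ ϖ = ϖ) (N : ℕ) : Kummer ϖ N ≃+* Kummer ϖ N :=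
  AdjoinRoot.mapRingEquiv O.σ (kummerPoly ϖ N) (kummerPoly ϖ N) (by
    rw [Polynomial.map_sub, Polynomial.map_pow, map_X, map_C]
    simp [hσ])

theorem kummerσ_of {ϖ : O.carrier} (hσ : O.σ ϖ = ϖ) (N : ℕ) (a : O.carrier) :
    O.kummerσ hσ N (AdjoinRoot.of _ a) = AdjoinRoot.of _ (O.σ a) := by
  simp [kummerσ, AdjoinRoot.mapRingEquiv]

theorem kummerσ_root {ϖ : O.carrier} (hσ : O.σ ϖ = ϖ) (N : ℕ) :
    O.kummerσ hσ N (AdjoinRoot.root _) = AdjoinRoot.root _ := by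
  simp [kummerσ, AdjoinRoot.mapRingEquiv]

/-- Adjoining an `N`-th root of a uniformizer fixed by `σ`. -/
def kummer {ϖ : O.carrier} (hϖ : Irreducible ϖ) (hσ : O.σ ϖ = ϖ) {N : ℕ} (hN : N ≠ 0) :
    CoeffRing.{u, v} p k :=
  letI := Kummer.isDomain hϖ hN
  letI := Kummer.isDiscreteValuationRing hϖ hN
  letI : Module.Finite O.carrier (Kummer ϖ N) := (kummerPoly_monic hN).finite_adjoinRoot
  { carrier := Kummer ϖ N
    finite := Module.Finite.trans O.carrier _
    algebraMap_injective := by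
      rw [AdjoinRoot.algebraMap_eq']
      exact (AdjoinRoot.of.injective_of_degree_ne_zero (by
        rw [degree_X_pow_sub_C (Nat.pos_of_ne_zero hN)]; exact_mod_cast hN)).comp
          O.algebraMap_injective
    residue_surjective := by
      intro y
      obtain ⟨s, rfl⟩ := IsLocalRing.residue_surjective y
      obtain ⟨a, t, rfl⟩ := Kummer.exists_eq s
      obtain ⟨w, hw⟩ := O.residue_surjective (residue O.carrier a)
      refine ⟨w, ?_⟩
      have h1 : residue O.carrier (algebraMap _ _ w - a) = 0 := by
        rw [map_sub, sub_eq_zero]; exact hw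
      rw [← dvd_iff_residue hϖ] at h1
      obtain ⟨b, hb⟩ := h1
      beta_reduce
      rw [← sub_eq_zero, ← map_sub, residue_eq_zero_iff, mem_maximalIdeal, mem_nonunits_iff,
        Kummer.isUnit_iff hϖ hN, AdjoinRoot.algebraMap_eq', RingHom.comp_apply, ← sub_sub,
        ← map_sub, hb, map_mul, ← Kummer.root_pow]
      exact dvd_sub ((dvd_pow_self _ hN).mul_right _) (dvd_mul_right _ _)
    σ := O.kummerσ hσ N
    σ_algebraMap := fun w => by
      rw [AdjoinRoot.algebraMap_eq', RingHom.comp_apply, RingHom.comp_apply, ← O.σ_algebraMap,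
        kummerσ_of] }

/-- Fixed elements of arbitrary small fractional valuation exist after an extension. -/
theorem exists_hom_root {ϖ : O.carrier} (hϖ : Irreducible ϖ) (hσ : O.σ ϖ = ϖ) {N : ℕ}
    (hN : N ≠ 0) : ∃ (O' : CoeffRing.{u, v} p k) (f : Hom O O') (x : O'.carrier),
      O'.σ x = x ∧ x ^ N = f.toRingHom ϖ := by
  refine ⟨O.kummer hϖ hσ hN, ⟨AdjoinRoot.of (kummerPoly ϖ N), fun w => ?_, fun a => ?_⟩,
    AdjoinRoot.root (kummerPoly ϖ N), ?_, Kummer.root_pow⟩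
  · rfl
  · exact (O.kummerσ_of hσ N a).symm
  · exact O.kummerσ_root hσ N

/-- Composition of extensions. -/
def Hom.comp {O₁ O₂ O₃ : CoeffRing.{u, v} p k} (g : Hom O₂ O₃) (f : Hom O₁ O₂) : Hom O₁ O₃ where
  toRingHom := g.toRingHom.comp f.toRingHom
  map_algebraMap w := by simp [f.map_algebraMap, g.map_algebraMap]
  map_σ a := by simp [f.map_σ, g.map_σ]

/-- The identity extension. -/
def Hom.id : Hom O O where
  toRingHom := RingHom.id _
  map_algebraMap _ := rfl
  map_σ _ := rfl

variable {O}

/-- The embedding of fraction fields induced by an extension. -/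
abbrev Hom.fF {O O' : CoeffRing.{u, v} p k} (f : Hom O O') : O.FracField →+* O'.FracField :=
  fracMap f.toRingHom

theorem Hom.fF_σF {O O' : CoeffRing.{u, v} p k} (f : Hom O O') (a : O.FracField) :
    f.fF (O.σF a) = O'.σF (f.fF a) := by
  obtain ⟨a, b, hb, rfl⟩ := IsFractionRing.div_surjective (A := O.carrier) a
  simp [f.map_σ]

theorem Hom.fF_comp {O₁ O₂ O₃ : CoeffRing.{u, v} p k} (g : Hom O₂ O₃) (f : Hom O₁ O₂)
    (a : O₁.FracField) : (g.comp f).fF a = g.fF (f.fF a) := by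
  obtain ⟨a, b, hb, rfl⟩ := IsFractionRing.div_surjective (A := O₁.carrier) a
  simp [Hom.comp]

end CoeffRing

end

/-! ### The Dieudonné–Manin decomposition -/

section

/-- Independence amounts to a left inverse matrix over `K`, and its image under `f` is a left
inverse over `L`. -/
theorem linearIndependent_comp_ringHom {K L : Type*} [Field K] [Field L] (f : K →+* L) {ι : Type*}
    [Fintype ι] [DecidableEq ι] {n : ℕ} {w : ι → Fin n → K} (hw : LinearIndependent K w) :
    LinearIndependent L fun i j => f (w i j) := by
  obtain ⟨g, hg⟩ := LinearMap.exists_leftInverse_of_injective (Fintype.linearCombination K w)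
    (LinearMap.ker_eq_bot.mpr
      (linearIndependent_iff_injective_fintypeLinearCombination.mp hw))
  set B := LinearMap.toMatrix' g with hB
  have h1 : ∀ i, B *ᵥ w i = Pi.single i 1 := fun i => by
    rw [hB, LinearMap.toMatrix'_mulVec]
    have := LinearMap.congr_fun hg (Pi.single i 1)
    simpa using this
  refine LinearIndependent.of_comp ((B.map f).mulVecLin) ?_
  have h2 : ((B.map f).mulVecLin ∘ fun i j => f (w i j)) = fun i : ι => Pi.single i (1 : L) := by
    funext i j
    have := congrArg f (congrFun (h1 i) j)
    simp only [Matrix.mulVec, dotProduct, map_sum, map_mul] at this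
    simp only [Function.comp, Matrix.mulVecLin_apply, Matrix.mulVec, dotProduct, Matrix.map_apply,
      this]
    by_cases h : j = i
    · subst h; simp
    · simp [Pi.single_eq_of_ne h]
  rw [h2]
  exact Pi.linearIndependent_single_one ι L

namespace CoeffRing

variable {p : ℕ} [Fact p.Prime] {k : Type v} [Field k] [IsAlgClosed k] [CharP k p]
variable {O : CoeffRing.{u, v} p k} {n : ℕ}

/-- The semilinear map `x ↦ A σ(x)`. -/
def frobVec (A : Matrix (Fin n) (Fin n) O.FracField) :
    (Fin n → O.FracField) →ₛₗ[O.σF] (Fin n → O.FracField) where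
  toFun x := A *ᵥ fun i => O.σF (x i)
  map_add' x y := by
    rw [← Matrix.mulVec_add]; congr 1; ext i; simp
  map_smul' r x := by
    rw [← Matrix.mulVec_smul]; congr 1; ext i; simp

theorem frobVec_apply (A : Matrix (Fin n) (Fin n) O.FracField) (x : Fin n → O.FracField) :
    frobVec A x = A *ᵥ fun i => O.σF (x i) := rfl

theorem frobVec_injective {A : Matrix (Fin n) (Fin n) O.FracField} (hA : IsUnit A) :
    Function.Injective (frobVec A) := by
  intro x y h
  have h1 := Matrix.mulVec_injective_iff_isUnit.mpr hA h
  funext i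
  exact O.σF.injective (congrFun h1 i)

theorem frobVec_map {O' : CoeffRing.{u, v} p k} (f : Hom O O')
    (A : Matrix (Fin n) (Fin n) O.FracField) (x : Fin n → O.FracField) :
    frobVec (A.map f.fF) (fun i => f.fF (x i)) = fun i => f.fF (frobVec A x i) := by
  funext i
  simp only [frobVec_apply, Matrix.mulVec, dotProduct, Matrix.map_apply, map_sum, map_mul,
    f.fF_σF]

/-- Extending a family of eigenvectors: the minimal relation between the iterates of a vector
outside their span. -/
theorem exists_minimal_relation {A : Matrix (Fin n) (Fin n) O.FracField} (hA : IsUnit A) {r : ℕ}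
    (hr : r < n) {w : Fin r → Fin n → O.FracField} (hw : LinearIndependent O.FracField w)
    {c : Fin r → O.FracField} (hc : ∀ j, c j ≠ 0) (hwc : ∀ j, frobVec A (w j) = c j • w j) :
    ∃ (m : ℕ) (g : ℕ → Fin n → O.FracField) (s : Fin r → O.FracField) (a : ℕ → O.FracField),
      (∀ i, g (i + 1) = frobVec A (g i)) ∧
      g (m + 1) = ∑ j, s j • w j + ∑ i ∈ Finset.range (m + 1), a i • g i ∧
      (∃ i ≤ m, a i ≠ 0) ∧
      LinearIndependent O.FracField (Sum.elim w fun i : Fin (m + 1) => g i) := by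
  classical
  obtain ⟨v, hv⟩ : ∃ v, v ∉ Submodule.span O.FracField (Set.range w) := by
    by_contra hcon
    push Not at hcon
    have h1 : Submodule.span O.FracField (Set.range w) = ⊤ := by
      rw [eq_top_iff]; exact fun v _ => hcon v
    have h2 := finrank_span_eq_card hw
    rw [h1, finrank_top, Module.finrank_fin_fun, Fintype.card_fin] at h2
    omega
  set F := frobVec A
  let g : ℕ → Fin n → O.FracField := fun i => F^[i] v
  have hg : ∀ i, g (i + 1) = F (g i) := fun i => Function.iterate_succ_apply' _ _ _
  -- One sequence lists the eigenvectors `w` and then `v, F v, F² v, …`; the first iterate that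
  -- depends on its predecessors gives the relation, and it is not `v` itself.
  let y : ℕ → Fin n → O.FracField := fun j => if h : j < r then w ⟨j, h⟩ else g (j - r)
  have hyw : ∀ j : Fin r, y j = w j := fun j => by simp [y]
  have hyg : ∀ i, y (r + i) = g i := fun i => by simp [y]
  have hLI : ∀ m : ℕ, (∀ i < m, y (r + i) ∉ Submodule.span O.FracField
      (Set.range fun j : Fin (r + i) => y j)) →
      LinearIndependent O.FracField fun j : Fin (r + m) => y j := by
    intro m
    induction m with
    | zero =>
      intro _
      have h0 : (fun j : Fin r => y j) = w := funext hyw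
      exact h0 ▸ hw
    | succ m ih =>
      intro h
      refine (linearIndependent_finSucc' (n := r + m)).mpr ⟨?_, ?_⟩
      · exact ih fun i hi => h i (by omega)
      · exact h m (by omega)
  have hex : ∃ m, y (r + m) ∈ Submodule.span O.FracField
      (Set.range fun j : Fin (r + m) => y j) := by
    by_contra hcon
    push Not at hcon
    have := (hLI (n + 1) fun i _ => hcon i).fintype_card_le_finrank
    rw [Module.finrank_fin_fun, Fintype.card_fin] at this
    omega
  have hmem := Nat.find_spec hex
  have hmin := hLI (Nat.find hex) fun i hi => Nat.find_min hex hi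
  obtain ⟨m, hm⟩ : ∃ m, Nat.find hex = m + 1 := by
    refine Nat.exists_eq_succ_of_ne_zero fun h => ?_
    rw [h] at hmem
    refine hv ?_
    have h0 : (fun j : Fin r => y j) = w := funext hyw
    change y (r + 0) ∈ Submodule.span O.FracField (Set.range fun j : Fin r => y j) at hmem
    rwa [h0, hyg 0] at hmem
  rw [hm] at hmem hmin
  rw [hyg, Submodule.mem_span_range_iff_exists_fun] at hmem
  obtain ⟨d, hd⟩ := hmem
  have hLI2 : LinearIndependent O.FracField (Sum.elim w fun i : Fin (m + 1) => g i) := by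
    have := hmin.comp finSumFinEquiv finSumFinEquiv.injective
    convert this using 1
    funext j
    rcases j with j | j
    · exact (hyw j).symm
    · exact (hyg j).symm
  let a : ℕ → O.FracField := fun i => if h : i < m + 1 then d (Fin.natAdd r ⟨i, h⟩) else 0
  have hrel : g (m + 1) = ∑ j, d (Fin.castAdd (m + 1) j) • w j +
      ∑ i ∈ Finset.range (m + 1), a i • g i := by
    rw [← hd, Fin.sum_univ_add, Finset.sum_range]
    congr 1
    · exact Finset.sum_congr rfl fun j _ => by rw [← hyw j]; rfl
    · refine Finset.sum_congr rfl fun j _ => ?_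
      simp only [Fin.val_natAdd, hyg, a]
      rw [dif_pos j.2]
  refine ⟨m, g, fun j => d (Fin.castAdd (m + 1) j), a, hg, hrel, ?_, hLI2⟩
  -- If all `aᵢ` vanished, `F (g m)` would lie in the span of the `w j`. These are eigenvectors with
  -- nonzero eigenvalues and `σ` is surjective, so `F` maps their span onto itself; by injectivity
  -- of `F`, `g m` would lie in the span.
  by_contra hcon
  push Not at hcon
  have hsum : ∑ i ∈ Finset.range (m + 1), a i • g i = 0 := Finset.sum_eq_zero fun i hi => by
    rw [hcon i (by simpa [Nat.lt_succ_iff] using hi), zero_smul]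
  rw [hsum, add_zero, hg] at hrel
  choose τ hτ using O.σF_surjective
  have h3 : g m = ∑ j, τ (d (Fin.castAdd (m + 1) j) / c j) • w j := by
    apply frobVec_injective hA
    change F (g m) = F _
    rw [hrel, map_sum]
    refine Finset.sum_congr rfl fun j _ => ?_
    rw [LinearMap.map_smulₛₗ, hwc, hτ, smul_smul, div_mul_cancel₀ _ (hc j)]
  have h4 := (linearIndependent_sum.mp hLI2).2.2
  rw [Submodule.disjoint_def] at h4
  have h5 := h4 (g m) (by
    rw [h3]
    exact Submodule.sum_mem _ fun j _ => Submodule.smul_mem _ _ (Submodule.subset_span ⟨j, rfl⟩))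
    (Submodule.subset_span ⟨Fin.last m, rfl⟩)
  exact hLI2.ne_zero (Sum.inr (Fin.last m)) h5

theorem σF_pow_algebraMap (j : ℕ) (a : O.carrier) : (O.σF ^ j) (algebraMap O.carrier O.FracField a) =
    algebraMap O.carrier O.FracField (O.σpow j a) := by
  induction j with
  | zero => simp
  | succ j ih =>
    rw [pow_succ', RingHom.mul_def, RingHom.comp_apply, ih, σpow_succ_apply, fracMap_algebraMap]
    rfl

theorem norm_σF_pow (j : ℕ) (x : O.FracField) : ‖(O.σF ^ j) x‖ = ‖x‖ := by
  induction j with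
  | zero => simp
  | succ j ih => rw [pow_succ', RingHom.mul_def, RingHom.comp_apply, norm_σF, ih]

/-- Solving the triangular system for an eigenvector with eigenvalue `c`. -/
theorem exists_eigen_coeffs {c : O.FracField} (hc : c ≠ 0) (hσc : O.σF c = c) {m : ℕ}
    {a : ℕ → O.FracField} (ha : ∀ i ≤ m, ‖a i‖ ≤ ‖c‖ ^ (m + 1 - i))
    {i₀ : ℕ} (hi₀ : i₀ ≤ m) (ha₀ : ‖a i₀‖ = ‖c‖ ^ (m + 1 - i₀)) :
    ∃ y : ℕ → O.FracField, y m ≠ 0 ∧ c * y 0 = a 0 * O.σF (y m) ∧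
      ∀ i, c * y (i + 1) = O.σF (y i) + a (i + 1) * O.σF (y m) := by
  have hcn : 0 < ‖c‖ := norm_pos_iff.mpr hc
  -- Eliminating all unknowns but `yₘ` leaves `yₘ = ∑ bⱼ σʲ⁺¹(yₘ)` with `bⱼ = σʲ(aₘ₋ⱼ) / c^(j+1)`.
  -- The bounds on the `aᵢ` make the `bⱼ` integral, and equality at `i₀` makes the one with `j = m -
  -- i₀` a unit.
  have hb : ∀ j : Fin (m + 1), ∃ b : O.carrier, algebraMap O.carrier O.FracField b =
      (O.σF ^ (j : ℕ)) (a (m - j)) / c ^ ((j : ℕ) + 1) := fun j => O.exists_of_norm_le_one (by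
    rw [norm_div, norm_σF_pow, norm_pow]
    refine div_le_one_of_le₀ ?_ (by positivity)
    have := ha (m - j) (by omega)
    rwa [show m + 1 - (m - (j : ℕ)) = j + 1 by omega] at this)
  choose b hb using hb
  obtain ⟨z, hz, hz'⟩ := exists_isUnit_frobOp_eq_zero b (j₀ := ⟨m - i₀, by omega⟩) (by
    rw [← O.norm_algebraMap_eq_one_iff, hb, norm_div, norm_σF_pow, norm_pow]
    simp only
    rw [show m - (m - i₀) = i₀ by omega, ha₀, show m + 1 - i₀ = m - i₀ + 1 by omega]
    exact div_self (by positivity))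
  set Z := algebraMap O.carrier O.FracField z with hZ
  let y : ℕ → O.FracField := fun i => ∑ l ∈ Finset.range (i + 1),
    (O.σF ^ l) (a (i - l)) / c ^ (l + 1) * (O.σF ^ (l + 1)) Z
  have hym : y m = Z := by
    have := congrArg (algebraMap O.carrier O.FracField) hz'
    rw [map_sum] at this
    rw [hZ, this]
    simp only [y, Finset.sum_range]
    refine Finset.sum_congr rfl fun j _ => ?_
    rw [map_mul, hb, ← σF_pow_algebraMap]
  have hσs : ∀ (l : ℕ) (x : O.FracField), O.σF ((O.σF ^ l) x) = (O.σF ^ (l + 1)) x := by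
    intro l x
    rw [pow_succ', RingHom.mul_def, RingHom.comp_apply]
  refine ⟨y, ?_, ?_, fun i => ?_⟩
  · rw [hym, hZ]
    exact (map_ne_zero_iff _ (IsFractionRing.injective O.carrier O.FracField)).mpr hz.ne_zero
  · rw [hym]
    simp only [y, Finset.sum_range_one, pow_zero, zero_add, pow_one]
    simp only [RingHom.one_def, RingHom.id_apply]
    field_simp
  · rw [hym]
    simp only [y]
    rw [Finset.sum_range_succ', mul_add, map_sum, Finset.mul_sum]
    congr 1
    · refine Finset.sum_congr rfl fun l _ => ?_
      rw [map_mul, map_div₀, map_pow, hσc, hσs, hσs,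
        show i + 1 - (l + 1) = i - l by omega, pow_succ c (l + 1)]
      field_simp
    · simp only [pow_zero, zero_add, pow_one, Nat.sub_zero, RingHom.one_def, RingHom.id_apply]
      field_simp

theorem exists_norm_eq_zpow {ϖ : O.carrier} (hϖ : Irreducible ϖ) {x : O.FracField} (hx : x ≠ 0) :
    ∃ α : ℤ, ‖x‖ = ‖algebraMap O.carrier O.FracField ϖ‖ ^ α := by
  obtain ⟨a, b, hb, rfl⟩ := IsFractionRing.div_surjective (A := O.carrier) x
  have ha : a ≠ 0 := by rintro rfl; simp at hx
  have hb0 : b ≠ 0 := nonZeroDivisors.ne_zero hb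
  obtain ⟨m, w, rfl⟩ := IsDiscreteValuationRing.eq_unit_mul_pow_irreducible ha hϖ
  obtain ⟨l, w', rfl⟩ := IsDiscreteValuationRing.eq_unit_mul_pow_irreducible hb0 hϖ
  have hq : ‖algebraMap O.carrier O.FracField ϖ‖ ≠ 0 := by
    simpa using hϖ.ne_zero
  refine ⟨(m : ℤ) - l, ?_⟩
  rw [zpow_sub₀ hq, zpow_natCast, zpow_natCast, norm_div, map_mul, map_mul, norm_mul, norm_mul,
    (O.norm_algebraMap_eq_one_iff _).mpr w.isUnit, (O.norm_algebraMap_eq_one_iff _).mpr w'.isUnit,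
    map_pow, map_pow, norm_pow, norm_pow, one_mul, one_mul]

/-- After an extension there is an eigenvalue of the right absolute value. -/
theorem exists_hom_eigenvalue {m : ℕ} {a : ℕ → O.FracField} (ha : ∃ i ≤ m, a i ≠ 0) :
    ∃ (O' : CoeffRing.{u, v} p k) (f : Hom O O') (c : O'.FracField), c ≠ 0 ∧ O'.σF c = c ∧
      (∀ i ≤ m, ‖f.fF (a i)‖ ≤ ‖c‖ ^ (m + 1 - i)) ∧
        ∃ i₀ ≤ m, ‖f.fF (a i₀)‖ = ‖c‖ ^ (m + 1 - i₀) := by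
  classical
  obtain ⟨ϖ, hϖ, hσ⟩ := O.exists_irreducible_fixed
  -- Every `m + 1 - i` with `i ≤ m` divides `(m + 1)!`; so after adjoining the root `x` of this
  -- order, each `|aᵢ|^(1/(m+1-i))` with `aᵢ ≠ 0` is an integral power of `|x|`.
  have hN : (m + 1).factorial ≠ 0 := Nat.factorial_ne_zero _
  obtain ⟨O', f, x, hx, hxN⟩ := O.exists_hom_root hϖ hσ hN
  have hα : ∀ i, ∃ α : ℤ, a i ≠ 0 → ‖a i‖ = ‖algebraMap O.carrier O.FracField ϖ‖ ^ α := fun i => by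
    by_cases h : a i = 0
    · exact ⟨0, fun h' => absurd h h'⟩
    · obtain ⟨α, hα⟩ := exists_norm_eq_zpow hϖ h
      exact ⟨α, fun _ => hα⟩
  choose α hα using hα
  have hd : ∀ i, i ≤ m → ∃ e : ℤ, e * ((m + 1 - i : ℕ) : ℤ) = (m + 1).factorial := fun i hi => by
    obtain ⟨e, he⟩ := Nat.dvd_factorial (m := m + 1 - i) (n := m + 1) (by omega) (by omega)
    exact ⟨e, by rw [he]; push_cast; ring⟩
  choose! e he using hd
  let S := (Finset.range (m + 1)).filter fun i => a i ≠ 0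
  have hS : S.Nonempty := by
    obtain ⟨i, hi, hi'⟩ := ha
    exact ⟨i, by simp [S, hi', hi]⟩
  -- Since `|x| ≤ 1`, the least exponent belongs to the largest `|aᵢ|^(1/(m+1-i))`, an extreme slope
  -- of the Newton polygon of the relation.
  obtain ⟨i₀, hi₀, hmin⟩ := S.exists_min_image (fun i => α i * e i) hS
  set X := algebraMap O'.carrier O'.FracField x with hX
  set q := ‖X‖ with hq
  have hqN : q ^ (m + 1).factorial = ‖algebraMap O.carrier O.FracField ϖ‖ := by
    rw [hq, ← norm_pow, hX, ← map_pow, hxN, norm_map_int]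
  have hX0 : X ≠ 0 := by
    intro h
    rw [hq, h, norm_zero, zero_pow hN] at hqN
    have : algebraMap O.carrier O.FracField ϖ ≠ 0 := by simpa using hϖ.ne_zero
    exact this (norm_eq_zero.mp hqN.symm)
  have hq0 : 0 < q := norm_pos_iff.mpr hX0
  have hq1 : q ≤ 1 := O'.norm_algebraMap_le_one _
  have hnorm : ∀ i ∈ S, ‖f.fF (a i)‖ = q ^ (α i * e i * ((m + 1 - i : ℕ) : ℤ)) := by
    intro i hi
    have hi' : i ≤ m ∧ a i ≠ 0 := by simpa [S, Nat.lt_succ_iff] using hi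
    rw [norm_fracMap, hα i hi'.2, ← hqN, mul_assoc, he i hi'.1, ← zpow_natCast, ← zpow_mul,
      mul_comm]
  have hcn : ∀ i, ‖X ^ (α i₀ * e i₀)‖ ^ (m + 1 - i) =
      q ^ (α i₀ * e i₀ * ((m + 1 - i : ℕ) : ℤ)) := fun i => by
    rw [norm_zpow, ← zpow_natCast, ← zpow_mul]
  have hi₀' : i₀ ≤ m ∧ a i₀ ≠ 0 := by simpa [S, Nat.lt_succ_iff] using hi₀
  refine ⟨O', f, X ^ (α i₀ * e i₀), zpow_ne_zero _ hX0, ?_, fun i hi => ?_, i₀, hi₀'.1, ?_⟩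
  · rw [map_zpow₀, hX, fracMap_algebraMap]
    congr 2
  · by_cases h : a i = 0
    · rw [h, map_zero, norm_zero]; positivity
    · have hiS : i ∈ S := by simp [S, hi, h]
      rw [hnorm i hiS, hcn]
      exact zpow_le_zpow_right_of_le_one₀ hq0 hq1
        (mul_le_mul_of_nonneg_right (hmin i hiS) (by positivity))
  · rw [hnorm i₀ hi₀, hcn]

/-- Eigenvectors are added one at a time. Modulo the span of those already found, the iterates of a
new vector satisfy a single relation, and solving a triangular system gives `x = ∑ yᵢ gᵢ` with `F x
≡ c x`. The error is absorbed by a combination `∑ qⱼ wⱼ`, each `qⱼ` being the solution of a scalar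
equation `dⱼ σ(qⱼ) - c qⱼ = const`. The new vector is independent of the old ones because `yₘ ≠ 0`.
-/
theorem exists_hom_eigenvectors (A : Matrix (Fin n) (Fin n) O.FracField) (hA : IsUnit A) (r : ℕ)
    (hr : r ≤ n) : ∃ (O' : CoeffRing.{u, v} p k) (f : Hom O O') (w : Fin r → Fin n → O'.FracField)
      (c : Fin r → O'.FracField), LinearIndependent O'.FracField w ∧ (∀ j, c j ≠ 0) ∧
        ∀ j, frobVec (A.map f.fF) (w j) = c j • w j := by
  induction r with
  | zero => exact ⟨O, Hom.id O, Fin.elim0, Fin.elim0, linearIndependent_empty_type,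
      fun j => j.elim0, fun j => j.elim0⟩
  | succ r ih =>
    obtain ⟨O₁, f₁, w, d, hw, hd, hwd⟩ := ih (by omega)
    have hA₁ : IsUnit (A.map f₁.fF) := hA.map f₁.fF.mapMatrix
    obtain ⟨m, g, s, a, hg, hrel, ha, hLI⟩ := exists_minimal_relation hA₁ (by omega) hw hd hwd
    obtain ⟨O₂, f₂, c, hc, hσc, hac, i₀, hi₀, hac₀⟩ := exists_hom_eigenvalue ha
    obtain ⟨y, hym, hy0, hy⟩ := exists_eigen_coeffs hc hσc hac hi₀ hac₀
    set F := frobVec ((A.map f₁.fF).map f₂.fF) with hF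
    have hA₂ : A.map (f₂.comp f₁).fF = (A.map f₁.fF).map f₂.fF := by
      ext i j; simp [Hom.fF_comp]
    set w' : Fin r → Fin n → O₂.FracField := fun j i => f₂.fF (w j i) with hw'
    set g' : ℕ → Fin n → O₂.FracField := fun j i => f₂.fF (g j i) with hg'
    have hFg : ∀ i, g' (i + 1) = F (g' i) := fun i => by
      rw [hF, hg', frobVec_map]; simp only [hg i]
    have hFw : ∀ j, F (w' j) = f₂.fF (d j) • w' j := fun j => by
      rw [hF, hw', frobVec_map, hwd]; ext i; simp
    have hrel' : g' (m + 1) = ∑ j, f₂.fF (s j) • w' j +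
        ∑ i ∈ Finset.range (m + 1), f₂.fF (a i) • g' i := by
      ext l
      have := congrArg f₂.fF (congrFun hrel l)
      simpa [Finset.sum_apply, hg', hw'] using this
    have hLI' : LinearIndependent O₂.FracField (Sum.elim w' fun i : Fin (m + 1) => g' i) := by
      have := linearIndependent_comp_ringHom f₂.fF hLI
      convert this using 1
      funext j
      rcases j with j | j <;> rfl
    have hd' : ∀ j, f₂.fF (d j) ≠ 0 := fun j => (map_ne_zero _).mpr (hd j)
    choose q hq using fun j => exists_mul_σF_sub_mul_eq (hd' j) hc (-(O₂.σF (y m) * f₂.fF (s j)))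
    set x := ∑ i ∈ Finset.range (m + 1), y i • g' i with hx
    have hFx : F x = c • x + ∑ j, (O₂.σF (y m) * f₂.fF (s j)) • w' j := by
      rw [hx, map_sum]
      simp only [LinearMap.map_smulₛₗ, ← hFg]
      rw [Finset.sum_range_succ, hrel', smul_add, Finset.smul_sum, Finset.smul_sum,
        Finset.sum_range_succ' (fun i => O₂.σF (y m) • f₂.fF (a i) • g' i),
        Finset.sum_range_succ' (fun i => y i • g' i), smul_add, Finset.smul_sum]
      simp only [smul_smul, hy0, hy, add_smul, Finset.sum_add_distrib,
        mul_comm (O₂.σF (y m)) (f₂.fF (a _))]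
      abel
    have hx'F : F (x + ∑ j, q j • w' j) = c • (x + ∑ j, q j • w' j) := by
      rw [map_add, hFx, map_sum, smul_add, Finset.smul_sum (s := Finset.univ), add_assoc,
        ← Finset.sum_add_distrib]
      congr 1
      refine Finset.sum_congr rfl fun j _ => ?_
      rw [LinearMap.map_smulₛₗ, hFw, smul_smul, smul_smul, ← add_smul]
      congr 1
      linear_combination hq j
    obtain ⟨hLw, hLg, hdisj⟩ := linearIndependent_sum.mp hLI'
    have hspan : ∀ t : Fin r → O₂.FracField, ∑ j, t j • w' j ∈
        Submodule.span O₂.FracField (Set.range w') := fun t =>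
      Submodule.sum_mem _ fun j _ => Submodule.smul_mem _ _ (Submodule.subset_span ⟨j, rfl⟩)
    refine ⟨O₂, f₂.comp f₁, Fin.snoc w' (x + ∑ j, q j • w' j),
      Fin.snoc (fun j => f₂.fF (d j)) c, ?_, ?_, ?_⟩
    · rw [linearIndependent_finSnoc]
      refine ⟨hLw, fun hmem => ?_⟩
      have h1 : x ∈ Submodule.span O₂.FracField (Set.range w') := by
        have := Submodule.sub_mem _ hmem (hspan q)
        rwa [add_sub_cancel_right] at this
      have h2 : x ∈ Submodule.span O₂.FracField (Set.range fun i : Fin (m + 1) => g' i) := by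
        rw [hx, Finset.sum_range]
        exact Submodule.sum_mem _ fun j _ => Submodule.smul_mem _ _
          (Submodule.subset_span ⟨j, rfl⟩)
      have h3 : x = 0 := (Submodule.disjoint_def.mp hdisj) x h1 h2
      rw [hx, Finset.sum_range] at h3
      exact hym (Fintype.linearIndependent_iff.mp hLg (fun i => y i) h3 (Fin.last m))
    · intro j
      refine Fin.lastCases ?_ (fun j => ?_) j
      · rwa [Fin.snoc_last]
      · rw [Fin.snoc_castSucc]; exact hd' j
    · intro j
      rw [hA₂]
      refine Fin.lastCases ?_ (fun j => ?_) j
      · rw [Fin.snoc_last, Fin.snoc_last]; exact hx'F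
      · rw [Fin.snoc_castSucc, Fin.snoc_castSucc]; exact hFw j

/-- The Dieudonné–Manin decomposition: after an extension of `𝒪`, every `F`-isocrystal with an
effective lattice is a sum of trivial ones. -/
theorem exists_hom_diagonal (A : Matrix (Fin n) (Fin n) O.carrier)
    (hA : IsUnit (A.map (algebraMap O.carrier O.FracField))) :
    ∃ (O' : CoeffRing.{u, v} p k) (f : Hom O O') (X : Matrix (Fin n) (Fin n) O'.FracField)
      (c : Fin n → O'.carrier), IsUnit X ∧ (∀ j, c j ≠ 0) ∧
        (A.map fun a => algebraMap O'.carrier O'.FracField (f.toRingHom a)) * X.map O'.σF =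
          X * Matrix.diagonal fun j => algebraMap O'.carrier O'.FracField (c j) := by
  obtain ⟨O', f, w, c, hw, hc, hwc⟩ := exists_hom_eigenvectors _ hA n le_rfl
  have hAf : (A.map (algebraMap O.carrier O.FracField)).map f.fF =
      A.map fun a => algebraMap O'.carrier O'.FracField (f.toRingHom a) := by
    ext i j; simp
  rw [hAf] at hwc
  -- `A` is integral and `σ` is isometric, so `A σ(w) = c w`, read at a coordinate of `w` of largest
  -- absolute value, gives `|c| ≤ 1`.
  have hc1 : ∀ j, ∃ b : O'.carrier, algebraMap O'.carrier O'.FracField b = c j := by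
    intro j
    refine O'.exists_of_norm_le_one ?_
    have hw0 := hw.ne_zero j
    obtain ⟨i₁, hi₁⟩ := Function.ne_iff.mp hw0
    obtain ⟨i, -, hi⟩ := Finset.univ.exists_max_image (fun i => ‖w j i‖) ⟨i₁, Finset.mem_univ _⟩
    have hpos : 0 < ‖w j i‖ := (norm_pos_iff.mpr hi₁).trans_le (hi i₁ (Finset.mem_univ _))
    have h1 := congrFun (hwc j) i
    rw [frobVec_apply, Pi.smul_apply, smul_eq_mul] at h1
    have h2 : ‖c j‖ * ‖w j i‖ ≤ ‖w j i‖ := by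
      rw [← norm_mul, ← h1]
      simp only [Matrix.mulVec, dotProduct]
      refine IsUltrametricDist.norm_sum_le_of_forall_le_of_nonneg
        (norm_nonneg (w j i : O'.FracField)) fun l _ => ?_
      rw [norm_mul, norm_σF]
      calc _ ≤ 1 * ‖w j i‖ := mul_le_mul (O'.norm_algebraMap_le_one _) (hi l (Finset.mem_univ _))
            (norm_nonneg _) zero_le_one
        _ = _ := one_mul _
    by_contra hlt
    push Not at hlt
    nlinarith
  choose b hb using hc1
  refine ⟨O', f, Matrix.of fun i j => w j i, b, ?_, fun j h => hc j ?_, ?_⟩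
  · rw [← Matrix.linearIndependent_cols_iff_isUnit]
    exact hw
  · rw [← hb, h, map_zero]
  · ext i j
    have := congrFun (hwc j) i
    rw [Matrix.mul_diagonal, hb, Matrix.of_apply, mul_comm]
    rw [frobVec_apply] at this
    exact this

end CoeffRing

end

/-! ### Matrices of series and Dwork's trick -/

section

namespace AnCon

variable {E : Type u} [NormedField E] [CompleteSpace E]
variable {ι κ μ : Type*} [Fintype κ]

/-- All the entries of a matrix are supported on exponents `≥ k`. -/
def MatSuppGE (k : ℤ) (X : Matrix ι μ (AnCon E)) : Prop := ∀ i j, SuppGE k (X i j)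

/-- All the entries of a matrix have Gauss norm at most `B` at radius `r`. -/
def MatBd (r B : ℝ) (X : Matrix ι μ (AnCon E)) : Prop := ∀ i j, Bd r B (X i j)

namespace MatSuppGE

variable {k l : ℤ} {X Y : Matrix ι μ (AnCon E)}

theorem mono (h : l ≤ k) (hX : MatSuppGE k X) : MatSuppGE l X := fun i j => (hX i j).mono h

theorem add (hX : MatSuppGE k X) (hY : MatSuppGE k Y) : MatSuppGE k (X + Y) :=
  fun i j => (hX i j).add (hY i j)

theorem sub (hX : MatSuppGE k X) (hY : MatSuppGE k Y) : MatSuppGE k (X - Y) :=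
  fun i j => (hX i j).sub (hY i j)

theorem mul {X : Matrix ι κ (AnCon E)} {Y : Matrix κ μ (AnCon E)} (hX : MatSuppGE k X)
    (hY : MatSuppGE l Y) : MatSuppGE (k + l) (X * Y) := fun i j => by
  rw [Matrix.mul_apply]; exact SuppGE.sum fun a _ => (hX i a).mul (hY a j)

theorem one [DecidableEq ι] : MatSuppGE 0 (1 : Matrix ι ι (AnCon E)) := fun i j => by
  rw [Matrix.one_apply]; split_ifs; exacts [suppGE_one, SuppGE.zero 0]

/-- The constant term is multiplicative on series without negative exponents. -/
theorem coeff_zero_mul {X : Matrix ι κ (AnCon E)} {Y : Matrix κ μ (AnCon E)} (hX : MatSuppGE 0 X)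
    (hY : MatSuppGE 0 Y) : (X * Y).map (fun x => x.coeff 0) =
      X.map (fun x => x.coeff 0) * Y.map (fun x => x.coeff 0) := by
  ext i j
  rw [Matrix.map_apply, Matrix.mul_apply, Matrix.mul_apply, coeff_sum]
  exact Finset.sum_congr rfl fun a _ => (hX i a).coeff_mul_add (hY a j)

end MatSuppGE

namespace MatBd

variable {r B C : ℝ} {X Y : Matrix ι μ (AnCon E)}

theorem mono (h : B ≤ C) (hX : MatBd r B X) : MatBd r C X := fun i j => (hX i j).mono h

theorem neg (hX : MatBd r B X) : MatBd r B (-X) := fun i j => (hX i j).neg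

variable [IsUltrametricDist E]

theorem add (hr : 0 < r) (hX : MatBd r B X) (hY : MatBd r B Y) : MatBd r B (X + Y) :=
  fun i j => (hX i j).add hr (hY i j)

theorem mul (hr : 0 < r) {X : Matrix ι κ (AnCon E)} {Y : Matrix κ μ (AnCon E)} (hB : 0 ≤ B * C)
    (hX : MatBd r B X) (hY : MatBd r C Y) : MatBd r (B * C) (X * Y) := fun i j => by
  rw [Matrix.mul_apply]; exact Bd.sum hr hB fun a _ => (hX i a).mul hr (hY a j)

theorem one [DecidableEq ι] : MatBd r 1 (1 : Matrix ι ι (AnCon E)) := fun i j => by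
  rw [Matrix.one_apply]; split_ifs; exacts [bd_one, Bd.zero zero_le_one]

end MatBd

theorem eq_zero_of_matSuppGE {X : Matrix ι μ (AnCon E)} {f : ℕ → ℤ} (hf : ∀ n : ℤ, ∃ k, n < f k)
    (h : ∀ k, MatSuppGE (f k) X) : X = 0 := by
  ext1 i j
  exact eq_zero_of_suppGE hf fun k => h k i j

end AnCon

namespace CoeffRing

open AnCon

variable {p : ℕ} [Fact p.Prime] {k : Type v} [Field k] [IsAlgClosed k] [CharP k p]
variable {O : CoeffRing.{u, v} p k} {ι : Type*} [Fintype ι] [DecidableEq ι]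

theorem exists_lt_p_pow (n : ℤ) : ∃ m : ℕ, n < (p : ℤ) ^ m := by
  obtain ⟨m, hm⟩ := pow_unbounded_of_one_lt n
    (show (1 : ℤ) < p by exact_mod_cast (Fact.out : p.Prime).one_lt)
  exact ⟨m, hm⟩

theorem matSuppGE_frob {m : ℤ} {X : Matrix ι ι O.GammaAnCon} (hX : MatSuppGE m X) :
    MatSuppGE (p * m) (X.map O.frobAnCon) := fun i j => suppGE_frob (hX i j)

theorem isAnCon_of_polynomial_growth {x : ℤ → O.FracField} {C : ℝ} {l : ℕ}
    (h0 : ∀ n < 0, x n = 0) (h : ∀ n : ℕ, ‖x n‖ ≤ (C * (n + 1)) ^ l) : IsAnCon x := by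
  refine ⟨fun r hr hr1 => ?_, 1 / 2, by norm_num, by norm_num, ‖x 0‖, fun n => ?_⟩
  · have ht := tendsto_pow_const_mul_const_pow_of_abs_lt_one l (r := r) (by rwa [abs_of_pos hr])
    obtain ⟨D, hD⟩ := ht.bddAbove_range
    refine ⟨|C| ^ l * (D / r), fun n => ?_⟩
    have h1 : ((n + 1 : ℕ) : ℝ) ^ l * r ^ (n + 1) ≤ D := hD ⟨n + 1, rfl⟩
    calc ‖x n‖ * r ^ n ≤ (|C| * (n + 1)) ^ l * r ^ n := by
          gcongr
          refine (h n).trans ((le_abs_self _).trans ?_)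
          rw [abs_pow, abs_mul, abs_of_nonneg (a := (n : ℝ) + 1) (by positivity)]
      _ = |C| ^ l * ((((n + 1 : ℕ) : ℝ) ^ l * r ^ (n + 1)) / r) := by
          rw [mul_pow, pow_succ r]; push_cast; field_simp
      _ ≤ _ := by gcongr
  · rcases Nat.eq_zero_or_pos n with rfl | hn
    · simp
    · rw [h0 _ (by omega), norm_zero]; positivity

/-- For `b = p`, `K n` is a number of Frobenius iterations after which the coefficient of `tⁿ` no
longer changes; the second bound turns a size of `p^(l K n)` into polynomial growth in `n`. -/
theorem exists_log_bound {b : ℕ} (hb : 1 < b) :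
    ∃ K : ℤ → ℕ, (∀ n : ℤ, n < (b : ℤ) ^ K n) ∧ ∀ n : ℕ, (b : ℝ) ^ K n ≤ b * (n + 1) := by
  refine ⟨fun n => Nat.log b n.toNat + 1, fun n => ?_, fun n => ?_⟩
  · have := Nat.lt_pow_succ_log_self hb n.toNat
    calc n ≤ (n.toNat : ℤ) := Int.self_le_toNat n
      _ < _ := by exact_mod_cast this
  · have h1 : b ^ Nat.log b n ≤ n + 1 := by
      rcases Nat.eq_zero_or_pos n with rfl | hn
      · simp
      · exact (Nat.pow_log_le_self b hn.ne').trans (Nat.le_succ n)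
    simp only [Int.toNat_natCast]
    rw [pow_succ']
    gcongr
    exact_mod_cast h1

/-- Dwork's trick: two Frobenius structures on a free module that agree at `t = 0` are related by a
change of basis that is the identity at `t = 0`. -/
theorem exists_frobenius_conj {A A' C' : Matrix ι ι O.GammaAnCon} (hA : MatSuppGE 0 A)
    (hAb : MatBd 1 1 A) (hC : MatSuppGE 0 C') {l : ℕ} (hCb : MatBd 1 ((p : ℝ) ^ l) C')
    (hAC : A' * C' = 1) (hd : MatSuppGE 1 (A - A')) :
    ∃ U : Matrix ι ι O.GammaAnCon, MatSuppGE 1 (U - 1) ∧ A * U.map O.frobAnCon = U * A' := by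
  have hp1 : 1 < p := (Fact.out : p.Prime).one_lt
  -- The wanted matrix is a fixed point of `U ↦ A U^σ A'⁻¹`, and `C'` is the inverse of `A'`.
  obtain ⟨U, hU0, hUs⟩ : ∃ U : ℕ → Matrix ι ι O.GammaAnCon, U 0 = 1 ∧
      ∀ m, U (m + 1) = A * (U m).map O.frobAnCon * C' :=
    ⟨fun m => Nat.rec 1 (fun _ V => A * V.map O.frobAnCon * C') m, rfl, fun _ => rfl⟩
  have hmap1 : (1 : Matrix ι ι O.GammaAnCon).map O.frobAnCon = 1 :=
    Matrix.map_one _ (map_zero _) (map_one _)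
  -- The first difference vanishes at `t = 0`, and Frobenius multiplies the order of vanishing by
  -- `p`.
  have hUD : ∀ m, MatSuppGE ((p : ℤ) ^ m) (U (m + 1) - U m) := by
    intro m
    induction m with
    | zero =>
      rw [hUs, hU0, hmap1, mul_one, ← hAC, ← sub_mul, pow_zero]
      simpa using hd.mul hC
    | succ m ih =>
      rw [hUs (m + 1)]
      nth_rw 2 [hUs m]
      rw [← sub_mul, ← mul_sub, ← Matrix.map_sub _ (map_sub _), pow_succ']
      simpa using (hA.mul (matSuppGE_frob ih)).mul hC
  have hUn : ∀ m, MatSuppGE 0 (U m) := by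
    intro m
    induction m with
    | zero => rw [hU0]; exact MatSuppGE.one
    | succ m ih => rw [hUs]; simpa using (hA.mul (matSuppGE_frob ih)).mul hC
  -- At radius one Frobenius and `A` do not increase the Gauss norm, so each step costs at most the
  -- factor `p^l` coming from `C'`.
  have hUb : ∀ m, MatBd 1 (((p : ℝ) ^ m) ^ l) (U m) := by
    intro m
    induction m with
    | zero => simpa [hU0] using MatBd.one (r := 1) (ι := ι) (E := O.FracField)
    | succ m ih =>
      have := ((hAb.mul one_pos (by positivity)
        (Y := (U m).map O.frobAnCon) fun i j => bd_one_frob (ih i j))).mul one_pos (by positivity) hCb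
      rwa [one_mul, ← mul_pow, ← pow_succ, ← hUs] at this
  have hst : ∀ (a b : ℕ) (n : ℤ), a ≤ b → n < (p : ℤ) ^ a → ∀ i j,
      (U b i j).coeff n = (U a i j).coeff n := by
    intro a b n hab hn i j
    induction b, hab using Nat.le_induction with
    | base => rfl
    | succ b hab ih =>
      have h := hUD b i j n (hn.trans_le (pow_le_pow_right₀ (by exact_mod_cast hp1.le) hab))
      rw [Matrix.sub_apply, coeff_sub, Pi.sub_apply, sub_eq_zero] at h
      rw [h, ih]
  have hst' : ∀ (a b : ℕ) (n : ℤ), n < (p : ℤ) ^ b → n < (p : ℤ) ^ a → ∀ i j,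
      (U b i j).coeff n = (U a i j).coeff n := by
    intro a b n hb ha i j
    rcases le_total a b with h | h
    · exact hst a b n h ha i j
    · exact (hst b a n h hb i j).symm
  obtain ⟨K, hK, hKle⟩ := exists_log_bound hp1
  -- The coefficient of `tⁿ` is read off from the iterate of index `K n`, where it is final and has
  -- norm at most `(p (n + 1))^l`.
  let V : Matrix ι ι O.GammaAnCon := Matrix.of fun i j =>
    AnCon.mk (fun n => (U (K n) i j).coeff n) <| isAnCon_of_polynomial_growth (C := p) (l := l)
      (fun n hn => hUn (K n) i j n hn) (fun n => by
        have := hUb (K n) i j n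
        rw [one_zpow, mul_one] at this
        exact this.trans (pow_le_pow_left₀ (by positivity) (hKle n) l))
  have hV : ∀ m, MatSuppGE ((p : ℤ) ^ m) (V - U m) := fun m i j n hn => by
    rw [Matrix.sub_apply, coeff_sub, Pi.sub_apply, sub_eq_zero]
    exact hst' m (K n) n (hK n) hn i j
  refine ⟨V, by simpa [hU0] using hV 0, ?_⟩
  have hkey : A * V.map O.frobAnCon * C' - V = 0 := by
    refine eq_zero_of_matSuppGE (f := fun m : ℕ => (p : ℤ) ^ m) exists_lt_p_pow fun m => ?_
    have e : A * V.map O.frobAnCon * C' - V =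
        A * (V - U m).map O.frobAnCon * C' - (V - U (m + 1)) := by
      rw [Matrix.map_sub _ (map_sub _), mul_sub, sub_mul, ← hUs]; abel
    have hle : (p : ℤ) ^ m ≤ (p : ℤ) ^ (m + 1) :=
      pow_le_pow_right₀ (by exact_mod_cast hp1.le) (Nat.le_succ m)
    have h1 := (hA.mul (matSuppGE_frob (hV m))).mul hC
    rw [zero_add, add_zero, ← pow_succ'] at h1
    rw [e]
    exact (h1.mono hle).sub ((hV (m + 1)).mono hle)
  rw [sub_eq_zero] at hkey
  calc A * V.map O.frobAnCon = A * V.map O.frobAnCon * (C' * A') := by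
        rw [mul_eq_one_comm.mp hAC, mul_one]
    _ = V * A' := by rw [← mul_assoc, hkey]

/-- The relation `X = A X^σ A⁻¹` multiplies the order of vanishing of `X` by `p`, so this order is
infinite. -/
theorem eq_zero_of_frobenius_commute {A C X : Matrix ι ι O.GammaAnCon} (hA : MatSuppGE 0 A)
    (hC : MatSuppGE 0 C) (hAC : A * C = 1) (hX : MatSuppGE 1 X)
    (h : A * X.map O.frobAnCon = X * A) : X = 0 := by
  refine eq_zero_of_matSuppGE (f := fun m : ℕ => (p : ℤ) ^ m) exists_lt_p_pow fun m => ?_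
  have e : X = A * X.map O.frobAnCon * C := by rw [h, mul_assoc, hAC, mul_one]
  induction m with
  | zero => simpa using hX
  | succ m ih =>
    rw [e, pow_succ']
    simpa using (hA.mul (matSuppGE_frob ih)).mul hC

/-- A Frobenius structure over the bounded open disc is isomorphic over the open disc to its fibre
at `t = 0`. -/
theorem exists_conj_constant_term {A C : Matrix ι ι O.GammaAnCon} (hA : MatSuppGE 0 A)
    (hAb : MatBd 1 1 A) (hC : MatSuppGE 0 C) {l : ℕ} (hCb : MatBd 1 ((p : ℝ) ^ l) C)
    (hAC : A * C = 1) : ∃ U V : Matrix ι ι O.GammaAnCon, U * V = 1 ∧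
      A * U.map O.frobAnCon = U * A.map fun x => const (x.coeff 0) := by
  set A0 : Matrix ι ι O.GammaAnCon := A.map fun x => const (x.coeff 0) with hA0
  set C0 : Matrix ι ι O.GammaAnCon := C.map fun x => const (x.coeff 0) with hC0
  have h0 : A0 * C0 = 1 := by
    have h1 := congrArg (fun X : Matrix ι ι O.FracField => X.map (const : O.FracField →+* O.GammaAnCon))
      (hA.coeff_zero_mul hC)
    simp only [hAC, Matrix.map_mul, Matrix.map_map] at h1
    rw [hA0, hC0]
    refine h1.symm.trans ?_
    ext1 i j
    rw [Matrix.map_apply, Matrix.one_apply]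
    simp only [Function.comp]
    split_ifs
    · simp
    · simp
  have hA0s : MatSuppGE 0 A0 := fun i j => suppGE_const _
  have hC0s : MatSuppGE 0 C0 := fun i j => suppGE_const _
  have hcb : ∀ {B : ℝ} {x : O.GammaAnCon}, Bd 1 B x → Bd 1 B (const (x.coeff 0)) := fun hx =>
    bd_const _ |>.mono (by simpa using hx 0)
  have hd : ∀ x : O.GammaAnCon, SuppGE 0 x → SuppGE 1 (x - const (x.coeff 0)) := fun x hx i hi => by
    rw [coeff_sub, Pi.sub_apply, coeff_const]
    rcases lt_or_eq_of_le (show i ≤ 0 by omega) with h | rfl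
    · rw [hx i h, Pi.single_eq_of_ne h.ne, sub_zero]
    · simp
  -- The conjugation to the constant term and the one back are built separately. Their product
  -- commutes with the Frobenius structure and is `1` at `t = 0`, hence equals `1`.
  obtain ⟨U, hU1, hU⟩ := exists_frobenius_conj hA hAb hC0s (fun i j => hcb (hCb i j)) h0
    fun i j => hd _ (hA i j)
  obtain ⟨V, hV1, hV⟩ := exists_frobenius_conj hA0s (fun i j => hcb (hAb i j)) hC hCb hAC
    fun i j => by
      have := (hd _ (hA i j)).neg
      rwa [neg_sub] at this
  refine ⟨U, V, ?_, hU⟩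
  rw [← sub_eq_zero]
  have hU0 : MatSuppGE 0 U := by
    have := (hU1.mono zero_le_one).add MatSuppGE.one
    rwa [sub_add_cancel] at this
  refine eq_zero_of_frobenius_commute hA hC hAC ?_ ?_
  · have h1 := hU0.mul hV1
    rw [zero_add] at h1
    have := h1.add hU1
    convert this using 1
    rw [mul_sub, mul_one]; abel
  · rw [Matrix.map_sub _ (map_sub _), Matrix.map_mul, mul_sub, ← mul_assoc, hU, mul_assoc, hV,
      Matrix.map_one _ (map_zero _) (map_one _), sub_mul, mul_one, one_mul, mul_assoc]

end CoeffRing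

end

/-! ### Semistable crystals are constant -/

section

namespace FModule

variable {R : Type u} [CommRing R] {φ : R →+* R}

theorem IsIsogenous.symm {M N : FModule R φ} (h : IsIsogenous M N) : IsIsogenous N M := by
  obtain ⟨f, g, a, hf, hg, ha, hgf, hfg⟩ := h
  exact ⟨g, f, a, hg, hf, ha, hfg, hgf⟩

theorem iso_ofMatrix_of_conj {n : ℕ} {A A' W V : Matrix (Fin n) (Fin n) R} (hWV : W * V = 1)
    (h : W * A = A' * W.map φ) : Iso (ofMatrix φ A) (ofMatrix φ A') := by
  refine ⟨(ofMatrixEquiv φ A).symm.trans ((Matrix.toLin'OfInv (mul_eq_one_comm.mp hWV) hWV).trans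
    (ofMatrixEquiv φ A')), fun m => ?_⟩
  obtain ⟨x, rfl⟩ := (ofMatrixEquiv φ A).surjective m
  rw [ofMatrix_F]
  simp only [LinearEquiv.trans_apply, LinearEquiv.symm_apply_apply]
  rw [ofMatrix_F]
  congr 1
  change W *ᵥ (A *ᵥ _) = A' *ᵥ fun i => φ ((W *ᵥ x) i)
  have : (fun i => φ ((W *ᵥ x) i)) = W.map φ *ᵥ fun i => φ (x i) := by
    ext i; simp [Matrix.mulVec, dotProduct]
  rw [this, Matrix.mulVec_mulVec, Matrix.mulVec_mulVec, h]

end FModule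

namespace CoeffRing

open AnCon FModule

variable {p : ℕ} [Fact p.Prime] {k : Type v} [Field k] [IsAlgClosed k] [CharP k p]
variable {O O' : CoeffRing.{u, v} p k}

theorem Hom.mapAnCon_coeff (f : Hom O O') (x : O.GammaAnCon) (n : ℤ) :
    (f.mapAnCon x).coeff n = f.fF (x.coeff n) := rfl

theorem Hom.mapAnCon_injective (f : Hom O O') : Function.Injective f.mapAnCon := by
  intro x y h
  ext n
  have := congrArg (fun z : O'.GammaAnCon => z.coeff n) h
  exact f.fF.injective this

theorem Hom.mapAnCon_const (f : Hom O O') (a : O.FracField) :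
    f.mapAnCon (const a) = const (f.fF a) := by
  ext n
  rw [Hom.mapAnCon_coeff]
  rcases eq_or_ne n 0 with rfl | h
  · simp
  · simp [Pi.single_eq_of_ne h]

/-- A module over `Γ_con` with a matrix over `𝒪⟦t⟧` becomes, after an extension of `𝒪`, a sum of
trivial crystals over `Γ_an,con`. -/
theorem exists_hom_diagonal_conj {n : ℕ} {A B : Matrix (Fin n) (Fin n) O.GammaAnCon} {l : ℕ}
    (hA : MatSuppGE 0 A) (hA1 : ∀ i j, A i j ∈ O.GammaCon) (hB : MatSuppGE 0 B)
    (hB1 : ∀ i j, B i j ∈ O.GammaCon) (hAB : A * B = Matrix.scalar _ ((p : O.GammaAnCon) ^ l)) :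
    ∃ (O' : CoeffRing.{u, v} p k) (f : Hom O O') (c : Fin n → O'.carrier)
      (W V : Matrix (Fin n) (Fin n) O'.GammaAnCon), (∀ i, c i ≠ 0) ∧ W * V = 1 ∧
        W * Matrix.diagonal (fun i => const (algebraMap O'.carrier O'.FracField (c i))) =
          A.map f.mapAnCon * W.map O'.frobAnCon := by
  have hp : (p : O.FracField) ^ l ≠ 0 := by
    rw [← norm_pos_iff, norm_pow, O.norm_p]
    have : (0 : ℝ) < p := by exact_mod_cast (Fact.out : p.Prime).pos
    positivity
  set q : O.GammaAnCon := const ((p : O.FracField) ^ l)⁻¹ with hq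
  have hAC : A * (q • B) = 1 := by
    rw [Matrix.mul_smul, hAB]
    ext1 i j
    rw [Matrix.smul_apply, Matrix.scalar_apply, Matrix.diagonal_apply, Matrix.one_apply]
    split_ifs
    · have : (p : O.GammaAnCon) ^ l = const ((p : O.FracField) ^ l) := by simp
      rw [smul_eq_mul, hq, this, ← map_mul, inv_mul_cancel₀ hp, map_one]
    · simp
  have hC : MatSuppGE 0 (q • B) := fun i j => by
    simpa using (suppGE_const ((p : O.FracField) ^ l)⁻¹).mul (hB i j)
  have hCb : MatBd 1 ((p : ℝ) ^ l) (q • B) := fun i j => by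
    have := (bd_const (r := 1) ((p : O.FracField) ^ l)⁻¹).mul one_pos
      (mem_gammaCon_iff_bd.mp (hB1 i j))
    rwa [norm_inv, norm_pow, O.norm_p, inv_pow, inv_inv, mul_one] at this
  obtain ⟨U, V, hUV, hU⟩ := exists_conj_constant_term hA
    (fun i j => mem_gammaCon_iff_bd.mp (hA1 i j)) hC hCb hAC
  choose a ha using fun i j => hA1 i j 0
  have ha' : (Matrix.of a).map (algebraMap O.carrier O.FracField) = A.map fun x => x.coeff 0 := by
    ext i j; simp [ha]
  have hunit : IsUnit ((Matrix.of a).map (algebraMap O.carrier O.FracField)) := by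
    rw [ha']
    refine IsUnit.of_mul_eq_one ((q • B).map fun x => x.coeff 0) ?_
    rw [← hA.coeff_zero_mul hC, hAC]
    ext i j
    rw [Matrix.map_apply, Matrix.one_apply, Matrix.one_apply]
    split_ifs <;> simp
  obtain ⟨O', f, X, c, hX, hc, hXc⟩ := exists_hom_diagonal _ hunit
  obtain ⟨Y, hY⟩ := hX.exists_right_inv
  let cst : O'.FracField →+* O'.GammaAnCon := const
  -- The change of basis is the composite of `U`, which makes the matrix constant, and `X`, which
  -- diagonalises the constant matrix.
  refine ⟨O', f, c, U.map f.mapAnCon * X.map cst, Y.map cst * V.map f.mapAnCon, hc, ?_, ?_⟩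
  · rw [mul_assoc, ← mul_assoc (X.map cst), ← Matrix.map_mul, hY,
      Matrix.map_one _ (map_zero _) (map_one _), one_mul, ← Matrix.map_mul, hUV,
      Matrix.map_one _ (map_zero _) (map_one _)]
  · have h1 : X.map cst * Matrix.diagonal (fun i => const (algebraMap O'.carrier O'.FracField (c i))) =
        (A.map fun x => const (x.coeff 0)).map f.mapAnCon * (X.map cst).map O'.frobAnCon := by
      have h2 := congrArg (fun Z : Matrix (Fin n) (Fin n) O'.FracField => Z.map cst) hXc
      simp only [Matrix.map_mul, Matrix.map_map] at h2
      have e1 : (Matrix.diagonal fun j => algebraMap O'.carrier O'.FracField (c j)).map cst =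
          Matrix.diagonal (fun i => const (algebraMap O'.carrier O'.FracField (c i))) :=
        Matrix.diagonal_map (map_zero _)
      rw [← e1, ← h2]
      congr 1
      · ext1 i j
        simp only [Matrix.map_apply, Function.comp, Matrix.of_apply]
        rw [f.mapAnCon_const, ← ha, fracMap_algebraMap]
      · ext1 i j
        simp only [Matrix.map_apply, Function.comp]
        exact (O'.frobAnCon_const _).symm
    have h2 := congrArg (fun Z : Matrix (Fin n) (Fin n) O.GammaAnCon => Z.map f.mapAnCon) hU
    simp only [Matrix.map_mul] at h2
    have h3 : (U.map O.frobAnCon).map f.mapAnCon = (U.map f.mapAnCon).map O'.frobAnCon := by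
      ext1 i j
      exact f.mapAnCon_frobAnCon _
    rw [h3] at h2
    rw [mul_assoc, h1, ← mul_assoc, ← h2, Matrix.map_mul, mul_assoc]

theorem exists_basis_fin {R : Type u} [CommRing R] (hR : IsLocalRing R) {φ : R →+* R}
    {M : FModule R φ} (hM : M.IsFCrystal p) :
    ∃ n, Nonempty (Module.Basis (Fin n) R M.carrier) := by
  have := hM.finite
  have := hM.projective
  have : Module.Free R M.carrier := Module.free_of_flat_of_isLocalRing
  have hn : Nontrivial R := hR.toNontrivial
  exact ⟨_, ⟨Module.finBasis R M.carrier⟩⟩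

end CoeffRing

open CoeffRing FModule AnCon

variable {p : ℕ} [Fact p.Prime] {k : Type v} [Field k] [IsAlgClosed k] [CharP k p]
variable {O : CoeffRing.{u, v} p k}

/-- The crystal over `Ω` is free and its matrix can be made constant and diagonal after an
extension. The given isogeny survives both base changes, since injectivity of the ring maps keeps
its scalar nonzero. -/
theorem IsSemistable.isConstant {M : FModule O.GammaCon O.frobCon} (h : IsSemistable M) :
    IsConstant (M.baseChange O.frobAnCon O.algebraMap_frobCon) := by
  obtain ⟨N, hN, hiso⟩ := h
  obtain ⟨n, ⟨b⟩⟩ := exists_basis_fin O.isLocalRing_omega hN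
  obtain ⟨B, l, hAB⟩ := hN.exists_matrix b
  have hNA := iso_ofMatrix N b
  set A : Matrix (Fin n) (Fin n) O.Omega := Matrix.of fun i j => b.repr (N.F (b j)) i
  let ι₁ := algebraMap O.Omega O.GammaCon
  let ι₂ := algebraMap O.GammaCon O.GammaAnCon
  have hAB' := congrArg (fun Z : Matrix (Fin n) (Fin n) O.Omega => (Z.map ι₁).map ι₂) hAB
  simp only [Matrix.map_mul] at hAB'
  obtain ⟨O', f, c, W, V, hc, hWV, hW⟩ := exists_hom_diagonal_conj (l := l)
    (fun i j => (A i j).2) (fun i j => (A i j).1.2) (fun i j => (B i j).2)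
    (fun i j => (B i j).1.2) (hAB'.trans (by
      ext1 i j
      simp only [Matrix.map_apply, Matrix.scalar_apply, Matrix.diagonal_apply]
      split_ifs <;> simp))
  refine ⟨O', f, n, c, hc, ?_⟩
  let _ : Algebra O.GammaAnCon O'.GammaAnCon := f.mapAnCon.toAlgebra
  have i1 := ((hNA.baseChange O.frobCon O.algebraMap_frobOmega).trans
    (ofMatrix_baseChange_iso O.frobCon O.algebraMap_frobOmega A)).baseChange O.frobAnCon
      O.algebraMap_frobCon
  have i2 := (i1.trans (ofMatrix_baseChange_iso O.frobAnCon O.algebraMap_frobCon _)).baseChange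
    O'.frobAnCon f.mapAnCon_frobAnCon
  have i3 := i2.trans (ofMatrix_baseChange_iso O'.frobAnCon f.mapAnCon_frobAnCon _)
  have i4 := i3.trans (iso_ofMatrix_of_conj hWV hW).symm
  have i5 := ((hiso.baseChange O.frobAnCon O.algebraMap_frobCon Subtype.val_injective).baseChange
    O'.frobAnCon f.mapAnCon_frobAnCon f.mapAnCon_injective).symm
  have h6 : FModule.directSum (fun i => trivialCrystal O' (c i)) =
      ofMatrix O'.frobAnCon (Matrix.diagonal fun i => const (algebraMap _ _ (c i))) :=
    directSum_rankOne _
  rw [h6]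
  exact i5.of_iso ⟨LinearEquiv.refl _ _, fun _ => rfl⟩ i4

end

/-! ### Bounded functionals on an extension of the coefficient field -/

section

namespace CoeffRing

open AnCon

variable {p : ℕ} [Fact p.Prime] {k : Type v} [Field k] [IsAlgClosed k] [CharP k p]
variable {O O' : CoeffRing.{u, v} p k}

instance : NontriviallyNormedField O.FracField where
  non_trivial := by
    have hp1 : (1 : ℝ) < p := by exact_mod_cast (Fact.out : p.Prime).one_lt
    refine ⟨(p : O.FracField)⁻¹, ?_⟩
    rwa [norm_inv, O.norm_p, inv_inv]

/-- A bounded functional on `𝒪'[1/p]`, linear over `𝒪[1/p]`. -/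
structure BddFunctional (f : Hom O O') where
  /-- the underlying additive map -/
  toAddHom : O'.FracField →+ O.FracField
  map_mul : ∀ a y, toAddHom (f.fF a * y) = a * toAddHom y
  bound : ∃ K, ∀ y, ‖toAddHom y‖ ≤ K * ‖y‖

/-- `𝒪'[1/p]` is spanned over `𝒪[1/p]` by finitely many elements. -/
theorem exists_span (f : Hom O O') : ∃ s : Finset O'.FracField, ∀ y, ∃ c : O'.FracField → O.FracField,
    y = ∑ b ∈ s, f.fF (c b) * b := by
  classical
  obtain ⟨s, hs⟩ := Module.Finite.fg_top (R := WittVector p k) (M := O'.carrier)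
  refine ⟨s.image (algebraMap O'.carrier O'.FracField), fun y => ?_⟩
  have hp1 : (1 : ℝ) < p := by exact_mod_cast (Fact.out : p.Prime).one_lt
  have hpF : (p : O.FracField) ≠ 0 := by rw [← norm_pos_iff, O.norm_p]; positivity
  have hpF' : (p : O'.FracField) ≠ 0 := by rw [← norm_pos_iff, O'.norm_p]; positivity
  obtain ⟨N, hN⟩ := pow_unbounded_of_one_lt ‖y‖ hp1
  obtain ⟨b, hb⟩ := O'.exists_of_norm_le_one (x := (p : O'.FracField) ^ N * y) (by
    rw [norm_mul, norm_pow, O'.norm_p, inv_pow, inv_mul_le_iff₀ (by positivity), mul_one]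
    exact hN.le)
  have hb' : b ∈ Submodule.span (WittVector p k) (s : Set O'.carrier) := by rw [hs]; trivial
  obtain ⟨w, -, hw⟩ := Submodule.mem_span_finset.mp hb'
  have hinj : Function.Injective (algebraMap O'.carrier O'.FracField) :=
    IsFractionRing.injective _ _
  let c : O'.FracField → O.FracField := fun z =>
    ((p : O.FracField) ^ N)⁻¹ * algebraMap O.carrier O.FracField
      (algebraMap _ _ (w (Function.invFun (algebraMap O'.carrier O'.FracField) z)))
  refine ⟨c, ?_⟩
  rw [Finset.sum_image fun _ _ _ _ h => hinj h]
  have h1 : ∀ x ∈ s, f.fF (c (algebraMap _ _ x)) * algebraMap _ _ x =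
      ((p : O'.FracField) ^ N)⁻¹ * algebraMap O'.carrier O'.FracField (w x • x) := fun x _ => by
    simp only [c]
    rw [Function.leftInverse_invFun hinj, _root_.map_mul, map_inv₀, map_pow, map_natCast,
      fracMap_algebraMap, f.map_algebraMap, Algebra.smul_def, _root_.map_mul, mul_assoc]
  rw [Finset.sum_congr rfl h1, ← Finset.mul_sum, ← map_sum, hw, hb,
    inv_mul_cancel_left₀ (pow_ne_zero N hpF')]

/-- The functionals are dual to a basis of `𝒪'[1/p]` over `𝒪[1/p]`. Over a complete field with
nontrivial norm, boundedness is automatic in finite dimension. -/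
theorem exists_functionals (f : Hom O O') : ∃ (d : ℕ) (β : Fin d → O'.FracField)
    (lam : Fin d → BddFunctional f), ∀ y, y = ∑ j, β j * f.fF ((lam j).toAddHom y) := by
  let _ : Algebra O.FracField O'.FracField := f.fF.toAlgebra
  have hsm : ∀ (a : O.FracField) (y : O'.FracField), a • y = f.fF a * y := fun _ _ => rfl
  let _ : NormedSpace O.FracField O'.FracField :=
    { norm_smul_le := fun a y => by rw [hsm, norm_mul, norm_fracMap] }
  have hfin : Module.Finite O.FracField O'.FracField := by
    obtain ⟨s, hs⟩ := exists_span f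
    refine ⟨⟨s, ?_⟩⟩
    rw [eq_top_iff]
    intro y _
    obtain ⟨c, hc⟩ := hs y
    rw [hc]
    exact Submodule.sum_mem _ fun b hb =>
      Submodule.smul_mem _ (c b) (Submodule.subset_span hb)
  let b := Module.finBasis O.FracField O'.FracField
  refine ⟨_, b, fun j => ⟨(b.coord j).toAddMonoidHom, fun a y => ?_,
    ‖LinearMap.toContinuousLinearMap (b.coord j)‖, fun y => ?_⟩, fun y => ?_⟩
  · exact (b.coord j).map_smul a y
  · exact (LinearMap.toContinuousLinearMap (b.coord j)).le_opNorm y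
  · conv_lhs => rw [← b.sum_repr y]
    exact Finset.sum_congr rfl fun j _ => by rw [hsm, mul_comm]; rfl

namespace BddFunctional

variable {f : Hom O O'} (lam : BddFunctional f)

theorem isAnCon {x : ℤ → O'.FracField} (hx : IsAnCon x) : IsAnCon fun n => lam.toAddHom (x n) := by
  obtain ⟨K, hK⟩ := lam.bound
  obtain ⟨r₀, h0, h1, h⟩ := hx.exists_summable
  refine isAnCon_of_summable h0 h1 fun r hr hr1 => ?_
  have hrpos : 0 < r := h0.trans hr
  refine Summable.of_nonneg_of_le (fun n => by positivity) (fun n => ?_) ((h r hr hr1).mul_left K)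
  rw [← mul_assoc]
  gcongr
  exact hK _

/-- The coefficientwise action of a functional on series. -/
def map : O'.GammaAnCon →+ O.GammaAnCon where
  toFun x := AnCon.mk (fun n => lam.toAddHom (x.coeff n)) (lam.isAnCon x.isAnCon)
  map_zero' := by ext n; simp
  map_add' x y := by ext n; simp

theorem map_coeff (x : O'.GammaAnCon) (n : ℤ) : (lam.map x).coeff n = lam.toAddHom (x.coeff n) :=
  rfl

/-- Coefficients of a product are infinite sums, and continuity lets the functional pass through
them. -/
theorem map_mapAnCon_mul (x : O.GammaAnCon) (y : O'.GammaAnCon) :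
    lam.map (f.mapAnCon x * y) = x * lam.map y := by
  ext n
  obtain ⟨K, hK⟩ := lam.bound
  have hc : Continuous lam.toAddHom := AddMonoidHomClass.continuous_of_bound _ K hK
  rw [map_coeff, coeff_mul_apply, coeff_mul_apply,
    Summable.map_tsum ((f.mapAnCon x).isAnCon.summable_norm_mul y.isAnCon n).of_norm _ hc]
  exact tsum_congr fun i => lam.map_mul _ _

theorem map_const (a : O'.FracField) : lam.map (const a) = const (lam.toAddHom a) := by
  ext n
  rw [map_coeff]
  rcases eq_or_ne n 0 with rfl | h
  · simp
  · simp [Pi.single_eq_of_ne h]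

/-- The conjugate `σ⁻¹ λ σ`. -/
theorem exists_conj : ∃ lam' : BddFunctional f, ∀ y,
    lam.toAddHom (O'.σF y) = O.σF (lam'.toAddHom y) := by
  let e : O.FracField ≃+* O.FracField :=
    RingEquiv.ofBijective O.σF ⟨O.σF.injective, O.σF_surjective⟩
  have he : ∀ x, O.σF (e.symm x) = x := e.apply_symm_apply
  refine ⟨⟨(e.symm : O.FracField →+ O.FracField).comp (lam.toAddHom.comp (O'.σF : _ →+ _)),
    fun a y => ?_, ?_⟩, fun y => ?_⟩
  · apply O.σF.injective
    simp only [AddMonoidHom.comp_apply, AddMonoidHom.coe_coe]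
    rw [he, _root_.map_mul O'.σF, _root_.map_mul O.σF, he, ← f.fF_σF, lam.map_mul]
  · obtain ⟨K, hK⟩ := lam.bound
    refine ⟨K, fun y => ?_⟩
    simp only [AddMonoidHom.comp_apply, AddMonoidHom.coe_coe]
    rw [← norm_σF, he, ← O'.norm_σF y]
    exact hK _
  · simp only [AddMonoidHom.comp_apply, AddMonoidHom.coe_coe]
    rw [he]

theorem map_frobAnCon {lam' : BddFunctional f}
    (h : ∀ y, lam.toAddHom (O'.σF y) = O.σF (lam'.toAddHom y)) (x : O'.GammaAnCon) :
    lam.map (O'.frobAnCon x) = O.frobAnCon (lam'.map x) := by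
  ext n
  rw [map_coeff, frobAnCon_coeff, frobAnCon_coeff]
  split_ifs
  · exact h _
  · exact map_zero _

variable (f) in
theorem exists_map_one : ∃ lam : BddFunctional f, lam.toAddHom 1 = 1 := by
  obtain ⟨d, β, lam, h⟩ := exists_functionals f
  obtain ⟨j, hj⟩ : ∃ j, (lam j).toAddHom 1 ≠ 0 := by
    by_contra hcon
    push Not at hcon
    refine one_ne_zero (α := O'.FracField) ?_
    rw [h 1]
    exact Finset.sum_eq_zero fun j _ => by rw [hcon j, map_zero, mul_zero]
  refine ⟨⟨(AddMonoidHom.mulLeft ((lam j).toAddHom 1)⁻¹).comp (lam j).toAddHom, fun a y => ?_, ?_⟩, ?_⟩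
  · simp only [AddMonoidHom.comp_apply, AddMonoidHom.coe_mulLeft, (lam j).map_mul]
    ring
  · obtain ⟨K, hK⟩ := (lam j).bound
    refine ⟨‖((lam j).toAddHom 1)⁻¹‖ * K, fun y => ?_⟩
    simp only [AddMonoidHom.comp_apply, AddMonoidHom.coe_mulLeft, norm_mul]
    rw [mul_assoc]
    gcongr
    exact hK y
  · simp [inv_mul_cancel₀ hj]

end BddFunctional

/-- A functional with value `1` at `1` induces a linear retraction of `f.mapAnCon`, which sends an
inverse of the image of `x` to an inverse of `x`. -/
theorem isUnit_of_isUnit_mapAnCon (f : Hom O O') {x : O.GammaAnCon} (hx : IsUnit (f.mapAnCon x)) :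
    IsUnit x := by
  obtain ⟨lam, h1⟩ := BddFunctional.exists_map_one f
  obtain ⟨z, hz⟩ := hx.exists_right_inv
  refine IsUnit.of_mul_eq_one (lam.map z) ?_
  rw [← lam.map_mapAnCon_mul, hz, ← map_one const, lam.map_const, h1, map_one]

end CoeffRing

end

/-! ### Descent of a constant trivialisation along an extension of `𝒪` -/

section

namespace CoeffRing

open AnCon FModule

variable {p : ℕ} [Fact p.Prime] {k : Type v} [Field k] [IsAlgClosed k] [CharP k p]
variable {O O' : CoeffRing.{u, v} p k} {n : ℕ}

theorem map_mulVec {R S : Type*} [CommRing R] [CommRing S] (f : R →+* S) {m n : Type*} [Fintype n]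
    (A : Matrix m n R) (x : n → R) : (fun i => f ((A *ᵥ x) i)) = A.map f *ᵥ fun i => f (x i) := by
  ext i; simp [Matrix.mulVec, dotProduct]

theorem BddFunctional.map_mulVec {f : Hom O O'} (lam : BddFunctional f)
    (A : Matrix (Fin n) (Fin n) O.GammaAnCon) (x : Fin n → O'.GammaAnCon) :
    (fun i => lam.map ((A.map f.mapAnCon *ᵥ x) i)) = A *ᵥ fun i => lam.map (x i) := by
  ext1 i
  simp only [Matrix.mulVec, dotProduct, Matrix.map_apply, map_sum, lam.map_mapAnCon_mul]

/-- Applying a coefficientwise functional to a horizontal vector gives a vector that is constant in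
the horizontal basis. -/
theorem functional_eq_const {f : Hom O O'} {A : Matrix (Fin n) (Fin n) O.GammaAnCon}
    {U V : Matrix (Fin n) (Fin n) O'.GammaAnCon} {D : Matrix (Fin n) (Fin n) O'.FracField}
    (hUV : U * V = 1) (hD : IsUnit D)
    (hU : U * A.map f.mapAnCon = D.map const * U.map O'.frobAnCon)
    (lam : BddFunctional f) (y : Fin n → O'.FracField) :
    ∃ z : Fin n → O'.FracField, (U *ᵥ fun i => f.mapAnCon
      (lam.map ((V *ᵥ fun j => const (y j)) i))) = fun i => const (z i) := by
  have hVU : V * U = 1 := mul_eq_one_comm.mp hUV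
  set Φ : BddFunctional f → (Fin n → O'.FracField) → Fin n → O'.GammaAnCon := fun lam y =>
    U *ᵥ fun i => f.mapAnCon (lam.map ((V *ᵥ fun j => const (y j)) i)) with hΦ
  have hV : A.map f.mapAnCon * V.map O'.frobAnCon = V * D.map const := by
    have h1 : U.map O'.frobAnCon * V.map O'.frobAnCon = 1 := by
      rw [← Matrix.map_mul, hUV, Matrix.map_one _ (map_zero _) (map_one _)]
    calc A.map f.mapAnCon * V.map O'.frobAnCon
        = V * (U * A.map f.mapAnCon) * V.map O'.frobAnCon := by rw [← mul_assoc, hVU, one_mul]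
      _ = _ := by rw [hU, mul_assoc, mul_assoc, h1, mul_one]
  -- A functional `λ` need not commute with `σ`, but `λ σ = σ λ'` for the conjugate functional `λ'`;
  -- so Frobenius can be pulled out of `Φ` at the price of replacing `λ` by `λ'`.
  have hstep : ∀ (lam lam' : BddFunctional f) (_ : ∀ y, lam.toAddHom (O'.σF y) =
      O.σF (lam'.toAddHom y)) (y : Fin n → O'.FracField),
      Φ lam (D *ᵥ fun i => O'.σF (y i)) = D.map const *ᵥ fun i => O'.frobAnCon (Φ lam' y i) := by
    intro lam lam' hlam y
    have h1 : (V *ᵥ fun j => const ((D *ᵥ fun i => O'.σF (y i)) j)) =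
        A.map f.mapAnCon *ᵥ fun i => O'.frobAnCon ((V *ᵥ fun j => const (y j)) i) := by
      rw [CoeffRing.map_mulVec, CoeffRing.map_mulVec, Matrix.mulVec_mulVec, Matrix.mulVec_mulVec, hV]
      simp only [frobAnCon_const]
    have h2 : (fun i => f.mapAnCon (lam.map ((V *ᵥ fun j => const ((D *ᵥ fun i => O'.σF (y i)) j)) i)))
        = A.map f.mapAnCon *ᵥ fun i => O'.frobAnCon
          (f.mapAnCon (lam'.map ((V *ᵥ fun j => const (y j)) i))) := by
      rw [h1]
      have h3 := lam.map_mulVec A fun i => O'.frobAnCon ((V *ᵥ fun j => const (y j)) i)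
      have h4 : ∀ i, lam.map ((A.map f.mapAnCon *ᵥ fun i => O'.frobAnCon
          ((V *ᵥ fun j => const (y j)) i)) i) = (A *ᵥ fun i => lam.map (O'.frobAnCon
            ((V *ᵥ fun j => const (y j)) i))) i := fun i => congrFun h3 i
      simp only [h4, lam.map_frobAnCon hlam]
      rw [CoeffRing.map_mulVec]
      simp only [f.mapAnCon_frobAnCon]
    simp only [hΦ]
    rw [h2, Matrix.mulVec_mulVec, hU, CoeffRing.map_mulVec, Matrix.mulVec_mulVec]
  obtain ⟨D', hD'⟩ := hD.exists_right_inv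
  choose τ hτ using O'.σF_surjective
  -- Each step changes both the functional and the vector, so the induction ranges over all of them
  -- at once. Every `y` has the form `D σ(y')` because `D` is invertible and `σ` is surjective.
  have hdvd : ∀ (m : ℕ) (lam : BddFunctional f) (y : Fin n → O'.FracField) (i : Fin n) (s : ℤ),
      (Φ lam y i).coeff s ≠ 0 → (p : ℤ) ^ m ∣ s := by
    intro m
    induction m with
    | zero => simp
    | succ m ih =>
      intro lam y i s hs
      obtain ⟨lam', hlam⟩ := lam.exists_conj
      have hy : y = D *ᵥ fun i => O'.σF (τ ((D' *ᵥ y) i)) := by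
        simp only [hτ]
        rw [Matrix.mulVec_mulVec, hD', Matrix.one_mulVec]
      rw [hy, hstep lam lam' hlam] at hs
      simp only [Matrix.mulVec, dotProduct, coeff_sum, Matrix.map_apply, coeff_const_mul] at hs
      obtain ⟨j, -, hj⟩ := Finset.exists_ne_zero_of_sum_ne_zero hs
      have hj' := right_ne_zero_of_mul hj
      rw [frobAnCon_coeff] at hj'
      split_ifs at hj' with hps
      · obtain ⟨s', rfl⟩ := hps
        rw [Int.mul_ediv_cancel_left _ p_pos.ne'] at hj'
        rw [pow_succ']
        exact mul_dvd_mul_left _ (ih lam' _ j s' fun h => hj' (by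
          rw [h, map_zero]))
      · exact absurd rfl hj'
  exact ⟨fun i => (Φ lam y i).coeff 0, funext fun i =>
    eq_const_of_dvd fun m s hs => hdvd m lam y i s hs⟩

/-- Descent of constancy along an extension of the coefficient ring. -/
theorem exists_const_conj_descend {f : Hom O O'} {A C : Matrix (Fin n) (Fin n) O.GammaAnCon}
    (hAC : A * C = 1)
    {U V : Matrix (Fin n) (Fin n) O'.GammaAnCon} {D : Matrix (Fin n) (Fin n) O'.FracField}
    (hUV : U * V = 1) (hD : IsUnit D)
    (hU : U * A.map f.mapAnCon = D.map const * U.map O'.frobAnCon) :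
    ∃ (X Y : Matrix (Fin n) (Fin n) O.GammaAnCon) (Z : Matrix (Fin n) (Fin n) O.FracField),
      X * Y = 1 ∧ IsUnit Z ∧ Y * A = Z.map const * Y.map O.frobAnCon := by
  have hVU : V * U = 1 := mul_eq_one_comm.mp hUV
  let cst' : O'.FracField →+* O'.GammaAnCon := const
  -- These are the constant coordinate vectors, in the trivialising basis over `𝒪'`, of vectors
  -- defined over `𝒪`.
  let S : Set (Fin n → O'.FracField) := {z | ∃ x : Fin n → O.GammaAnCon,
    (U *ᵥ fun i => f.mapAnCon (x i)) = fun i => cst' (z i)}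
  -- Expanding coefficients in the basis `β` writes the vector with coordinates `y` as a combination
  -- of its images under the functionals, which have constant coordinates by `functional_eq_const`.
  have hspan : Submodule.span O'.FracField S = ⊤ := by
    rw [eq_top_iff]
    intro y _
    obtain ⟨d, β, lam, hlam⟩ := exists_functionals f
    choose z hz using fun j => functional_eq_const hUV hD hU (lam j) y
    have hy : y = ∑ j, β j • z j := by
      have h1 : (V *ᵥ fun j => cst' (y j)) = ∑ j, cst' (β j) • fun i => f.mapAnCon
          ((lam j).map ((V *ᵥ fun l => cst' (y l)) i)) := by
        ext i s
        rw [Finset.sum_apply, coeff_sum]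
        simp only [Pi.smul_apply, smul_eq_mul]
        rw [hlam (((V *ᵥ fun j => cst' (y j)) i).coeff s)]
        refine Finset.sum_congr rfl fun j _ => ?_
        rw [coeff_const_mul]
        rfl
      have h2 := congrArg (fun w => U *ᵥ w) h1
      simp only [Matrix.mulVec_mulVec, hUV, Matrix.one_mulVec, Matrix.mulVec_sum,
        Matrix.mulVec_smul] at h2
      ext i
      have h3 := congrArg (fun x : O'.GammaAnCon => x.coeff 0) (congrFun h2 i)
      rw [Finset.sum_apply] at h3 ⊢
      simp only [coeff_sum, Pi.smul_apply, smul_eq_mul] at h3 ⊢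
      have h4 : ((cst' (y i)).coeff 0) = y i := by simp [cst']
      rw [h4] at h3
      rw [h3]
      refine Finset.sum_congr rfl fun j _ => ?_
      rw [coeff_const_mul, show (U *ᵥ fun i => f.mapAnCon ((lam j).map
        ((V *ᵥ fun l => cst' (y l)) i))) i = const (z j i) from congrFun (hz j) i]
      simp
    rw [hy]
    refine Submodule.sum_mem _ fun j _ => Submodule.smul_mem _ _ (Submodule.subset_span ?_)
    exact ⟨_, hz j⟩
  obtain ⟨b, hb, -, hLI⟩ := Submodule.exists_fun_fin_finrank_span_eq O'.FracField S
  have hn : Module.finrank O'.FracField (Submodule.span O'.FracField S) = n := by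
    rw [hspan, finrank_top, Module.finrank_fin_fun]
  obtain ⟨b, hb, hLI⟩ : ∃ b : Fin n → Fin n → O'.FracField, (∀ i, b i ∈ S) ∧
      LinearIndependent O'.FracField b := by
    refine ⟨fun i => b (Fin.cast hn.symm i), fun i => hb _, hLI.comp _ (Fin.cast_injective _)⟩
  choose x hx using hb
  let X : Matrix (Fin n) (Fin n) O.GammaAnCon := Matrix.of fun i j => x j i
  let K : Matrix (Fin n) (Fin n) O'.FracField := Matrix.of fun i j => b j i
  have hK : IsUnit K := by
    rw [← Matrix.linearIndependent_cols_iff_isUnit]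
    exact hLI
  have hUX : U * X.map f.mapAnCon = K.map cst' := by
    ext1 i j
    exact congrFun (hx j) i
  have hXu' : IsUnit (X.map f.mapAnCon) := by
    have h1 : X.map f.mapAnCon = V * K.map cst' := by rw [← hUX, ← mul_assoc, hVU, one_mul]
    rw [h1]
    exact (IsUnit.of_mul_eq_one _ hVU).mul (hK.map cst'.mapMatrix)
  -- Over `𝒪'` the matrix is invertible because `U X = K` is; the invertibility of its determinant
  -- descends.
  have hXu : IsUnit X := by
    rw [Matrix.isUnit_iff_isUnit_det] at hXu' ⊢
    refine isUnit_of_isUnit_mapAnCon f ?_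
    rwa [RingHom.map_det]
  obtain ⟨Y, hXY⟩ := hXu.exists_right_inv
  have hYX : Y * X = 1 := mul_eq_one_comm.mp hXY
  obtain ⟨K', hK'⟩ := hK.exists_left_inv
  have hKσ : (X.map O.frobAnCon).map f.mapAnCon = (X.map f.mapAnCon).map O'.frobAnCon := by
    ext1 i j; exact f.mapAnCon_frobAnCon _
  have hstep : U * (A * X.map O.frobAnCon).map f.mapAnCon = (D * K.map O'.σF).map cst' := by
    rw [Matrix.map_mul, ← mul_assoc, hU, hKσ, mul_assoc, ← Matrix.map_mul, hUX, Matrix.map_mul]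
    congr 1
    ext1 i j
    exact O'.frobAnCon_const _
  have hZ' : (Y * (A * X.map O.frobAnCon)).map f.mapAnCon = (K' * (D * K.map O'.σF)).map cst' := by
    have h1 : K'.map cst' * U = Y.map f.mapAnCon := by
      have h2 : K'.map cst' * U * X.map f.mapAnCon = 1 := by
        rw [mul_assoc, hUX, ← Matrix.map_mul, hK', Matrix.map_one _ (map_zero _) (map_one _)]
      have h3 : X.map f.mapAnCon * Y.map f.mapAnCon = 1 := by
        rw [← Matrix.map_mul, hXY, Matrix.map_one _ (map_zero _) (map_one _)]
      calc _ = K'.map cst' * U * (X.map f.mapAnCon * Y.map f.mapAnCon) := by rw [h3, mul_one]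
        _ = _ := by rw [← mul_assoc, h2, one_mul]
    rw [Matrix.map_mul (L := K'), ← hstep, ← mul_assoc (K'.map cst'), h1, Matrix.map_mul]
  set Q := Y * (A * X.map O.frobAnCon) with hQ
  let Z : Matrix (Fin n) (Fin n) O.FracField := Q.map fun x => x.coeff 0
  -- `Q` becomes constant over `𝒪'`, so its coefficients at nonzero exponents vanish already over
  -- `𝒪`.
  have hQZ : Q = Z.map const := by
    ext i j s
    have h1 := congrArg (fun x : O'.GammaAnCon => x.coeff s) (congrFun (congrFun hZ' i) j)
    simp only [Matrix.map_apply, Hom.mapAnCon_coeff] at h1 ⊢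
    rcases eq_or_ne s 0 with rfl | hs
    · simp [Z]
    · rw [coeff_const, Pi.single_eq_of_ne hs]
      apply f.fF.injective
      rw [h1, map_zero]
      simp [cst', Pi.single_eq_of_ne hs]
  refine ⟨X, Y, Z, hXY, ?_, ?_⟩
  · have hQu : IsUnit Q := (IsUnit.of_mul_eq_one _ hYX).mul
      ((IsUnit.of_mul_eq_one _ hAC).mul (hXu.map (O.frobAnCon).mapMatrix))
    rw [hQZ, Matrix.isUnit_iff_isUnit_det] at hQu
    rw [Matrix.isUnit_iff_isUnit_det, isUnit_iff_ne_zero]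
    intro h0
    have h1 : (Z.map (const : O.FracField →+* O.GammaAnCon)).det = const Z.det :=
      ((const : O.FracField →+* O.GammaAnCon).map_det Z).symm
    rw [h1, h0, map_zero] at hQu
    exact not_isUnit_zero hQu
  · rw [← hQZ, hQ, mul_assoc, mul_assoc, ← Matrix.map_mul, hXY,
      Matrix.map_one _ (map_zero _) (map_one _), mul_one]

end CoeffRing

end

/-! ### From an isogeny with a constant crystal to an isomorphism over `𝒪` -/

section

open CoeffRing FModule AnCon

variable {p : ℕ} [Fact p.Prime] {k : Type v} [Field k] [IsAlgClosed k] [CharP k p]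
variable {O : CoeffRing.{u, v} p k} {n : ℕ}

/-- The scalar `a` of the isogeny is compatible with an invertible Frobenius matrix, so it is fixed
by Frobenius and hence constant. A nonzero constant is a unit of `Γ_an,con`, so the isogeny is an
isomorphism, and this can be descended. -/
theorem IsConstant.exists_const_conj {M : FModule O.GammaAnCon O.frobAnCon}
    {A C : Matrix (Fin n) (Fin n) O.GammaAnCon} (h : IsConstant M)
    (hMA : Iso M (ofMatrix O.frobAnCon A)) (hAC : A * C = 1) :
    ∃ (X Y : Matrix (Fin n) (Fin n) O.GammaAnCon) (Z : Matrix (Fin n) (Fin n) O.FracField),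
      X * Y = 1 ∧ IsUnit Z ∧ Y * A = Z.map const * Y.map O.frobAnCon := by
  -- In rank zero the scalar `a` cannot be read off from a matrix entry.
  rcases Nat.eq_zero_or_pos n with rfl | hn
  · exact ⟨1, 1, 1, by simp, isUnit_one, Subsingleton.elim _ _⟩
  obtain ⟨O', f, m, c, hc, hiso⟩ := h
  let _ : Algebra O.GammaAnCon O'.GammaAnCon := f.mapAnCon.toAlgebra
  have i1 := (hMA.baseChange O'.frobAnCon f.mapAnCon_frobAnCon).trans
    (ofMatrix_baseChange_iso O'.frobAnCon f.mapAnCon_frobAnCon A)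
  have h6 : FModule.directSum (fun i => trivialCrystal O' (c i)) =
      ofMatrix O'.frobAnCon (Matrix.diagonal fun i => const (algebraMap _ _ (c i))) :=
    directSum_rankOne _
  rw [h6] at hiso
  have hiso' := hiso.of_iso i1 ⟨LinearEquiv.refl _ _, fun _ => rfl⟩
  rw [isIsogenous_ofMatrix_iff] at hiso'
  obtain ⟨G, H, a, hG, hH, ha, hHG, hGH⟩ := hiso'
  have hAf : A.map (algebraMap O.GammaAnCon O'.GammaAnCon) = A.map f.mapAnCon := rfl
  rw [hAf] at hG hH
  have hAC' : A.map f.mapAnCon * C.map f.mapAnCon = 1 := by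
    rw [← Matrix.map_mul, hAC, Matrix.map_one _ (map_zero _) (map_one _)]
  have hσa : O'.frobAnCon a = a := by
    have h1 : Matrix.scalar (Fin n) a * A.map f.mapAnCon =
        A.map f.mapAnCon * Matrix.scalar (Fin n) (O'.frobAnCon a) := by
      have e : (Matrix.scalar (Fin n) a).map O'.frobAnCon = Matrix.scalar (Fin n) (O'.frobAnCon a) :=
        Matrix.diagonal_map (map_zero _)
      rw [← e, ← hHG, Matrix.map_mul, ← Matrix.mul_assoc, ← hH, Matrix.mul_assoc, hG,
        ← Matrix.mul_assoc]
    have h2 : Matrix.scalar (Fin n) (O'.frobAnCon a) = Matrix.scalar (Fin n) a := by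
      calc _ = C.map f.mapAnCon * A.map f.mapAnCon * Matrix.scalar (Fin n) (O'.frobAnCon a) := by
            rw [mul_eq_one_comm.mp hAC', one_mul]
        _ = Matrix.scalar (Fin n) a * (C.map f.mapAnCon * A.map f.mapAnCon) := by
            rw [mul_assoc, ← h1, ← mul_assoc, ← mul_assoc,
              (Matrix.scalar_commute a (Commute.all a) (C.map f.mapAnCon)).eq]
        _ = _ := by rw [mul_eq_one_comm.mp hAC', mul_one]
    have h3 := congrFun (congrFun h2 ⟨0, hn⟩) ⟨0, hn⟩
    simpa using h3
  have hconst := eq_const_of_frob_eq hσa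
  set a0 := a.coeff 0
  have ha0 : a0 ≠ 0 := by
    intro h0
    rw [h0, map_zero] at hconst
    exact ha hconst
  set b : O'.GammaAnCon := const a0⁻¹ with hb
  have hba : b * a = 1 := by rw [hconst, hb, ← map_mul, inv_mul_cancel₀ ha0, map_one]
  have hGH' : G * (b • H) = 1 := by
    rw [Matrix.mul_smul, hGH]
    ext1 i j
    rw [Matrix.smul_apply, Matrix.scalar_apply, Matrix.diagonal_apply, Matrix.one_apply]
    split_ifs
    · exact hba
    · simp
  have hHG' : (b • H) * G = 1 := by
    rw [Matrix.smul_mul, hHG]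
    ext1 i j
    rw [Matrix.smul_apply, Matrix.scalar_apply, Matrix.diagonal_apply, Matrix.one_apply]
    split_ifs
    · exact hba
    · simp
  have hmn : m = n := by
    simpa using Matrix.square_of_invertible G (b • H) hGH' hHG'
  subst hmn
  refine exists_const_conj_descend (f := f) hAC hGH'
    (D := Matrix.diagonal fun i => algebraMap O'.carrier O'.FracField (c i)) ?_ ?_
  · rw [Matrix.isUnit_iff_isUnit_det, Matrix.det_diagonal, isUnit_iff_ne_zero]
    exact Finset.prod_ne_zero_iff.mpr fun i _ =>
      (map_ne_zero_iff _ (IsFractionRing.injective O'.carrier O'.FracField)).mpr (hc i)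
  · rw [hG, Matrix.diagonal_map (map_zero _)]

end

/-! ### Splitting off negative exponents near the identity -/

section

namespace AnCon

variable {E : Type u} [NormedField E] [CompleteSpace E]

/-- The filter form lets finitely many series share one radius. -/
theorem eventually_summable (x : AnCon E) :
    ∀ᶠ r in nhdsWithin (1 : ℝ) (Set.Iio 1), Summable fun i : ℤ => ‖x.coeff i‖ * r ^ i := by
  obtain ⟨r₀, -, h1, h⟩ := x.isAnCon.exists_summable
  filter_upwards [Ioo_mem_nhdsLT h1] with r hr
  exact h r hr.1 hr.2

/-- The part of a series with negative exponents. -/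
def negPart (x : AnCon E) : AnCon E := trunc (Set.Iio 0) x

theorem coeff_negPart (x : AnCon E) (i : ℤ) :
    (negPart x).coeff i = if i < 0 then x.coeff i else 0 := rfl

theorem negPart_sub (x y : AnCon E) : negPart (x - y) = negPart x - negPart y := by
  ext i
  rw [coeff_sub, Pi.sub_apply, coeff_negPart, coeff_negPart, coeff_negPart]
  split_ifs
  · rw [coeff_sub, Pi.sub_apply]
  · rw [sub_zero]

variable {ι μ : Type*}

theorem exists_matBd [Finite ι] [Finite μ] {r : ℝ} {X : Matrix ι μ (AnCon E)}
    (h : ∀ i j, ∃ B, Bd r B (X i j)) : ∃ B, 1 ≤ B ∧ MatBd r B X := by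
  choose B hB using h
  obtain ⟨C, hC⟩ := (Set.finite_range fun q : ι × μ => B q.1 q.2).bddAbove
  exact ⟨max 1 C, le_max_left _ _, fun i j =>
    (hB i j).mono ((hC ⟨(i, j), rfl⟩).trans (le_max_right _ _))⟩

theorem exists_bd_of_summable {r : ℝ} (hr : 0 < r) {x : AnCon E}
    (h : Summable fun i : ℤ => ‖x.coeff i‖ * r ^ i) : ∃ B, Bd r B x :=
  ⟨_, fun i => h.le_tsum i fun j _ => by positivity⟩

end AnCon

namespace CoeffRing

open AnCon

variable {p : ℕ} [Fact p.Prime] {k : Type v} [Field k] [IsAlgClosed k] [CharP k p]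
variable {O : CoeffRing.{u, v} p k} {ι : Type*} [Fintype ι] [DecidableEq ι]

/-- Factoring off a matrix with negative exponents from a matrix close to the identity at some
radius. -/
theorem exists_negative_factor {X : Matrix ι ι O.GammaAnCon} {r ρ : ℝ} (hr : 0 < r) (hr1 : r < 1)
    (hρ : 0 < ρ) (hρ1 : ρ < 1) (hX : MatBd r ρ X) :
    ∃ Y : Matrix ι ι O.GammaAnCon, (∀ i j, Y i j ∈ O.GammaCon) ∧ MatBd r ρ Y ∧
      MatSuppGE 0 ((1 + X) * (1 + Y)) := by
  -- `Y` is sought as a fixed point of `Y ↦ -(X + X Y)⁻`, where the exponent denotes the negative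
  -- part, so that `(1 + X)(1 + Y) = 1 + X + Y + X Y` has no negative part. The map contracts Gauss
  -- norms at `r` by the factor `ρ`.
  obtain ⟨Y, hY0, hYs⟩ : ∃ Y : ℕ → Matrix ι ι O.GammaAnCon, Y 0 = 0 ∧
      ∀ m, Y (m + 1) = -(X + X * Y m).map negPart :=
    ⟨fun m => Nat.rec 0 (fun _ V => -(X + X * V).map negPart) m, rfl, fun _ => rfl⟩
  have hneg : ∀ {B : ℝ} {T : Matrix ι ι O.GammaAnCon}, MatBd r B T → MatBd r B (T.map negPart) :=
    fun hT i j => (hT i j).trunc hr _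
  have hsub : ∀ V V' : Matrix ι ι O.GammaAnCon, (X + X * V).map negPart - (X + X * V').map negPart =
      (X * (V - V')).map negPart := fun V V' => by
    ext1 i j
    rw [Matrix.sub_apply, Matrix.map_apply, Matrix.map_apply, Matrix.map_apply, ← negPart_sub,
      mul_sub, Matrix.add_apply, Matrix.add_apply, Matrix.sub_apply, add_sub_add_left_eq_sub]
  have hD : ∀ m, MatBd r (ρ * ρ ^ m) (Y (m + 1) - Y m) := by
    intro m
    induction m with
    | zero =>
      rw [hYs, hY0, mul_zero, add_zero, sub_zero, pow_zero, mul_one]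
      exact (hneg hX).neg
    | succ m ih =>
      have e : Y (m + 1 + 1) - Y (m + 1) = -(X * (Y (m + 1) - Y m)).map negPart := by
        rw [hYs (m + 1), ← hsub]
        nth_rw 2 [hYs m]
        abel
      rw [e, pow_succ']
      exact (hneg (hX.mul hr (by positivity) ih)).neg
  have hYb : ∀ m, MatBd r ρ (Y m) := by
    intro m
    induction m with
    | zero => rw [hY0]; exact fun i j => Bd.zero hρ.le
    | succ m ih =>
      rw [hYs]
      refine (hneg (hX.add hr ((hX.mul hr (by positivity) ih).mono ?_))).neg
      nlinarith
  have hYn : ∀ m i j, ∀ n : ℤ, 0 ≤ n → (Y m i j).coeff n = 0 := by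
    intro m i j n hn
    rcases m with _ | m
    · rw [hY0]; rfl
    · rw [hYs, Matrix.neg_apply, coeff_neg, Pi.neg_apply, Matrix.map_apply, coeff_negPart,
        if_neg (by omega), neg_zero]
  choose z hz using fun i j => exists_coeff_limit (y := fun m => Y m i j) hr hρ1 fun m => hD m i j
  set C := ρ / (1 - ρ) with hC
  have hC0 : 0 ≤ C := div_nonneg hρ.le (by linarith)
  have hzb : ∀ i j n, ‖z i j n‖ * r ^ n ≤ ρ := by
    intro i j n
    have ht : Filter.Tendsto (fun m : ℕ => C * ρ ^ m) Filter.atTop (nhds (C * 0)) :=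
      (tendsto_pow_atTop_nhds_zero_of_lt_one hρ.le hρ1).const_mul C
    rw [mul_zero] at ht
    obtain ⟨m, hm⟩ := (ht.eventually_lt_const hρ).exists
    have h1 := IsUltrametricDist.norm_add_le_max (z i j n - (Y m i j).coeff n) ((Y m i j).coeff n)
    rw [sub_add_cancel] at h1
    have hn : 0 < r ^ n := zpow_pos hr n
    refine (mul_le_mul_of_nonneg_right h1 hn.le).trans ?_
    rw [max_mul_of_nonneg _ _ hn.le]
    exact max_le ((hz i j m n).trans hm.le) (hYb m i j n)
  have hwb : ∀ i j, ∀ n : ℤ, ‖if n < 0 then z i j n else 0‖ * r ^ n ≤ ρ := by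
    intro i j n
    split_ifs
    · exact hzb i j n
    · simpa using hρ.le
  -- At negative exponents `rⁿ ≥ 1`, so the bound at radius `r` already makes the coefficients
  -- integral.
  have hw1 : ∀ i j, ∀ n : ℤ, ‖if n < 0 then z i j n else 0‖ ≤ 1 := by
    intro i j n
    split_ifs with hn
    · have h1 : 1 ≤ r ^ n := one_le_zpow_of_nonpos₀ hr hr1.le hn.le
      calc _ ≤ ‖z i j n‖ * r ^ n := le_mul_of_one_le_right (norm_nonneg _) h1
        _ ≤ 1 := (hzb i j n).trans hρ1.le
    · simp
  let W : Matrix ι ι O.GammaAnCon := Matrix.of fun i j =>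
    AnCon.mk (fun n => if n < 0 then z i j n else 0) (isAnCon_of_bounded hr hr1 (hw1 i j) (hwb i j))
  have hWc : ∀ i j n, (W i j).coeff n = if n < 0 then z i j n else 0 := fun _ _ _ => rfl
  have hW : ∀ m, MatBd r (C * ρ ^ m) (W - Y m) := fun m i j n => by
    rw [Matrix.sub_apply, coeff_sub, Pi.sub_apply, hWc]
    split_ifs with hn
    · exact hz i j m n
    · rw [hYn m i j n (by omega)]
      simp only [sub_zero, norm_zero, zero_mul]
      positivity
  refine ⟨W, fun i j => mem_gammaCon_iff.mpr (hw1 i j), hwb, ?_⟩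
  have hT : W + (X + X * W).map negPart = 0 := by
    ext1 i j
    refine eq_zero_of_bd hr hρ.le hρ1 (B := C) fun m => ?_
    have e : W + (X + X * W).map negPart = (W - Y (m + 1)) + (X * (W - Y m)).map negPart := by
      rw [← hsub, hYs]; abel
    rw [e]
    refine MatBd.add hr ((hW (m + 1)).mono ?_) ((hneg (hX.mul hr (by positivity) (hW m))).mono ?_) i j
    · exact mul_le_mul_of_nonneg_left (pow_le_pow_of_le_one hρ.le hρ1.le (Nat.le_succ m)) hC0
    · have : 0 ≤ C * ρ ^ m := by positivity
      nlinarith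
  intro i j n hn
  have h1 := congrArg (fun x : O.GammaAnCon => x.coeff n) (congrFun (congrFun hT i) j)
  simp only [Matrix.add_apply, Matrix.map_apply, coeff_add, Pi.add_apply, coeff_negPart, if_pos hn,
    Matrix.zero_apply, coeff_zero, Pi.zero_apply] at h1
  have e : (1 + X) * (1 + W) = 1 + (W + (X + X * W)) := by
    rw [mul_add, mul_one, add_mul, one_mul]; abel
  rw [e]
  simp only [Matrix.add_apply, coeff_add, Pi.add_apply]
  rw [h1, add_zero]
  exact MatSuppGE.one i j n hn

/-- A matrix close to the identity at some radius has nonzero determinant. -/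
theorem det_one_add_ne_zero {X : Matrix ι ι O.GammaAnCon} {r ρ : ℝ} (hr : 0 < r) (hρ : 0 < ρ)
    (hρ1 : ρ < 1) (hX : MatBd r ρ X) : (1 + X).det ≠ 0 := by
  -- Series of Gauss norm at most `ρ` form an ideal among those of Gauss norm at most one. Modulo
  -- this ideal the determinant is `1`, and `1` does not lie in the ideal.
  let R : Subring O.GammaAnCon :=
    { carrier := {x | Bd r 1 x}
      zero_mem' := Bd.zero zero_le_one
      one_mem' := bd_one
      add_mem' := fun hx hy => hx.add hr hy
      neg_mem' := fun hx => hx.neg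
      mul_mem' := fun hx hy => by simpa using hx.mul hr hy }
  let I : Ideal R :=
    { carrier := {x | Bd r ρ (x : O.GammaAnCon)}
      zero_mem' := Bd.zero hρ.le
      add_mem' := fun hx hy => hx.add hr hy
      smul_mem' := fun c x hx => by
        have := c.2.mul hr hx
        rwa [one_mul] at this }
  let X' : Matrix ι ι R := Matrix.of fun i j => ⟨X i j, (hX i j).mono hρ1.le⟩
  have h1 : X'.map (Ideal.Quotient.mk I) = 0 := by
    ext i j
    exact Ideal.Quotient.eq_zero_iff_mem.mpr (hX i j)
  have h2 : Ideal.Quotient.mk I (1 + X').det = 1 := by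
    rw [RingHom.map_det, RingHom.mapMatrix_apply, Matrix.map_add _ (map_add _), h1, add_zero,
      Matrix.map_one _ (map_zero _) (map_one _), Matrix.det_one]
  intro h0
  have h3 : (1 + X').det = 0 := by
    apply Subtype.val_injective
    have h4 : ((1 + X').det : O.GammaAnCon) = ((1 + X').map R.subtype).det :=
      R.subtype.map_det _
    rw [h4, Matrix.map_add _ (map_add _), Matrix.map_one _ (map_zero _) (map_one _)]
    exact h0
  rw [h3, map_zero] at h2
  have h5 : Ideal.Quotient.mk I 1 = 0 := by rw [map_one]; exact h2.symm
  have h6 : Bd r ρ (1 : O.GammaAnCon) := Ideal.Quotient.eq_zero_iff_mem.mp h5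
  have := h6 0
  simp at this
  linarith

end CoeffRing

end

/-! ### Birkhoff factorization over `Γ_con` up to powers of `p` -/

section

namespace CoeffRing

open AnCon

variable {p : ℕ} [Fact p.Prime] {k : Type v} [Field k] [IsAlgClosed k] [CharP k p]
variable {O : CoeffRing.{u, v} p k} {ι : Type*} [Fintype ι] [DecidableEq ι]

/-- Up to a unit, `x` is a power of the uniformizer, and the uniformizer divides `p`. -/
theorem exists_mul_eq_p_pow {x : O.GammaCon} (hx : x ≠ 0) :
    ∃ (w : O.GammaCon) (m : ℕ), x * w = (p : O.GammaCon) ^ m := by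
  obtain ⟨ϖ, hϖ⟩ := IsDiscreteValuationRing.exists_irreducible O.carrier
  obtain ⟨m, y, z, hz, hyz, hxy⟩ := exists_eq_const_mul x.2 (fun h => hx (Subtype.ext h)) hϖ
  obtain ⟨e, he⟩ : ϖ ∣ (p : O.carrier) := by
    obtain ⟨u, hu⟩ := O.ramIdx_spec hϖ
    rw [hu]
    exact (dvd_pow_self ϖ O.ramIdx_ne_zero).mul_left _
  refine ⟨⟨z, hz⟩ * ⟨_, O.const_algebraMap_mem e⟩ ^ m, m, Subtype.ext ?_⟩
  have hp : (p : O.GammaAnCon) = const (algebraMap O.carrier O.FracField ϖ) *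
      const (algebraMap O.carrier O.FracField e) := by
    rw [← map_mul, ← map_mul, ← he, map_natCast, map_natCast]
  simp only [Subring.coe_mul, Subring.coe_pow, SubringClass.coe_natCast]
  rw [hp, hxy, mul_pow]
  linear_combination const (algebraMap O.carrier O.FracField ϖ) ^ m *
    const (algebraMap O.carrier O.FracField e) ^ m * hyz

theorem exists_mul_eq_scalar_p_pow {V : Matrix ι ι O.GammaCon} (hV : V.det ≠ 0) :
    ∃ (V' : Matrix ι ι O.GammaCon) (s : ℕ), V * V' = Matrix.scalar ι ((p : O.GammaCon) ^ s) := by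
  obtain ⟨w, s, hw⟩ := exists_mul_eq_p_pow hV
  refine ⟨w • V.adjugate, s, ?_⟩
  rw [Matrix.mul_smul, Matrix.mul_adjugate, smul_smul, mul_comm, hw]
  ext1 i j
  simp [Matrix.one_apply, Matrix.diagonal_apply]

theorem matBd_one_of_mem {X : Matrix ι ι O.GammaAnCon} {B : ℝ} (hX : MatBd 1 B X) :
    ∃ s : ℕ, ∀ i j, const ((p : O.FracField) ^ s) * X i j ∈ O.GammaCon := by
  have hp1 : (1 : ℝ) < p := by exact_mod_cast (Fact.out : p.Prime).one_lt
  obtain ⟨s, hs⟩ := pow_unbounded_of_one_lt B hp1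
  refine ⟨s, fun i j => mem_gammaCon_iff_bd.mpr ?_⟩
  refine ((bd_const _).mul one_pos (hX i j)).mono ?_
  rw [norm_pow, O.norm_p, inv_pow, inv_mul_le_iff₀ (by positivity), mul_one]
  exact hs.le

/-- A matrix over `Γ_con`, invertible up to a power of `p`, carries a given invertible matrix over
`Γ_an,con` to a matrix of series without negative exponents. -/
theorem exists_birkhoff {U U' : Matrix ι ι O.GammaAnCon} (hU : U * U' = 1) :
    ∃ (V V' : Matrix ι ι O.GammaCon) (s : ℕ),
      V * V' = Matrix.scalar ι ((p : O.GammaCon) ^ s) ∧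
        MatSuppGE 0 (U * V.map (algebraMap O.GammaCon O.GammaAnCon)) := by
  classical
  obtain ⟨r, hr, hr1, hUs, hUs'⟩ : ∃ r : ℝ, 0 < r ∧ r < 1 ∧
      (∀ i j, Summable fun n : ℤ => ‖(U i j).coeff n‖ * r ^ n) ∧
        ∀ i j, Summable fun n : ℤ => ‖(U' i j).coeff n‖ * r ^ n := by
    have h1 : ∀ᶠ r in nhdsWithin (1 : ℝ) (Set.Iio 1), r ∈ Set.Ioo (0 : ℝ) 1 :=
      Ioo_mem_nhdsLT one_pos
    have h2 : ∀ᶠ r in nhdsWithin (1 : ℝ) (Set.Iio 1),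
        ∀ i j, Summable fun n : ℤ => ‖(U i j).coeff n‖ * r ^ n :=
      Filter.eventually_all.mpr fun i => Filter.eventually_all.mpr fun j => eventually_summable _
    have h3 : ∀ᶠ r in nhdsWithin (1 : ℝ) (Set.Iio 1),
        ∀ i j, Summable fun n : ℤ => ‖(U' i j).coeff n‖ * r ^ n :=
      Filter.eventually_all.mpr fun i => Filter.eventually_all.mpr fun j => eventually_summable _
    obtain ⟨r, hr, h, h'⟩ := (h1.and (h2.and h3)).exists
    exact ⟨r, hr.1, hr.2, h, h'⟩
  obtain ⟨C, hC1, hUC⟩ := exists_matBd fun i j => exists_bd_of_summable hr (hUs i j)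
  have hC0 : 0 < C := by linarith
  have hε : 0 < 1 / (2 * C) := by positivity
  -- `U'` is approximated at radius `r` by a matrix `P` of Laurent polynomials. With `C` bounding
  -- `U`, the tolerance `1/(2C)` makes `U P - 1` of norm at most `1/2`; a power of `p` makes `P`
  -- integral.
  have hfin : ∀ i j, ∃ S : Finset ℤ, ∀ n ∉ S, ‖(U' i j).coeff n‖ * r ^ n ≤ 1 / (2 * C) := by
    intro i j
    have h1 := (hUs' i j).tendsto_cofinite_zero.eventually_le_const hε
    exact ⟨(Filter.mem_cofinite.mp h1).toFinset, fun n hn => by simpa using hn⟩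
  choose S hS using hfin
  let T : Finset ℤ := Finset.univ.biUnion fun i => Finset.univ.biUnion fun j => S i j
  have hT : ∀ i j, ∀ n ∉ T, ‖(U' i j).coeff n‖ * r ^ n ≤ 1 / (2 * C) := fun i j n hn =>
    hS i j n fun h => hn (by
      simp only [T, Finset.mem_biUnion, Finset.mem_univ, true_and]
      exact ⟨i, j, h⟩)
  let P : Matrix ι ι O.GammaAnCon := U'.map (trunc (T : Set ℤ))
  have hPc : ∀ i j n, (P i j).coeff n = if n ∈ T then (U' i j).coeff n else 0 :=
    fun i j n => by simp only [P, Matrix.map_apply, coeff_trunc, Finset.mem_coe]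
  have hP : MatBd r (1 / (2 * C)) (U' - P) := fun i j n => by
    rw [Matrix.sub_apply, coeff_sub, Pi.sub_apply, hPc]
    by_cases hn : n ∈ T
    · rw [if_pos hn, sub_self, norm_zero, zero_mul]
      exact hε.le
    · rw [if_neg hn, sub_zero]
      exact hT i j n hn
  obtain ⟨B, -, hPB⟩ : ∃ B, 1 ≤ B ∧ MatBd 1 B P := exists_matBd fun i j =>
    ⟨∑ n ∈ T, ‖(U' i j).coeff n‖, fun n => by
      rw [one_zpow, mul_one, hPc]
      split_ifs with hn
      · exact Finset.single_le_sum (f := fun n => ‖(U' i j).coeff n‖) (fun _ _ => norm_nonneg _) hn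
      · rw [norm_zero]
        exact Finset.sum_nonneg fun _ _ => norm_nonneg _⟩
  obtain ⟨m, hm⟩ := matBd_one_of_mem hPB
  set q : O.GammaAnCon := const ((p : O.FracField) ^ m) with hq
  set X := U * P - 1 with hX
  have hXb : MatBd r (1 / 2) X := by
    have e : X = -(U * (U' - P)) := by rw [hX, mul_sub, hU]; abel
    rw [e]
    refine (MatBd.mono (le_of_eq ?_) (hUC.mul hr (by positivity) hP)).neg
    field_simp
  -- The factor `1 + Y` removes the remaining negative exponents, and `V` is `p^m P (1 + Y)`.
  obtain ⟨Y, hYc, hYb, hXY⟩ := exists_negative_factor hr hr1 (by norm_num) (by norm_num) hXb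
  have hUP : U * P = 1 + X := by rw [hX]; abel
  let P₁ : Matrix ι ι O.GammaCon := Matrix.of fun i j => ⟨q * P i j, hm i j⟩
  let Y₁ : Matrix ι ι O.GammaCon := Matrix.of fun i j => ⟨Y i j, hYc i j⟩
  have hV : (P₁ * (1 + Y₁)).map (algebraMap O.GammaCon O.GammaAnCon) = q • (P * (1 + Y)) := by
    rw [Matrix.map_mul, Matrix.map_add _ (map_add _), Matrix.map_one _ (map_zero _) (map_one _),
      ← Matrix.smul_mul]
    rfl
  have hZ : (1 + X) * (1 + Y) = 1 + (X + Y + X * Y) := by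
    rw [mul_add, mul_one, add_mul, one_mul]; abel
  have hZb : MatBd r (1 / 2) (X + Y + X * Y) :=
    (hXb.add hr hYb).add hr ((hXb.mul hr (by norm_num) hYb).mono (by norm_num))
  -- `U P (1 + Y)` is still close to the identity at radius `r`, so its determinant is nonzero. Over
  -- `Γ_con` a nonzero determinant gives invertibility up to a power of `p`.
  have hdet : (P₁ * (1 + Y₁)).det ≠ 0 := by
    intro h0
    have h1 := congrArg (algebraMap O.GammaCon O.GammaAnCon) h0
    rw [RingHom.map_det, RingHom.mapMatrix_apply, hV, Matrix.det_smul, map_zero] at h1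
    have hqu : IsUnit q := by
      have := (isUnit_natCast_p (O := O)).pow m
      rw [hq, map_pow, map_natCast]
      exact this
    have h2 := (hqu.pow (Fintype.card ι)).mul_right_eq_zero.mp h1
    refine det_one_add_ne_zero hr (by norm_num) (by norm_num) hZb ?_
    rw [← hZ, ← hUP, mul_assoc, Matrix.det_mul, h2, mul_zero]
  obtain ⟨V', s, hV'⟩ := exists_mul_eq_scalar_p_pow hdet
  refine ⟨_, V', s, hV', ?_⟩
  rw [hV, Matrix.mul_smul, ← mul_assoc, hUP]
  intro i j
  have := (suppGE_const ((p : O.FracField) ^ m)).mul (hXY i j)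
  rwa [zero_add] at this

end CoeffRing

end

/-! ### The lattice of vectors without negative exponents is finitely generated -/

section

theorem Matrix.mul_eq_scalar_comm {R ι : Type*} [CommRing R] [IsDomain R] [Fintype ι]
    [DecidableEq ι] {A B : Matrix ι ι R} {a : R} (ha : a ≠ 0) (h : A * B = Matrix.scalar ι a) :
    B * A = Matrix.scalar ι a := by
  have h1 : A * (B * A - Matrix.scalar ι a) = 0 := by
    rw [mul_sub, ← mul_assoc, h, (Matrix.scalar_commute a (Commute.all a) A).eq, sub_self]
  have h2 : A.det ≠ 0 := by
    intro h0
    have h3 := congrArg Matrix.det h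
    rw [Matrix.det_mul, h0, zero_mul, Matrix.scalar_apply, Matrix.det_diagonal] at h3
    exact Finset.prod_ne_zero_iff.mpr (fun _ _ => ha) h3.symm
  have h3 : A.det • (B * A - Matrix.scalar ι a) = 0 := by
    have := congrArg (fun X => A.adjugate * X) h1
    simpa only [← mul_assoc, Matrix.adjugate_mul, Matrix.smul_mul, one_mul, mul_zero] using this
  exact sub_eq_zero.mp ((smul_eq_zero.mp h3).resolve_left h2)

namespace CoeffRing

open AnCon

variable {p : ℕ} [Fact p.Prime] {k : Type v} [Field k] [IsAlgClosed k] [CharP k p]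
variable {O : CoeffRing.{u, v} p k} {n : ℕ}

theorem natCast_p_pow_ne_zero (m : ℕ) : (p : O.GammaCon) ^ m ≠ 0 := by
  intro h
  have h1 := congrArg (algebraMap O.GammaCon O.GammaAnCon) h
  rw [map_pow, map_natCast, map_zero] at h1
  exact ((isUnit_natCast_p (O := O)).pow m).ne_zero h1

/-- Every nonzero element divides a power of `p`, and powers of `p` are nonzero. -/
instance : IsDomain O.GammaCon := by
  have : NoZeroDivisors O.GammaCon := by
    refine ⟨fun {x y} hxy => ?_⟩
    by_contra hcon
    push Not at hcon
    obtain ⟨w, m, hw⟩ := exists_mul_eq_p_pow hcon.1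
    obtain ⟨z, l, hz⟩ := exists_mul_eq_p_pow hcon.2
    refine natCast_p_pow_ne_zero (O := O) (m + l) ?_
    rw [pow_add, ← hw, ← hz]
    linear_combination w * z * hxy
  exact NoZeroDivisors.to_isDomain _

theorem norm_le_norm_uniformizer {ϖ : O.carrier} (hϖ : Irreducible ϖ) {x : O.FracField}
    (hx : ‖x‖ < 1) : ‖x‖ ≤ ‖algebraMap O.carrier O.FracField ϖ‖ := by
  obtain ⟨q, -, -, hq, ϖ', hϖ', hn⟩ := O.exists_norm_lt_one
  rw [O.norm_uniformizer hϖ, ← O.norm_uniformizer hϖ', hn]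
  exact hq x hx

theorem algebraMap_uniformizer_ne_zero {ϖ : O.carrier} (hϖ : Irreducible ϖ) :
    algebraMap O.carrier O.FracField ϖ ≠ 0 :=
  (map_ne_zero_iff _ (IsFractionRing.injective O.carrier O.FracField)).mpr hϖ.ne_zero

theorem exists_eq_uniformizer_mul {ϖ : O.carrier} (hϖ : Irreducible ϖ) {x : O.GammaAnCon}
    (hx : ∀ i, ‖x.coeff i‖ < 1) :
    ∃ g ∈ O.GammaCon, x = const (algebraMap O.carrier O.FracField ϖ) * g := by
  set c := algebraMap O.carrier O.FracField ϖ with hc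
  have hc0 : c ≠ 0 := algebraMap_uniformizer_ne_zero hϖ
  refine ⟨const c⁻¹ * x, mem_gammaCon_iff.mpr fun i => ?_, ?_⟩
  · rw [coeff_const_mul, norm_mul, norm_inv, inv_mul_le_iff₀ (norm_pos_iff.mpr hc0), mul_one]
    exact norm_le_norm_uniformizer hϖ (hx i)
  · rw [← mul_assoc, ← map_mul, mul_inv_cancel₀ hc0, map_one, one_mul]

/-- A family of series over `𝒪`, nonzero modulo the uniformizer, is up to a power of `t` congruent
to a family of power series, one of which is a unit. -/
theorem exists_leading_term {ι : Type*} [Finite ι] {h : ι → O.GammaCon}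
    (hne : ∃ i j, ‖(h i : O.GammaAnCon).coeff j‖ = 1) {ϖ : O.carrier} (hϖ : Irreducible ϖ) :
    ∃ (m : ℤ) (h' : ι → O.Omega) (g : ι → O.GammaCon),
      (∀ i, (h i : O.GammaAnCon) = monomial m 1 * ((h' i : O.GammaCon) : O.GammaAnCon) +
        const (algebraMap O.carrier O.FracField ϖ) * (g i : O.GammaAnCon)) ∧
        ∃ i, ‖((h' i : O.GammaCon) : O.GammaAnCon).coeff 0‖ = 1 := by
  choose b hb using fun i => exists_le_of_norm_eq_one (h i : O.GammaAnCon)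
  obtain ⟨B, hB⟩ := (Set.finite_range b).bddBelow
  -- `m` is the least exponent at which some member of the family has a unit coefficient; the part
  -- below `m` is divisible by the uniformizer and goes into `g`.
  obtain ⟨m, ⟨i₀, hi₀⟩, hmin⟩ := Int.exists_least_of_bdd
    (P := fun z => ∃ i, ‖(h i : O.GammaAnCon).coeff z‖ = 1)
    ⟨B, fun z ⟨i, hz⟩ => (hB ⟨i, rfl⟩).trans (hb i z hz)⟩
    (by obtain ⟨i, j, hij⟩ := hne; exact ⟨j, i, hij⟩)
  have hg : ∀ i, ∃ g ∈ O.GammaCon, (h i : O.GammaAnCon) - trunc (Set.Ici m) (h i : O.GammaAnCon) =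
      const (algebraMap O.carrier O.FracField ϖ) * g := fun i => by
    refine exists_eq_uniformizer_mul hϖ fun j => ?_
    rw [coeff_sub, Pi.sub_apply, coeff_trunc]
    split_ifs with hj
    · simp
    · rw [sub_zero]
      refine lt_of_le_of_ne (mem_gammaCon_iff.mp (h i).2 j) fun hj' => hj (hmin j ⟨i, hj'⟩)
  choose g hgm hg using hg
  have hc : ∀ i j, (monomial (-m) 1 * trunc (Set.Ici m) (h i : O.GammaAnCon)).coeff j =
      if 0 ≤ j then (h i : O.GammaAnCon).coeff (j + m) else 0 := fun i j => by
    rw [coeff_monomial_mul, one_mul, coeff_trunc, sub_neg_eq_add]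
    simp
  refine ⟨m, fun i => ⟨⟨monomial (-m) 1 * trunc (Set.Ici m) (h i : O.GammaAnCon),
    Subring.mul_mem _ (O.monomial_one_mem _) (O.trunc_mem _ (h i).2)⟩, fun j hj => ?_⟩,
    fun i => ⟨g i, hgm i⟩, fun i => ?_, i₀, ?_⟩
  · rw [hc, if_neg (by omega)]
  · simp only
    rw [← hg i, ← mul_assoc, monomial_mul_monomial, add_neg_cancel, mul_one, monomial_zero_one,
      one_mul]
    ring
  · rw [hc, if_pos le_rfl, zero_add, hi₀]

/-- The vectors over `Γ_con` that become series without negative exponents after applying `U`. -/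
def nonnegLattice (U : Matrix (Fin n) (Fin n) O.GammaAnCon) :
    Submodule O.Omega (Fin n → O.GammaCon) where
  carrier := {x | ∀ i, SuppGE 0 ((U *ᵥ fun j => (x j : O.GammaAnCon)) i)}
  zero_mem' i := by
    have : (fun j => (((0 : Fin n → O.GammaCon) j : O.GammaCon) : O.GammaAnCon)) = 0 := rfl
    rw [this, Matrix.mulVec_zero]
    exact SuppGE.zero 0
  add_mem' {x y} hx hy i := by
    have : (fun j => (((x + y) j : O.GammaCon) : O.GammaAnCon)) =
        (fun j => (x j : O.GammaAnCon)) + fun j => (y j : O.GammaAnCon) := rfl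
    rw [this, Matrix.mulVec_add]
    exact (hx i).add (hy i)
  smul_mem' c x hx i := by
    have : (fun j => (((c • x) j : O.GammaCon) : O.GammaAnCon)) =
        ((c : O.GammaCon) : O.GammaAnCon) • fun j => (x j : O.GammaAnCon) := rfl
    rw [this, Matrix.mulVec_smul]
    have hc : SuppGE 0 ((c : O.GammaCon) : O.GammaAnCon) := c.2
    have := hc.mul (hx i)
    rwa [add_zero] at this

theorem coe_mulVec {m l : Type*} [Fintype l] (A : Matrix m l O.GammaCon) (x : l → O.GammaCon) :
    (fun i => ((A *ᵥ x) i : O.GammaAnCon)) =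
      A.map (algebraMap O.GammaCon O.GammaAnCon) *ᵥ fun i => (x i : O.GammaAnCon) :=
  map_mulVec (algebraMap O.GammaCon O.GammaAnCon) A x

/-- The lattice is saturated. -/
theorem mem_nonnegLattice_of_const_smul {U : Matrix (Fin n) (Fin n) O.GammaAnCon} {a : O.FracField}
    (ha : a ≠ 0) {x y : Fin n → O.GammaCon} (hy : y ∈ nonnegLattice U)
    (hxy : ∀ i, (y i : O.GammaAnCon) = const a * (x i : O.GammaAnCon)) : x ∈ nonnegLattice U := by
  intro i
  have e : (fun j => (x j : O.GammaAnCon)) = const a⁻¹ • fun j => (y j : O.GammaAnCon) := by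
    ext1 j
    rw [Pi.smul_apply, smul_eq_mul, hxy, ← mul_assoc, ← map_mul, inv_mul_cancel₀ ha, map_one,
      one_mul]
  rw [e, Matrix.mulVec_smul]
  have := (suppGE_const a⁻¹).mul (hy i)
  rwa [add_zero] at this

/-- Birkhoff factorization of the transposed inverse of `U` yields `R` over `Γ_con`, invertible up
to a power of `p`, with `R U'` free of negative exponents. For `x` in the lattice, `R x = (R U')(U
x)` has entries in `Ω`; so `R` embeds the lattice into the Noetherian module `Ωⁿ`. -/
theorem nonnegLattice_fg {U U' : Matrix (Fin n) (Fin n) O.GammaAnCon} (hU : U * U' = 1) :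
    (nonnegLattice U).FG := by
  obtain ⟨V, V', s, hV, hUV⟩ := exists_birkhoff (U := U'ᵀ) (U' := Uᵀ) (by
    rw [← Matrix.transpose_mul, hU, Matrix.transpose_one])
  set R := Vᵀ with hR
  have hRU : MatSuppGE 0 (R.map (algebraMap O.GammaCon O.GammaAnCon) * U') := fun i j => by
    have := hUV j i
    rwa [← Matrix.transpose_apply (_ * _), Matrix.transpose_mul, Matrix.transpose_transpose] at this
  have hU' := mul_eq_one_comm.mp hU
  have hmem : ∀ x ∈ nonnegLattice U, ∀ i, (R *ᵥ x) i ∈ O.Omega := by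
    intro x hx i
    have h1 : (fun i => ((R *ᵥ x) i : O.GammaAnCon)) =
        (R.map (algebraMap O.GammaCon O.GammaAnCon) * U') *ᵥ
          (U *ᵥ fun j => (x j : O.GammaAnCon)) := by
      rw [coe_mulVec, Matrix.mulVec_mulVec, mul_assoc, hU', mul_one]
    have h2 : SuppGE 0 ((R *ᵥ x) i : O.GammaAnCon) := by
      rw [show ((R *ᵥ x) i : O.GammaAnCon) = _ from congrFun h1 i]
      refine SuppGE.sum fun j _ => ?_
      have := (hRU i j).mul (hx j)
      rwa [add_zero] at this
    exact h2
  let φ : nonnegLattice U →ₗ[O.Omega] (Fin n → O.Omega) :=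
    { toFun := fun x i => ⟨(R *ᵥ x.1) i, hmem x.1 x.2 i⟩
      map_add' := fun x y => by
        ext1 i
        apply Subtype.ext
        change (R *ᵥ (x.1 + y.1)) i = (R *ᵥ x.1) i + (R *ᵥ y.1) i
        rw [Matrix.mulVec_add, Pi.add_apply]
      map_smul' := fun c x => by
        ext1 i
        apply Subtype.ext
        change (R *ᵥ ((c : O.GammaCon) • x.1)) i = (c : O.GammaCon) * (R *ᵥ x.1) i
        rw [Matrix.mulVec_smul, Pi.smul_apply, smul_eq_mul] }
  have hinj : Function.Injective φ := by
    rw [← LinearMap.ker_eq_bot, LinearMap.ker_eq_bot']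
    intro x hx
    have h1 : R *ᵥ x.1 = 0 := by
      ext1 i
      exact congrArg Subtype.val (congrFun hx i)
    have h2 : V'ᵀ * R = Matrix.scalar (Fin n) ((p : O.GammaCon) ^ s) := by
      rw [hR, ← Matrix.transpose_mul, hV, Matrix.scalar_apply, Matrix.diagonal_transpose]
    have h3 : (V'ᵀ * R) *ᵥ x.1 = 0 := by rw [← Matrix.mulVec_mulVec, h1, Matrix.mulVec_zero]
    rw [h2] at h3
    apply Subtype.ext
    ext1 i
    have h4 := congrFun h3 i
    rw [Matrix.scalar_apply, Matrix.mulVec_diagonal] at h4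
    exact (mul_eq_zero.mp h4).resolve_left (natCast_p_pow_ne_zero s)
  have hN : IsNoetherian O.Omega (nonnegLattice U) := isNoetherian_of_injective φ hinj
  exact Module.Finite.iff_fg.mp inferInstance

end CoeffRing

end

/-! ### The lattice is free of full rank -/

section

/-- A generator occurring with a unit coefficient in a relation can be dropped. -/
theorem span_succAbove_eq {R M : Type*} [CommRing R] [AddCommGroup M] [Module R M] {r : ℕ}
    {b : Fin (r + 1) → M} {e : Fin (r + 1) → R} {i₀ : Fin (r + 1)} (hsum : ∑ j, e j • b j = 0)
    (hu : IsUnit (e i₀)) :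
    Submodule.span R (Set.range fun j => b (i₀.succAbove j)) = Submodule.span R (Set.range b) := by
  refine le_antisymm (Submodule.span_mono ?_) (Submodule.span_le.mpr ?_)
  · rintro _ ⟨j, rfl⟩
    exact ⟨_, rfl⟩
  · rintro _ ⟨j, rfl⟩
    rcases Fin.eq_self_or_eq_succAbove i₀ j with rfl | ⟨j', rfl⟩
    · obtain ⟨u, hu⟩ := hu.exists_left_inv
      rw [Fin.sum_univ_succAbove _ j] at hsum
      have h1 := congrArg (fun x => u • x) (eq_neg_of_add_eq_zero_left hsum)
      simp only [smul_smul, hu, one_smul] at h1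
      rw [SetLike.mem_coe, h1]
      exact Submodule.smul_mem _ _ (Submodule.neg_mem _ (Submodule.sum_mem _ fun j' _ =>
        Submodule.smul_mem _ _ (Submodule.subset_span ⟨j', rfl⟩)))
    · exact Submodule.subset_span ⟨j', rfl⟩

theorem not_isUnit_of_minimal {R M : Type*} [CommRing R] [AddCommGroup M] [Module R M] {r : ℕ}
    {N : Submodule R M} {b : Fin r → M} (hb : Submodule.span R (Set.range b) = N)
    (hmin : ∀ m < r, ¬ ∃ s : Fin m → M, Submodule.span R (Set.range s) = N)
    {e : Fin r → R} (hsum : ∑ j, e j • b j = 0) (i₀ : Fin r) : ¬ IsUnit (e i₀) := fun hu => by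
  rcases r with _ | r
  · exact i₀.elim0
  · exact hmin r (Nat.lt_succ_self r) ⟨_, (span_succAbove_eq hsum hu).trans hb⟩

namespace CoeffRing

open AnCon

variable {p : ℕ} [Fact p.Prime] {k : Type v} [Field k] [IsAlgClosed k] [CharP k p]
variable {O : CoeffRing.{u, v} p k} {n r : ℕ}

theorem mulVec_coe_eq_sum (b : Fin r → Fin n → O.GammaCon) (c : Fin r → O.Omega) :
    ((Matrix.of fun i j => b j i) *ᵥ fun j => (c j : O.GammaCon)) = ∑ j, c j • b j := by
  ext1 i
  rw [Finset.sum_apply]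
  simp only [Matrix.mulVec, dotProduct, Matrix.of_apply]
  exact Finset.sum_congr rfl fun j _ => mul_comm (b j i) (c j : O.GammaCon)

theorem isUnit_sub_uniformizer_mul {ϖ : O.carrier} (hϖ : Irreducible ϖ) {x y π : O.Omega}
    (hπ : ((π : O.GammaCon) : O.GammaAnCon) = const (algebraMap O.carrier O.FracField ϖ))
    (hx : ‖((x : O.GammaCon) : O.GammaAnCon).coeff 0‖ = 1) : IsUnit (x - π * y) := by
  refine O.isUnit_omega ?_
  have e : (((x - π * y : O.Omega) : O.GammaCon) : O.GammaAnCon).coeff 0 =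
      ((x : O.GammaCon) : O.GammaAnCon).coeff 0 -
        algebraMap O.carrier O.FracField ϖ * ((y : O.GammaCon) : O.GammaAnCon).coeff 0 := by
    rw [← coeff_const_mul, ← hπ]
    rfl
  have hlt : ‖algebraMap O.carrier O.FracField ϖ *
      ((y : O.GammaCon) : O.GammaAnCon).coeff 0‖ < 1 := by
    rw [norm_mul]
    refine (mul_le_of_le_one_right (norm_nonneg _) (mem_gammaCon_iff.mp y.1.2 0)).trans_lt ?_
    exact lt_of_le_of_ne (O.norm_algebraMap_le_one _) fun h1 =>
      hϖ.not_isUnit ((O.norm_algebraMap_eq_one_iff ϖ).mp h1)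
  rw [e, sub_eq_add_neg, IsUltrametricDist.norm_add_eq_max_of_norm_ne_norm, norm_neg, hx,
    max_eq_left hlt.le]
  rw [norm_neg, hx]
  exact hlt.ne'

/-- A relation over `Γ_con` between the members of a minimal generating family has its coefficients
in the maximal ideal. -/
theorem norm_lt_one_of_mulVec_eq_zero {U : Matrix (Fin n) (Fin n) O.GammaAnCon}
    {b : Fin r → Fin n → O.GammaCon}
    (hb : Submodule.span O.Omega (Set.range b) = nonnegLattice U)
    (hmin : ∀ m < r, ¬ ∃ s : Fin m → Fin n → O.GammaCon,
      Submodule.span O.Omega (Set.range s) = nonnegLattice U)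
    {h : Fin r → O.GammaCon} (hh : (Matrix.of fun i j => b j i) *ᵥ h = 0) (i : Fin r) (j : ℤ) :
    ‖(h i : O.GammaAnCon).coeff j‖ < 1 := by
  by_contra hcon
  have hij : ‖(h i : O.GammaAnCon).coeff j‖ = 1 :=
    le_antisymm (mem_gammaCon_iff.mp (h i).2 j) (not_lt.mp hcon)
  obtain ⟨ϖ, hϖ⟩ := IsDiscreteValuationRing.exists_irreducible O.carrier
  obtain ⟨m, h', g, hhg, i₀, hi₀⟩ := exists_leading_term ⟨i, j, hij⟩ hϖ
  set B : Matrix (Fin n) (Fin r) O.GammaCon := Matrix.of fun i j => b j i with hB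
  let T : O.GammaCon := ⟨monomial m 1, O.monomial_one_mem m⟩
  let T' : O.GammaCon := ⟨monomial (-m) 1, O.monomial_one_mem (-m)⟩
  let π : O.Omega := ⟨⟨const (algebraMap O.carrier O.FracField ϖ), O.const_algebraMap_mem ϖ⟩,
    suppGE_const _⟩
  have hTT : T' * T = 1 := Subtype.ext (by
    change monomial (-m) 1 * monomial m 1 = 1
    rw [monomial_mul_monomial, neg_add_cancel, mul_one, monomial_zero_one])
  have hh' : h = T • (fun i => (h' i : O.GammaCon)) + (π : O.GammaCon) • g := by
    ext1 i
    exact Subtype.ext (hhg i)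
  -- Modulo `ϖ` and up to a power of `t`, the relation has coefficients `h'` in `Ω`. So `∑ h'ⱼ bⱼ`
  -- is `ϖ` times a vector, which lies in the lattice by saturation. Writing that vector in the
  -- generators gives `∑ (h'ⱼ - ϖ cⱼ) bⱼ = 0` with a unit coefficient, against minimality.
  set y := B *ᵥ fun j => (h' j : O.GammaCon) with hy
  have hyN : y ∈ nonnegLattice U := by
    rw [hy, hB, mulVec_coe_eq_sum, ← hb]
    exact Submodule.sum_mem _ fun j _ => Submodule.smul_mem _ _ (Submodule.subset_span ⟨j, rfl⟩)
  set w := -(T' • B *ᵥ g) with hw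
  have hyw : y = (π : O.GammaCon) • w := by
    rw [hh', Matrix.mulVec_add, Matrix.mulVec_smul, Matrix.mulVec_smul] at hh
    have h1 := congrArg (fun x => T' • x) hh
    simp only [smul_add, smul_smul, hTT, one_smul, smul_zero] at h1
    refine (eq_neg_of_add_eq_zero_left h1).trans ?_
    rw [hw, smul_neg, smul_smul, mul_comm]
  have hwN : w ∈ nonnegLattice U :=
    mem_nonnegLattice_of_const_smul (algebraMap_uniformizer_ne_zero hϖ) hyN fun i =>
      congrArg Subtype.val (congrFun hyw i)
  rw [← hb, Submodule.mem_span_range_iff_exists_fun] at hwN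
  obtain ⟨c, hc⟩ := hwN
  have hsum : ∑ j, (h' j - π * c j) • b j = 0 := by
    simp only [sub_smul, Finset.sum_sub_distrib, mul_smul]
    rw [← Finset.smul_sum, hc, ← mulVec_coe_eq_sum, ← hB, ← hy, hyw]
    exact sub_self _
  have hunit : IsUnit (h' i₀ - π * c i₀) := isUnit_sub_uniformizer_mul hϖ rfl hi₀
  exact not_isUnit_of_minimal hb hmin hsum i₀ hunit

/-- The lattice of vectors that become nonnegative is free, and of full rank. -/
theorem exists_lattice_basis {U U' : Matrix (Fin n) (Fin n) O.GammaAnCon} (hU : U * U' = 1) :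
    ∃ (b b' : Matrix (Fin n) (Fin n) O.GammaCon) (s : ℕ),
      b * b' = Matrix.scalar (Fin n) ((p : O.GammaCon) ^ s) ∧
        (∀ j, (fun i => b i j) ∈ nonnegLattice U) ∧
          ∀ x ∈ nonnegLattice U, ∃ c : Fin n → O.Omega, x = b *ᵥ fun j => (c j : O.GammaCon) := by
  classical
  have hex := Submodule.fg_iff_exists_fin_generating_family.mp (nonnegLattice_fg hU)
  obtain ⟨r, ⟨b, hb⟩, hmin⟩ : ∃ r, (∃ s : Fin r → Fin n → O.GammaCon,
      Submodule.span O.Omega (Set.range s) = nonnegLattice U) ∧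
      ∀ m < r, ¬ ∃ s : Fin m → Fin n → O.GammaCon,
        Submodule.span O.Omega (Set.range s) = nonnegLattice U :=
    ⟨Nat.find hex, Nat.find_spec hex, fun m hm => Nat.find_min hex hm⟩
  set B : Matrix (Fin n) (Fin r) O.GammaCon := Matrix.of fun i j => b j i with hB
  obtain ⟨q, q0, q1, -, ϖ, hϖ, hϖq⟩ := O.exists_norm_lt_one
  let π : O.GammaCon := ⟨const (algebraMap O.carrier O.FracField ϖ), O.const_algebraMap_mem ϖ⟩
  have hπ0 : π ≠ 0 := by
    intro h0
    have h1 := congrArg Subtype.val h0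
    exact algebraMap_uniformizer_ne_zero hϖ (const_injective (h1.trans (map_zero const).symm))
  -- A relation can be divided by the uniformizer indefinitely, hence is zero.
  have hBinj : ∀ h : Fin r → O.GammaCon, B *ᵥ h = 0 → h = 0 := by
    intro h hh
    have hdiv : ∀ m : ℕ, ∃ h₁ : Fin r → O.GammaCon, h = π ^ m • h₁ ∧ B *ᵥ h₁ = 0 := by
      intro m
      induction m with
      | zero => exact ⟨h, by simp, hh⟩
      | succ m ih =>
        obtain ⟨h₁, e₁, hh₁⟩ := ih
        choose g hg hg' using fun i => exists_eq_uniformizer_mul hϖ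
          (norm_lt_one_of_mulVec_eq_zero hb hmin hh₁ i)
        have e₂ : h₁ = π • fun i => (⟨g i, hg i⟩ : O.GammaCon) := by
          ext1 i
          exact Subtype.ext (hg' i)
        refine ⟨fun i => ⟨g i, hg i⟩, ?_, ?_⟩
        · rw [pow_succ, mul_smul, ← e₂, ← e₁]
        · rw [e₂, Matrix.mulVec_smul] at hh₁
          exact (smul_eq_zero.mp hh₁).resolve_left hπ0
    ext1 i
    refine Subtype.ext (eq_zero_of_bd one_pos q0.le q1 (B := 1) fun m => ?_)
    obtain ⟨h₁, e₁, -⟩ := hdiv m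
    have e₂ : (h i : O.GammaAnCon) = const (algebraMap O.carrier O.FracField ϖ ^ m) *
        (h₁ i : O.GammaAnCon) := by
      rw [e₁, map_pow]; rfl
    rw [e₂, mul_comm (1 : ℝ)]
    refine Bd.mul one_pos ?_ (mem_gammaCon_iff_bd.mp (h₁ i).2)
    rw [← hϖq, ← norm_pow]
    exact bd_const _
  have hcoord : ∀ x ∈ nonnegLattice U, ∃ c : Fin r → O.Omega, x = B *ᵥ fun j => (c j : O.GammaCon) := by
    intro x hx
    rw [← hb, Submodule.mem_span_range_iff_exists_fun] at hx
    obtain ⟨c, hc⟩ := hx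
    exact ⟨c, by rw [hB, mulVec_coe_eq_sum, hc]⟩
  -- The columns of the Birkhoff matrix lie in the lattice, so `V = B C`, and `C V'` is a right
  -- inverse of `B` up to a power of `p`. Since `B` and `C V'` are both injective, `r = n`.
  obtain ⟨V, V', s, hV, hUV⟩ := exists_birkhoff hU
  have hVN : ∀ j, (fun i => V i j) ∈ nonnegLattice U := fun j i => hUV i j
  choose c hc using fun j => hcoord _ (hVN j)
  let C : Matrix (Fin r) (Fin n) O.GammaCon := Matrix.of fun i j => (c j i : O.GammaCon)
  have hVC : V = B * C := by
    ext1 i j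
    exact congrFun (hc j) i
  have hBC : B * (C * V') = Matrix.scalar (Fin n) ((p : O.GammaCon) ^ s) := by
    rw [← Matrix.mul_assoc, ← hVC, hV]
  have hrn : r ≤ n := by
    refine le_of_fin_injective O.GammaCon B.mulVecLin ?_
    rw [← LinearMap.ker_eq_bot, LinearMap.ker_eq_bot']
    exact hBinj
  have hnr : n ≤ r := by
    refine le_of_fin_injective O.GammaCon (C * V').mulVecLin ?_
    rw [← LinearMap.ker_eq_bot, LinearMap.ker_eq_bot']
    intro x hx
    have h1 : (B * (C * V')) *ᵥ x = 0 := by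
      rw [← Matrix.mulVec_mulVec]
      rw [Matrix.mulVecLin_apply] at hx
      rw [hx, Matrix.mulVec_zero]
    rw [hBC] at h1
    ext1 i
    have h2 := congrFun h1 i
    rw [Matrix.scalar_apply, Matrix.mulVec_diagonal] at h2
    exact (mul_eq_zero.mp h2).resolve_left (natCast_p_pow_ne_zero s)
  obtain rfl : r = n := le_antisymm hrn hnr
  refine ⟨B, C * V', s, hBC, fun j => ?_, hcoord⟩
  rw [← hb]
  exact Submodule.subset_span ⟨j, rfl⟩

end CoeffRing

end

/-! ### Frobenius on the lattice; constant crystals are semistable -/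

section

theorem Matrix.cancel_left_of_mul_eq_scalar {R ι μ : Type*} [CommRing R] [IsDomain R] [Fintype ι]
    [DecidableEq ι] {B B' : Matrix ι ι R} {a : R} (ha : a ≠ 0) (h : B' * B = Matrix.scalar ι a)
    {X Y : Matrix ι μ R} (hXY : B * X = B * Y) : X = Y := by
  have h1 := congrArg (fun Z => B' * Z) hXY
  simp only [← Matrix.mul_assoc, h] at h1
  ext i j
  have h2 := congrFun (congrFun h1 i) j
  rw [Matrix.scalar_apply, Matrix.diagonal_mul, Matrix.diagonal_mul] at h2
  exact mul_left_cancel₀ ha h2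

namespace CoeffRing

open AnCon

variable {p : ℕ} [Fact p.Prime] {k : Type v} [Field k] [IsAlgClosed k] [CharP k p]
variable {O : CoeffRing.{u, v} p k} {n : ℕ}

theorem coeff_sum_monomial_frob (x : Fin p → O.GammaAnCon) (i : Fin p) (m : ℤ) :
    (∑ j : Fin p, monomial (j : ℤ) 1 * O.frobAnCon (x j)).coeff (p * m + i) =
      O.σF ((x i).coeff m) := by
  rw [coeff_sum, Finset.sum_eq_single i]
  · rw [coeff_monomial_mul, one_mul, add_sub_cancel_right, frobAnCon_coeff_mul]
  · intro j _ hj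
    rw [coeff_monomial_mul, one_mul, frobAnCon_coeff, if_neg]
    rw [add_sub_assoc]
    intro hdvd
    have h1 := (Int.dvd_add_right (dvd_mul_right _ _)).mp hdvd
    have h2 : ((i : ℕ) : ℤ) - (j : ℕ) = 0 := Int.eq_zero_of_abs_lt_dvd h1 (by
      rw [abs_lt]
      have := i.2
      have := j.2
      constructor <;> omega)
    exact hj (Fin.ext (by omega))
  · intro h
    exact absurd (Finset.mem_univ i) h

/-- `Γ_con` is spanned over its Frobenius image by `1, t, …, t^(p-1)`. -/
theorem exists_frob_decomposition (y : O.GammaCon) : ∃ x : Fin p → O.GammaCon,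
    (y : O.GammaAnCon) = ∑ j : Fin p, monomial (j : ℤ) 1 * O.frobAnCon (x j) := by
  choose τ hτ using O.σF_surjective
  have hτn : ∀ a, ‖τ a‖ = ‖a‖ := fun a => by rw [← O.norm_σF, hτ]
  have hy := mem_gammaCon_iff.mp y.2
  obtain ⟨r, hr, hr1, C, hC⟩ : ∃ r : ℝ, 0 < r ∧ r < 1 ∧ ∃ C, Bd r C (y : O.GammaAnCon) := by
    obtain ⟨r₀, h0, h1, h⟩ := (y : O.GammaAnCon).isAnCon.exists_summable
    obtain ⟨r, hr, hr1⟩ := exists_between h1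
    exact ⟨r, h0.trans hr, hr1, exists_bd_of_summable (h0.trans hr) (h r hr hr1)⟩
  have hp0 : p ≠ 0 := (Fact.out : p.Prime).ne_zero
  -- The coefficient of `tᵐ` in `xⱼ` comes from that of `t^(pm+j)` in `y`, so the radius `r` is
  -- replaced by `r^p`.
  have hbd : ∀ (j : Fin p) (m : ℤ), ‖τ ((y : O.GammaAnCon).coeff (p * m + j))‖ * (r ^ p) ^ m ≤
      C / r ^ (j : ℤ) := by
    intro j m
    have hj : 0 < r ^ ((j : ℕ) : ℤ) := zpow_pos hr _
    rw [hτn, le_div_iff₀ hj, mul_assoc, ← zpow_natCast r p, ← zpow_mul, ← zpow_add₀ hr.ne']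
    exact hC _
  let x : Fin p → O.GammaCon := fun j =>
    ⟨AnCon.mk (fun m => τ ((y : O.GammaAnCon).coeff (p * m + j)))
      (isAnCon_of_bounded (pow_pos hr p) (pow_lt_one₀ hr.le hr1 hp0)
        (fun m => (hτn _).trans_le (hy _)) (hbd j)),
      mem_gammaCon_iff.mpr fun m => (hτn _).trans_le (hy _)⟩
  refine ⟨x, ?_⟩
  ext N
  have h0 : 0 ≤ N % p := Int.emod_nonneg _ p_pos.ne'
  have h1 : N % p < p := Int.emod_lt_of_pos _ p_pos
  have hN : N = p * (N / p) + ((⟨(N % p).toNat, by omega⟩ : Fin p) : ℕ) := by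
    simp only [Int.toNat_of_nonneg h0]
    exact (Int.mul_ediv_add_emod N p).symm
  rw [hN, coeff_sum_monomial_frob]
  exact (hτ _).symm

theorem suppGE_of_sum_monomial_frob {x : Fin p → O.GammaAnCon}
    (h : SuppGE 0 (∑ j : Fin p, monomial (j : ℤ) 1 * O.frobAnCon (x j))) (j : Fin p) :
    SuppGE 0 (x j) := fun m hm => by
  apply O.σF.injective
  rw [map_zero, ← coeff_sum_monomial_frob x j m]
  refine h _ ?_
  have := j.2
  have hp := p_pos (p := p)
  nlinarith

/-- `U A x^σ = Z (U x)^σ`, where `Z` is constant and Frobenius creates no negative exponents. -/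
theorem frobCon_mem_nonnegLattice {U : Matrix (Fin n) (Fin n) O.GammaAnCon}
    {Z : Matrix (Fin n) (Fin n) O.FracField} {A : Matrix (Fin n) (Fin n) O.GammaCon}
    (hUA : U * A.map (algebraMap O.GammaCon O.GammaAnCon) = Z.map const * U.map O.frobAnCon)
    {x : Fin n → O.GammaCon} (hx : x ∈ nonnegLattice U) :
    (A *ᵥ fun i => O.frobCon (x i)) ∈ nonnegLattice U := by
  intro i
  have e : (U *ᵥ fun j => ((A *ᵥ fun i => O.frobCon (x i)) j : O.GammaAnCon)) =
      Z.map const *ᵥ fun i => O.frobAnCon ((U *ᵥ fun j => (x j : O.GammaAnCon)) i) := by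
    rw [coe_mulVec, Matrix.mulVec_mulVec, hUA, ← Matrix.mulVec_mulVec, map_mulVec O.frobAnCon]
    rfl
  rw [e]
  refine SuppGE.sum fun j _ => ?_
  have := (suppGE_const (Z i j)).mul (suppGE_frob (hx j))
  rwa [mul_zero, add_zero] at this

/-- `U^σ y = Z⁻¹ U A y` has no negative exponents. Writing `y = ∑ tˡ xₗ^σ` gives `U^σ y = ∑ tˡ (U
xₗ)^σ`, whose summands have exponents in different classes modulo `p`; so no `U xₗ` has negative
exponents. Thus the `xₗ` lie in the lattice, and their coordinates assemble to those of `y` in the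
Frobenius image of `b`. -/
theorem exists_eq_frob_of_mem {U : Matrix (Fin n) (Fin n) O.GammaAnCon}
    {Z : Matrix (Fin n) (Fin n) O.FracField} (hZ : IsUnit Z)
    {A : Matrix (Fin n) (Fin n) O.GammaCon}
    (hUA : U * A.map (algebraMap O.GammaCon O.GammaAnCon) = Z.map const * U.map O.frobAnCon)
    {b : Matrix (Fin n) (Fin n) O.GammaCon}
    (hb : ∀ x ∈ nonnegLattice U, ∃ c : Fin n → O.Omega, x = b *ᵥ fun j => (c j : O.GammaCon))
    {y : Fin n → O.GammaCon} (hy : A *ᵥ y ∈ nonnegLattice U) :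
    ∃ c : Fin n → O.Omega, y = b.map O.frobCon *ᵥ fun j => (c j : O.GammaCon) := by
  choose x hx using fun i => exists_frob_decomposition (y i)
  obtain ⟨Z', hZ'⟩ := hZ.exists_left_inv
  have h1 : U.map O.frobAnCon *ᵥ (fun j => (y j : O.GammaAnCon)) =
      Z'.map const *ᵥ (U *ᵥ fun j => ((A *ᵥ y) j : O.GammaAnCon)) := by
    rw [coe_mulVec, Matrix.mulVec_mulVec _ U, hUA, Matrix.mulVec_mulVec, ← mul_assoc, ← Matrix.map_mul,
      hZ', Matrix.map_one _ (map_zero _) (map_one _), one_mul]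
  have h2 : ∀ i, SuppGE 0 ((U.map O.frobAnCon *ᵥ fun j => (y j : O.GammaAnCon)) i) := by
    intro i
    rw [h1]
    refine SuppGE.sum fun j _ => ?_
    have := (suppGE_const (Z' i j)).mul (hy j)
    rwa [add_zero] at this
  have h3 : ∀ i, (U.map O.frobAnCon *ᵥ fun j => (y j : O.GammaAnCon)) i =
      ∑ l : Fin p, monomial (l : ℤ) 1 *
        O.frobAnCon ((U *ᵥ fun j => (x j l : O.GammaAnCon)) i) := by
    intro i
    simp only [Matrix.mulVec, dotProduct, Matrix.map_apply, hx, map_sum, map_mul, Finset.mul_sum]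
    rw [Finset.sum_comm]
    exact Finset.sum_congr rfl fun l _ => Finset.sum_congr rfl fun j _ => mul_left_comm _ _ _
  have h4 : ∀ l, (fun j => x j l) ∈ nonnegLattice U := fun l i =>
    suppGE_of_sum_monomial_frob (x := fun l => (U *ᵥ fun j => (x j l : O.GammaAnCon)) i)
      (h3 i ▸ h2 i) l
  choose c hc using fun l => hb _ (h4 l)
  let t : Fin p → O.Omega := fun l => ⟨⟨monomial (l : ℤ) 1, O.monomial_one_mem _⟩, fun i hi => by
    have : i ≠ (l : ℤ) := by omega
    simp [Pi.single_eq_of_ne this]⟩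
  refine ⟨fun j => ∑ l, t l * O.frobOmega (c l j), ?_⟩
  ext1 i
  have h5 : y i = ∑ l, (t l : O.GammaCon) * O.frobCon (x i l) := by
    apply Subtype.ext
    rw [hx i, AddSubmonoidClass.coe_finsetSum]
    rfl
  rw [h5]
  have h6 : ∀ l, x i l = (b *ᵥ fun j => (c l j : O.GammaCon)) i := fun l => congrFun (hc l) i
  have h7 : ∀ j, ((∑ l, t l * O.frobOmega (c l j) : O.Omega) : O.GammaCon) =
      ∑ l, (t l : O.GammaCon) * O.frobCon (c l j : O.GammaCon) := fun j => by
    rw [AddSubmonoidClass.coe_finsetSum]; rfl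
  simp only [h6, h7, Matrix.mulVec, dotProduct, Matrix.map_apply, map_sum, map_mul, Finset.mul_sum]
  rw [Finset.sum_comm]
  exact Finset.sum_congr rfl fun l _ => Finset.sum_congr rfl fun j _ => mul_left_comm _ _ _

/-- A Frobenius structure over `Γ_con` that becomes constant over `Γ_an,con` has, up to a power of
`p`, a basis in which its matrix has entries in `𝒪⟦t⟧`. -/
theorem exists_omega_matrix {U U' : Matrix (Fin n) (Fin n) O.GammaAnCon}
    {Z : Matrix (Fin n) (Fin n) O.FracField} (hU : U * U' = 1) (hZ : IsUnit Z)
    {A B : Matrix (Fin n) (Fin n) O.GammaCon} {l : ℕ}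
    (hAB : A * B = Matrix.scalar _ ((p : O.GammaCon) ^ l))
    (hUA : U * A.map (algebraMap O.GammaCon O.GammaAnCon) = Z.map const * U.map O.frobAnCon) :
    ∃ (b b' : Matrix (Fin n) (Fin n) O.GammaCon) (s : ℕ) (A₁ B₁ : Matrix (Fin n) (Fin n) O.Omega),
      b * b' = Matrix.scalar _ ((p : O.GammaCon) ^ s) ∧
        b * A₁.map (algebraMap O.Omega O.GammaCon) = A * b.map O.frobCon ∧
          A₁ * B₁ = Matrix.scalar _ ((p : O.Omega) ^ l) := by
  obtain ⟨b, b', s, hbb', hbN, hb⟩ := exists_lattice_basis hU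
  have hb'b := Matrix.mul_eq_scalar_comm (natCast_p_pow_ne_zero s) hbb'
  -- Stability of the lattice under Frobenius gives `A₁`; the columns of `B b`, which `A` sends to
  -- `p^l` times those of `b`, will give `B₁`.
  choose a ha using fun j => hb _ (frobCon_mem_nonnegLattice hUA (hbN j))
  have hABb : A * (B * b) = b * Matrix.scalar _ ((p : O.GammaCon) ^ l) := by
    rw [← Matrix.mul_assoc, hAB, (Matrix.scalar_commute _ (Commute.all _) b).eq]
  have hy : ∀ j, (A *ᵥ fun i => (B * b) i j) ∈ nonnegLattice U := by
    intro j
    have e : (A *ᵥ fun i => (B * b) i j) = ((p : O.Omega) ^ l) • fun i => b i j := by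
      ext1 i
      have h1 := congrFun (congrFun hABb i) j
      rw [Matrix.scalar_apply, Matrix.mul_diagonal] at h1
      exact h1.trans (mul_comm _ _)
    rw [e]
    exact Submodule.smul_mem _ _ (hbN j)
  choose d hd using fun j => exists_eq_frob_of_mem hZ hUA hb (hy j)
  let A₁ : Matrix (Fin n) (Fin n) O.Omega := Matrix.of fun i j => a j i
  let B₁ : Matrix (Fin n) (Fin n) O.Omega := Matrix.of fun i j => d j i
  have hA₁ : b * A₁.map (algebraMap O.Omega O.GammaCon) = A * b.map O.frobCon := by
    ext1 i j
    exact (congrFun (ha j) i).symm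
  have hB₁ : B * b = b.map O.frobCon * B₁.map (algebraMap O.Omega O.GammaCon) := by
    ext1 i j
    exact congrFun (hd j) i
  refine ⟨b, b', s, A₁, B₁, hbb', hA₁, ?_⟩
  -- `b A₁ B₁ = A b^σ B₁ = A B b = p^l b`, and `b`, being invertible up to a power of `p`, can be
  -- cancelled.
  have h1 : (A₁ * B₁).map (algebraMap O.Omega O.GammaCon) =
      Matrix.scalar _ ((p : O.GammaCon) ^ l) := by
    refine Matrix.cancel_left_of_mul_eq_scalar (natCast_p_pow_ne_zero s) hb'b ?_
    rw [Matrix.map_mul, ← Matrix.mul_assoc, hA₁, Matrix.mul_assoc, ← hB₁, hABb]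
  ext1 i j
  apply Subtype.val_injective
  refine (congrFun (congrFun h1 i) j).trans ?_
  simp only [Matrix.scalar_apply, Matrix.diagonal_apply]
  split_ifs <;> rfl

end CoeffRing

open CoeffRing FModule AnCon

variable {p : ℕ} [Fact p.Prime] {k : Type v} [Field k] [IsAlgClosed k] [CharP k p]
variable {O : CoeffRing.{u, v} p k}

theorem IsConstant.isSemistable {M : FModule O.GammaCon O.frobCon} (hM : M.IsFCrystal p)
    (h : IsConstant (M.baseChange O.frobAnCon O.algebraMap_frobCon)) : IsSemistable M := by
  obtain ⟨n, ⟨b₀⟩⟩ := exists_basis_fin O.isLocalRing_gammaCon hM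
  obtain ⟨B, l, hAB⟩ := hM.exists_matrix b₀
  have hMA := iso_ofMatrix M b₀
  set A : Matrix (Fin n) (Fin n) O.GammaCon := Matrix.of fun i j => b₀.repr (M.F (b₀ j)) i
  obtain ⟨q, hq⟩ := ((isUnit_natCast_p (O := O)).pow l).exists_right_inv
  have hAC : A.map (algebraMap O.GammaCon O.GammaAnCon) *
      (q • B.map (algebraMap O.GammaCon O.GammaAnCon)) = 1 := by
    rw [Matrix.mul_smul, ← Matrix.map_mul, hAB]
    ext1 i j
    simp only [Matrix.smul_apply, Matrix.map_apply, Matrix.scalar_apply, Matrix.diagonal_apply,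
      Matrix.one_apply]
    split_ifs
    · rw [map_pow, map_natCast, smul_eq_mul, mul_comm, hq]
    · rw [map_zero, smul_zero]
  obtain ⟨X, Y, Z, hXY, hZ, hYA⟩ := h.exists_const_conj
    ((hMA.baseChange O.frobAnCon O.algebraMap_frobCon).trans
      (ofMatrix_baseChange_iso O.frobAnCon O.algebraMap_frobCon A)) hAC
  obtain ⟨b, b', s, A₁, B₁, hbb', hbA, hAB₁⟩ :=
    exists_omega_matrix (mul_eq_one_comm.mp hXY) hZ hAB hYA
  have hp0 : ∀ m, (p : O.Omega) ^ m ≠ 0 := fun m h0 =>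
    natCast_p_pow_ne_zero (O := O) m (by
      have := congrArg Subtype.val h0
      simpa using this)
  have hb'b := Matrix.mul_eq_scalar_comm (natCast_p_pow_ne_zero s) hbb'
  refine ⟨ofMatrix O.frobOmega A₁,
    isFCrystal_ofMatrix p hAB₁ (Matrix.mul_eq_scalar_comm (hp0 l) hAB₁), ?_⟩
  refine IsIsogenous.of_iso ?_
    (ofMatrix_baseChange_iso O.frobCon O.algebraMap_frobOmega A₁).symm hMA.symm
  rw [isIsogenous_ofMatrix_iff]
  -- The basis matrix and its inverse up to `p^s` are the two morphisms of the isogeny.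
  -- Compatibility of `b'` with Frobenius follows from that of `b` by cancelling `b` on the left.
  refine ⟨b, b', (p : O.GammaCon) ^ s, hbA, ?_, natCast_p_pow_ne_zero s, hb'b, hbb'⟩
  refine Matrix.cancel_left_of_mul_eq_scalar (natCast_p_pow_ne_zero s) hb'b ?_
  have e : b.map O.frobCon * b'.map O.frobCon = Matrix.scalar _ ((p : O.GammaCon) ^ s) := by
    rw [← Matrix.map_mul, hbb', Matrix.scalar_apply, Matrix.diagonal_map (map_zero _)]
    simp
  rw [← Matrix.mul_assoc, ← Matrix.mul_assoc, hbA, Matrix.mul_assoc A, e, hbb',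
    (Matrix.scalar_commute _ (Commute.all _) A).eq]

end

end OverconvergentCrystal

end

theorem theorem4p1 {p : ℕ} [Fact p.Prime] {k : Type v} [Field k] [IsAlgClosed k] [CharP k p]
    (O : OverconvergentCrystal.CoeffRing.{u, v} p k)
    (M : OverconvergentCrystal.FModule O.GammaCon O.frobCon) (hM : M.IsFCrystal p) :
    OverconvergentCrystal.IsSemistable M ↔
      OverconvergentCrystal.IsConstant (M.baseChange O.frobAnCon O.algebraMap_frobCon) :=
  ⟨fun h => h.isConstant, fun h => h.isSemistable hM⟩
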